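/- Let $X=\prod_{i=1}^d[\mathrm{lo}_i,\mathrm{hi}_i]\subset\mathbb{R}^d$ be a hyperrectangle with $\mathrm{lo}_i<\mathrm{hi}_i$, let $t_0\le t_1$ and $\varepsilon>0$, and let $b=b(t,x)\in\mathbb{R}^d$ be a vector field that is continuous on $[t_0,t_1]\times X$ and, for every $t\in[t_0,t_1]$, locally Lipschitz on $X$ and divergence-free ($\operatorname{div} b(t,\cdot)=0$ a.e. on $X$). Consider the Fokker--Planck equation $$\partial_t u=\tfrac{\varepsilon^2}{2}\Delta u-\operatorname{div}(ub)\quad\text{on }[t_0,t_1]\times X,\qquad u(t_0,\cdot)=u_0,$$ either with periodic boundary conditions, in which case $b(t,\cdot)$ is assumed periodic with respect to $X$, or with homogeneous Neumann boundary conditions, in which case $b(t,\cdot)$ is assumed tangential to the faces of $X$. A weak solution is a function $u\in C([t_0,t_1];L^2(X))\cap L^2(t_0,t_1;H)$, where $H$ is the periodic Sobolev space $H^1_{\mathrm{per}}(X)$, respectively $H^1(X)$, with $$\int_X u(t)\,w-\int_X u_0\,w=\int_{t_0}^t\Bigl(-\tfrac{\varepsilon^2}{2}\int_X\nabla u\cdot\nabla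 w+\int_X u\,b\cdot\nabla w\Bigr)ds$$ for all $t\in[t_0,t_1]$ and all periodic $w\in C^\infty(\mathbb{R}^d)$, respectively all $w\in C^\infty(\mathbb{R}^d)$. Then for every $u_0\in L^2(X)$ there is exactly one weak solution $u$, and $\mathcal{P}^\varepsilon u_0:=u(t_1,\cdot)$ defines a bounded linear operator $\mathcal{P}^\varepsilon:L^2(X)\to L^2(X)$. Both $\mathcal{P}^\varepsilon$ and its adjoint $\mathcal{P}^{\varepsilon,*}:L^2(X)\to L^2(X)$ are stochastic: each maps a.e. non-negative functions to a.e. non-negative functions and fixes the constant function $1_X$. -/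

import Mathlib

open MeasureTheory Set
open scoped ContDiff

namespace FokkerPlanck

/-- The two boundary conditions on the hyperrectangle `[lo, hi]`. -/
inductive BoundaryCondition
  | periodic
  | neumann

/-- `L²(X, m)` for the hyperrectangle `X = ∏ᵢ [loᵢ, hiᵢ]` with Lebesgue measure `m`. -/
abbrev L2 {d : ℕ} (lo hi : Fin d → ℝ) : Type :=
  Lp ℝ 2 (volume.restrict (Icc lo hi))

/-- The classical partial derivative `∂ⱼ f (x)`. -/
noncomputable def pderiv {d : ℕ} (j : Fin d) (f : (Fin d → ℝ) → ℝ) (x : Fin d → ℝ) : ℝ :=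
  fderiv ℝ f x (Pi.single j 1)

/-- `f` is periodic with period `hiᵢ - loᵢ` in the `i`-th coordinate, for every `i`. -/
def IsPeriodic {d : ℕ} {F : Type*} (lo hi : Fin d → ℝ) (f : (Fin d → ℝ) → F) : Prop :=
  ∀ (i : Fin d) (x : Fin d → ℝ), f (x + Pi.single i (hi i - lo i)) = f x

/-- Test functions of the weak formulation: smooth periodic functions for periodic boundary
conditions, all functions smooth up to the boundary for (natural) Neumann conditions. -/
def IsTestFunction {d : ℕ} (bc : BoundaryCondition) (lo hi : Fin d → ℝ)
    (w : (Fin d → ℝ) → ℝ) : Prop :=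
  ContDiff ℝ ∞ w ∧
    match bc with
    | .periodic => IsPeriodic lo hi w
    | .neumann => True

/-- Test functions that define weak derivatives: smooth periodic functions (this gives the periodic
Sobolev space), respectively smooth functions compactly supported in the interior of `X`
(this gives `H¹(X)`). -/
def IsDerivTestFunction {d : ℕ} (bc : BoundaryCondition) (lo hi : Fin d → ℝ)
    (φ : (Fin d → ℝ) → ℝ) : Prop :=
  ContDiff ℝ ∞ φ ∧
    match bc with
    | .periodic => IsPeriodic lo hi φ
    | .neumann => HasCompactSupport φ ∧ tsupport φ ⊆ interior (Icc lo hi)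

/-- `g` is the weak partial derivative `∂ⱼ v` of `v` on `X` (on the torus, if `bc` is periodic). -/
def IsWeakPartial {d : ℕ} (bc : BoundaryCondition) (lo hi : Fin d → ℝ) (j : Fin d)
    (v g : L2 lo hi) : Prop :=
  ∀ φ : (Fin d → ℝ) → ℝ, IsDerivTestFunction bc lo hi φ →
    ∫ x in Icc lo hi, v x * pderiv j φ x = -∫ x in Icc lo hi, g x * φ x

/-- The assumptions on the vector field `b` on `[t₀, t₁] × X`: it is continuous, locally Lipschitz
in space and divergence free (by Rademacher's theorem the classical divergence exists almost
everywhere), and compatible with the boundary condition: periodic in space, respectively tangential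
to the faces of `X`. -/
structure IsDivFreeField {d : ℕ} (bc : BoundaryCondition) (lo hi : Fin d → ℝ) (t₀ t₁ : ℝ)
    (b : ℝ → (Fin d → ℝ) → (Fin d → ℝ)) : Prop where
  continuousOn : ContinuousOn (Function.uncurry b) (Icc t₀ t₁ ×ˢ Icc lo hi)
  locallyLipschitzOn : ∀ t ∈ Icc t₀ t₁, LocallyLipschitzOn (Icc lo hi) (b t)
  div_eq_zero : ∀ t ∈ Icc t₀ t₁, ∀ᵐ x ∂(volume.restrict (Icc lo hi)),
    ∑ i, fderiv ℝ (b t) x (Pi.single i 1) i = 0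
  boundary : ∀ t ∈ Icc t₀ t₁,
    match bc with
    | .periodic => IsPeriodic lo hi (b t)
    | .neumann => ∀ x ∈ Icc lo hi, ∀ i, x i = lo i ∨ x i = hi i → b t x i = 0

/-- `u` is a weak solution on `[t₀, t₁]` of `∂ₜ u = (ε² / 2) Δ u - div (u b)`, `u(t₀) = u₀`, with the
boundary condition `bc`: `u ∈ C([t₀, t₁]; L²) ∩ L²(t₀, t₁; H¹)` with weak gradient `g`, and the
equation, tested with `w`, holds in time-integrated form. -/
structure IsWeakSolution {d : ℕ} (bc : BoundaryCondition) (lo hi : Fin d → ℝ) (t₀ t₁ ε : ℝ)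
    (b : ℝ → (Fin d → ℝ) → (Fin d → ℝ)) (u₀ : L2 lo hi) (u : ℝ → L2 lo hi) : Prop where
  continuousOn : ContinuousOn u (Icc t₀ t₁)
  initial : u t₀ = u₀
  weak : ∃ g : Fin d → ℝ → L2 lo hi,
    (∀ j, MemLp (g j) 2 (volume.restrict (Icc t₀ t₁))) ∧
    (∀ᵐ t ∂(volume.restrict (Icc t₀ t₁)), ∀ j, IsWeakPartial bc lo hi j (u t) (g j t)) ∧
    ∀ w : (Fin d → ℝ) → ℝ, IsTestFunction bc lo hi w → ∀ t ∈ Icc t₀ t₁,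
      (∫ x in Icc lo hi, u t x * w x) - ∫ x in Icc lo hi, u₀ x * w x =
        ∫ s in t₀..t,
          (-(ε ^ 2 / 2) * ∑ j, ∫ x in Icc lo hi, g j s x * pderiv j w x)
            + ∑ j, ∫ x in Icc lo hi, u s x * b s x j * pderiv j w x

/-- `P` is the transfer operator `P^ε`: for every `u₀ ∈ L²` the Fokker-Planck equation has one and
only one weak solution `u` on `[t₀, t₁]` with `u(t₀) = u₀`, and `P u₀ = u(t₁)`. -/
def IsTransferOperator {d : ℕ} (bc : BoundaryCondition) (lo hi : Fin d → ℝ) (t₀ t₁ ε : ℝ)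
    (b : ℝ → (Fin d → ℝ) → (Fin d → ℝ)) (P : L2 lo hi →L[ℝ] L2 lo hi) : Prop :=
  ∀ u₀ : L2 lo hi, ∃ u : ℝ → L2 lo hi,
    IsWeakSolution bc lo hi t₀ t₁ ε b u₀ u ∧
    (∀ v : ℝ → L2 lo hi, IsWeakSolution bc lo hi t₀ t₁ ε b u₀ v → EqOn v u (Icc t₀ t₁)) ∧
    P u₀ = u t₁

/-- The constant function `1_X` as an element of `L²(X)`. -/
noncomputable def one {d : ℕ} (lo hi : Fin d → ℝ) : L2 lo hi :=
  indicatorConstLp 2 (s := Icc lo hi) measurableSet_Icc isCompact_Icc.measure_lt_top.ne 1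

/-- A stochastic operator: it maps (a.e.) non-negative functions to non-negative functions and
fixes the constant function `1_X`. -/
def IsStochastic {d : ℕ} {lo hi : Fin d → ℝ} (T : L2 lo hi →L[ℝ] L2 lo hi) : Prop :=
  (∀ f : L2 lo hi, 0 ≤ f → 0 ≤ T f) ∧ T (one lo hi) = one lo hi

end FokkerPlanck

/-! With either boundary condition, products of one-dimensional trigonometric functions form an
orthonormal basis `e k` of L² that diagonalises the Laplacian, and their gradients `f k` are again
orthogonal. Write ν = ε²/2 and B u = u b. Testing with `e k` turns the equation into the system y_k'
= -ν ‖f k‖² y_k + ⟪f k, B u⟫ for the coefficients y_k of u, which is `IsHeatSolution`. This system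
is equivalent to the weak formulation (`IsWeakSolution.isHeatSolution`,
`IsHeatSolution.isWeakSolution`): gradients of test functions are series in the `f k`
(`Modes.hasSum_gradL2`), and weak derivatives may be tested with the partial derivatives of `e k`
(`Modes.integral_weakPartial_mul_pderiv_eig`).

Well-posedness. The energy estimate for each scalar equation, summed with Bessel's inequality for
the `f k`, bounds ‖u‖² and the dissipation by the initial value and the time integral of ‖B u‖².
Since B is a continuous family of bounded operators, Gronwall's inequality gives uniqueness and
boundedness, and Picard iteration gives existence (`exists_modal_solution`). The dissipation bound
yields the weak gradient (`IsHeatSolution.exists_gradient`).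

Positivity. For a smooth convex entropy j, diffusion decreases ∫ j(u), and a divergence-free drift
leaves it unchanged because u b · ∇j'(u) = b · ∇G(u) with G'(r) = r j''(r). To avoid a chain rule
for weak solutions, the computation is done for the smooth partial sums of the expansion of u; the
resulting error is absorbed by the dissipation and tends to 0 (`Modes.sum_coeff_mul_inner_le`,
`IsHeatSolution.integral_comp_le`). Taking j(s) = √(s² + δ²) and δ → 0, the L¹ norm does not
increase. Mass is conserved, so for u₀ ≥ 0 one has ∫ |u| ≤ ∫ u₀ = ∫ u, and u ≥ 0.

The operator fixes 1 because the constant is a stationary solution, which uses that b is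
divergence-free and compatible with the boundary. Its adjoint is positive by duality and fixes 1 by
conservation of mass (`isStochastic_adjoint`). -/

open Filter Topology
open scoped RealInnerProductSpace

namespace FokkerPlanck

/-! ### Orthogonal families that are not normalised -/

section OrthogonalFamilies

variable {K G : Type*} [NormedAddCommGroup G] [InnerProductSpace ℝ G] {f : K → G}

lemma norm_sq_sum_smul_of_orthogonal (hf : Pairwise fun k l => ⟪f k, f l⟫ = 0) (S : Finset K)
    (c : K → ℝ) : ‖∑ k ∈ S, c k • f k‖ ^ 2 = ∑ k ∈ S, c k ^ 2 * ‖f k‖ ^ 2 := by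
  classical
  induction S using Finset.induction_on with
  | empty => simp
  | insert a S ha ih =>
    rw [Finset.sum_insert ha, Finset.sum_insert ha, norm_add_sq_real, ih, inner_sum,
      Finset.sum_eq_zero, norm_smul, mul_pow, Real.norm_eq_abs, sq_abs]
    · ring
    · intro k hk
      have hne : a ≠ k := fun h => ha (h ▸ hk)
      simp [inner_smul_left, inner_smul_right, hf hne]

lemma inner_sum_smul_of_orthogonal (hf : Pairwise fun k l => ⟪f k, f l⟫ = 0) {S : Finset K}
    (c : K → ℝ) {l : K} (hl : l ∈ S) : ⟪f l, ∑ k ∈ S, c k • f k⟫ = c l * ‖f l‖ ^ 2 := by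
  rw [inner_sum, Finset.sum_eq_single l]
  · simp [inner_smul_right]
  · intro k _ hk
    simp [inner_smul_right, hf hk.symm]
  · exact fun h => absurd hl h

/-- Bessel's inequality for an orthogonal family that is not normalised. -/
lemma sum_inner_sq_div_le (hf : Pairwise fun k l => ⟪f k, f l⟫ = 0) (S : Finset K) (v : G) :
    ∑ k ∈ S, ⟪f k, v⟫ ^ 2 / ‖f k‖ ^ 2 ≤ ‖v‖ ^ 2 := by
  set c : K → ℝ := fun k => ⟪f k, v⟫ / ‖f k‖ ^ 2
  -- The constant mode has zero gradient, so `f k = 0` does occur; division by zero then makes both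
  -- sides 0.
  have hterm : ∀ k, c k ^ 2 * ‖f k‖ ^ 2 = ⟪f k, v⟫ ^ 2 / ‖f k‖ ^ 2 := by
    intro k
    by_cases h : ‖f k‖ = 0
    · simp [c, h]
    · simp only [c]; field_simp
  have h1 : ‖∑ k ∈ S, c k • f k‖ ^ 2 = ∑ k ∈ S, ⟪f k, v⟫ ^ 2 / ‖f k‖ ^ 2 := by
    rw [norm_sq_sum_smul_of_orthogonal hf]
    exact Finset.sum_congr rfl fun k _ => hterm k
  have h2 : ⟪v, ∑ k ∈ S, c k • f k⟫ = ∑ k ∈ S, ⟪f k, v⟫ ^ 2 / ‖f k‖ ^ 2 := by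
    rw [inner_sum]
    refine Finset.sum_congr rfl fun k _ => ?_
    rw [inner_smul_right, real_inner_comm]
    simp only [c]; ring
  have h3 := norm_sub_sq_real v (∑ k ∈ S, c k • f k)
  nlinarith [sq_nonneg ‖v - ∑ k ∈ S, c k • f k‖]

lemma summable_inner_sq_div (hf : Pairwise fun k l => ⟪f k, f l⟫ = 0) (v : G) :
    Summable fun k => ⟪f k, v⟫ ^ 2 / ‖f k‖ ^ 2 :=
  summable_of_sum_le (fun _ => by positivity) fun S => sum_inner_sq_div_le hf S v

lemma summable_smul_of_orthogonal [CompleteSpace G] (hf : Pairwise fun k l => ⟪f k, f l⟫ = 0)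
    {c : K → ℝ} (hc : Summable fun k => c k ^ 2 * ‖f k‖ ^ 2) : Summable fun k => c k • f k := by
  rw [summable_iff_vanishing_norm] at hc ⊢
  intro ε hε
  obtain ⟨S, hS⟩ := hc (ε ^ 2) (by positivity)
  refine ⟨S, fun T hT => ?_⟩
  have h := hS T hT
  rw [← norm_sq_sum_smul_of_orthogonal hf, Real.norm_eq_abs, abs_of_nonneg (by positivity)] at h
  exact lt_of_pow_lt_pow_left₀ 2 hε.le h

lemma norm_sq_tsum_smul_of_orthogonal [CompleteSpace G]
    (hf : Pairwise fun k l => ⟪f k, f l⟫ = 0) {c : K → ℝ}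
    (hc : Summable fun k => c k ^ 2 * ‖f k‖ ^ 2) :
    ‖∑' k, c k • f k‖ ^ 2 = ∑' k, c k ^ 2 * ‖f k‖ ^ 2 := by
  have h1 := (((summable_smul_of_orthogonal hf hc).hasSum).norm).pow 2
  simp only [norm_sq_sum_smul_of_orthogonal hf] at h1
  exact tendsto_nhds_unique h1 hc.hasSum

end OrthogonalFamilies

/-! ### The scalar equation y' = -κ y + F -/

section ScalarEquation

lemma hasDerivAt_of_integral_eq {y F : ℝ → ℝ} {t₀ t₁ κ y₀ : ℝ} (hy : Continuous y)
    (hF : Continuous F)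
    (heq : ∀ t ∈ Icc t₀ t₁, y t = y₀ + ∫ s in t₀..t, (-κ * y s + F s)) {t : ℝ}
    (ht : t ∈ Ioo t₀ t₁) : HasDerivAt y (-κ * y t + F t) t := by
  have hc : Continuous fun s => -κ * y s + F s := by fun_prop
  have h : HasDerivAt (fun t => y₀ + ∫ s in t₀..t, (-κ * y s + F s)) (-κ * y t + F t) t :=
    (intervalIntegral.integral_hasDerivAt_right (hc.intervalIntegrable _ _)
      (hc.stronglyMeasurableAtFilter _ _) hc.continuousAt).const_add y₀
  exact h.congr_of_eventuallyEq
    (eventually_of_mem (Ioo_mem_nhds ht.1 ht.2) fun s hs => heq s (Ioo_subset_Icc_self hs))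

/-- The energy estimate for the scalar equation `y' = -κ y + F`. -/
lemma sq_add_integral_sq_le {y F : ℝ → ℝ} {t₀ t₁ κ y₀ : ℝ} (hy : Continuous y)
    (hF : Continuous F) (hκ : 0 ≤ κ) (hF0 : κ = 0 → ∀ s, F s = 0)
    (heq : ∀ t ∈ Icc t₀ t₁, y t = y₀ + ∫ s in t₀..t, (-κ * y s + F s)) {t : ℝ}
    (ht : t ∈ Icc t₀ t₁) :
    y t ^ 2 + κ * ∫ s in t₀..t, y s ^ 2 ≤ y₀ ^ 2 + ∫ s in t₀..t, F s ^ 2 / κ := by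
  have hc1 : Continuous fun s => y s ^ 2 := by fun_prop
  have hc2 : Continuous fun s => F s ^ 2 / κ := by fun_prop
  have hd : ∀ c : ℝ → ℝ, Continuous c → ∀ t, HasDerivAt (fun t => ∫ s in t₀..t, c s) (c t) t :=
    fun c hc t => intervalIntegral.integral_hasDerivAt_right (hc.intervalIntegrable _ _)
      (hc.stronglyMeasurableAtFilter _ _) hc.continuousAt
  set h : ℝ → ℝ := fun t => y t ^ 2 + κ * (∫ s in t₀..t, y s ^ 2) - ∫ s in t₀..t, F s ^ 2 / κ
  have hder : ∀ t ∈ Ioo t₀ t₁, HasDerivAt h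
      (2 * y t * (-κ * y t + F t) + κ * y t ^ 2 - F t ^ 2 / κ) t := by
    intro t ht
    have := (((hasDerivAt_of_integral_eq hy hF heq ht).pow 2).add
      ((hd _ hc1 t).const_mul κ)).sub (hd _ hc2 t)
    convert! this using 1
    norm_num
  have hcont : Continuous h := by
    have h1 : Continuous fun t => ∫ s in t₀..t, y s ^ 2 :=
      continuous_iff_continuousAt.2 fun t => (hd _ hc1 t).continuousAt
    have h2 : Continuous fun t => ∫ s in t₀..t, F s ^ 2 / κ :=
      continuous_iff_continuousAt.2 fun t => (hd _ hc2 t).continuousAt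
    fun_prop
  have hanti : AntitoneOn h (Icc t₀ t₁) := by
    refine antitoneOn_of_deriv_nonpos (convex_Icc _ _) hcont.continuousOn ?_ ?_
    · intro t ht
      rw [interior_Icc] at ht
      exact (hder t ht).differentiableAt.differentiableWithinAt
    · intro t ht
      rw [interior_Icc] at ht
      rw [(hder t ht).deriv]
      -- For κ = 0 the forcing vanishes and so does the derivative of `h` (with `F s ^ 2 / 0 = 0`).
      -- For κ > 0 the derivative is minus a complete square.
      rcases hκ.eq_or_lt with h0 | h0
      · simp [hF0 h0.symm, ← h0]
      · have : 2 * y t * (-κ * y t + F t) + κ * y t ^ 2 - F t ^ 2 / κ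
            = -((κ * y t - F t) ^ 2 / κ) := by field_simp; ring
        rw [this]
        exact neg_nonpos.2 (by positivity)
  have h0 : t₀ ∈ Icc t₀ t₁ := ⟨le_rfl, ht.1.trans ht.2⟩
  have hle := hanti h0 ht ht.1
  have hy0 : y t₀ = y₀ := by simpa using heq t₀ h0
  simp only [h, intervalIntegral.integral_same, hy0] at hle
  linarith

/-- Solvability of the scalar equation `y' = -κ y + F`. -/
lemma exists_integral_eq {F : ℝ → ℝ} (t₀ κ y₀ : ℝ) (hF : Continuous F) :
    ∃ y : ℝ → ℝ, Continuous y ∧ ∀ t, y t = y₀ + ∫ s in t₀..t, (-κ * y s + F s) := by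
  have hc : Continuous fun s => Real.exp (κ * s) * F s := by fun_prop
  set y : ℝ → ℝ := fun t => Real.exp (-κ * t) *
    (Real.exp (κ * t₀) * y₀ + ∫ s in t₀..t, Real.exp (κ * s) * F s)
  have hder : ∀ t, HasDerivAt y (-κ * y t + F t) t := by
    intro t
    have h1 : HasDerivAt (fun t => Real.exp (-κ * t)) (Real.exp (-κ * t) * -κ) t := by
      simpa using ((hasDerivAt_id t).const_mul (-κ)).exp
    have h2 : HasDerivAt (fun t => Real.exp (κ * t₀) * y₀ + ∫ s in t₀..t, Real.exp (κ * s) * F s)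
        (Real.exp (κ * t) * F t) t :=
      (intervalIntegral.integral_hasDerivAt_right (hc.intervalIntegrable _ _)
        (hc.stronglyMeasurableAtFilter _ _) hc.continuousAt).const_add _
    convert! h1.mul h2 using 1
    have : Real.exp (-κ * t) * (Real.exp (κ * t) * F t) = F t := by
      rw [← mul_assoc, ← Real.exp_add]; simp
    simp only [y]
    rw [this]; ring
  have hy : Continuous y := continuous_iff_continuousAt.2 fun t => (hder t).continuousAt
  have hy' : Continuous fun s => -κ * y s + F s := by fun_prop
  refine ⟨y, hy, fun t => ?_⟩
  rw [intervalIntegral.integral_eq_sub_of_hasDerivAt (fun s _ => hder s)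
    (hy'.intervalIntegrable _ _)]
  have : y t₀ = y₀ := by
    simp only [y, intervalIntegral.integral_same, add_zero]
    rw [← mul_assoc, ← Real.exp_add]; simp
  rw [this]; ring

end ScalarEquation

/-! ### The modal equation with given forcing -/

section ModalEquation

/-- Gronwall's inequality in integral form. -/
lemma le_mul_exp_of_le_add_integral {a : ℝ → ℝ} {t₀ t₁ c C : ℝ} (ha : Continuous a) (hC : 0 ≤ C)
    (hle : ∀ t ∈ Icc t₀ t₁, a t ≤ c + C * ∫ s in t₀..t, a s) {t : ℝ} (ht : t ∈ Icc t₀ t₁) :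
    a t ≤ c * Real.exp (C * (t - t₀)) := by
  have hd : ∀ t, HasDerivAt (fun t => c + C * ∫ s in t₀..t, a s) (C * a t) t := fun t =>
    ((intervalIntegral.integral_hasDerivAt_right (ha.intervalIntegrable _ _)
      (ha.stronglyMeasurableAtFilter _ _) ha.continuousAt).const_mul C).const_add c
  set z : ℝ → ℝ := fun t => c + C * ∫ s in t₀..t, a s
  have hexp : ∀ t, HasDerivAt (fun t => Real.exp (-C * (t - t₀)))
      (Real.exp (-C * (t - t₀)) * -C) t := fun t => by
    simpa using (((hasDerivAt_id t).sub_const t₀).const_mul (-C)).exp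
  have hprod := fun t => (hd t).mul (hexp t)
  -- Here z' = C a ≤ C z, so z times the decaying exponential is non-increasing.
  have hanti : AntitoneOn (z * fun t => Real.exp (-C * (t - t₀))) (Icc t₀ t₁) := by
    refine antitoneOn_of_deriv_nonpos (convex_Icc _ _)
      (fun t _ => (hprod t).continuousAt.continuousWithinAt)
      (fun t _ => (hprod t).differentiableAt.differentiableWithinAt) fun t ht => ?_
    rw [interior_Icc] at ht
    rw [(hprod t).deriv]
    have h1 := hle t (Ioo_subset_Icc_self ht)
    have h2 := Real.exp_pos (-C * (t - t₀))
    have : C * a t * Real.exp (-C * (t - t₀)) + z t * (Real.exp (-C * (t - t₀)) * -C)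
        = C * Real.exp (-C * (t - t₀)) * (a t - z t) := by ring
    rw [this]
    exact mul_nonpos_of_nonneg_of_nonpos (by positivity) (by simpa [z] using h1)
  have h := hanti ⟨le_rfl, ht.1.trans ht.2⟩ ht ht.1
  have hz0 : z t₀ = c := by simp [z]
  simp only [Pi.mul_apply, sub_self, mul_zero, Real.exp_zero, mul_one, hz0] at h
  have hE : Real.exp (-C * (t - t₀)) * Real.exp (C * (t - t₀)) = 1 := by
    rw [← Real.exp_add]; simp
  calc a t ≤ z t := hle t ht
    _ = z t * Real.exp (-C * (t - t₀)) * Real.exp (C * (t - t₀)) := by rw [mul_assoc, hE, mul_one]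
    _ ≤ c * Real.exp (C * (t - t₀)) := by gcongr

variable {K H G : Type*} [NormedAddCommGroup H] [InnerProductSpace ℝ H]
  [NormedAddCommGroup G] [InnerProductSpace ℝ G]

/-- The equation `u' = -ν ∇* ∇ u + ∇* V`, `u(t₀) = u₀`, in terms of the coefficients of `u` in an
orthonormal basis `e`, where `f k` stands for the gradient `∇ (e k)`. -/
structure IsHeatSolution (e : HilbertBasis K ℝ H) (f : K → G) (ν t₀ t₁ : ℝ) (V : ℝ → G) (u₀ : H)
    (u : ℝ → H) : Prop where
  -- Continuity is required on the whole line, so that integrals need no side conditions; functions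
  -- given on `Icc t₀ t₁` are extended by `projIcc`.
  continuous : Continuous u
  coeff : ∀ k, ∀ t ∈ Icc t₀ t₁, ⟪e k, u t⟫ = ⟪e k, u₀⟫ +
    ∫ s in t₀..t, (-(ν * ‖f k‖ ^ 2) * ⟪e k, u s⟫ + ⟪f k, V s⟫)

variable {e : HilbertBasis K ℝ H} {f : K → G} {ν t₀ t₁ : ℝ} {V V' : ℝ → G} {u₀ v₀ : H}
  {u v : ℝ → H}

lemma hasSum_inner_sq (e : HilbertBasis K ℝ H) (x : H) :
    HasSum (fun k => ⟪e k, x⟫ ^ 2) (‖x‖ ^ 2) := by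
  have := e.hasSum_inner_mul_inner x x
  rw [real_inner_self_eq_norm_sq] at this
  refine this.congr_fun fun k => ?_
  rw [real_inner_comm, sq]

lemma ext_inner_basis (e : HilbertBasis K ℝ H) {x y : H} (h : ∀ k, ⟪e k, x⟫ = ⟪e k, y⟫) :
    x = y := by
  have h1 := hasSum_inner_sq e (x - y)
  have h2 : (fun k => ⟪e k, x - y⟫ ^ 2) = fun _ => 0 := by
    funext k; simp [inner_sub_right, h]
  rw [h2] at h1
  simpa [sub_eq_zero] using h1.unique hasSum_zero

namespace IsHeatSolution

lemma initial (ht : t₀ ≤ t₁) (hu : IsHeatSolution e f ν t₀ t₁ V u₀ u) : u t₀ = u₀ :=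
  ext_inner_basis e fun k => by simpa using hu.coeff k t₀ ⟨le_rfl, ht⟩

lemma add_smul (hu : IsHeatSolution e f ν t₀ t₁ V u₀ u) (hv : IsHeatSolution e f ν t₀ t₁ V' v₀ v)
    (hV : Continuous V) (hV' : Continuous V') (c : ℝ) :
    IsHeatSolution e f ν t₀ t₁ (fun s => V s + c • V' s) (u₀ + c • v₀) (fun s => u s + c • v s)
    where
  continuous := hu.continuous.add (hv.continuous.const_smul c)
  coeff k t ht := by
    have hcu := hu.continuous
    have hcv := hv.continuous
    have h1 : Continuous fun s => -(ν * ‖f k‖ ^ 2) * ⟪e k, u s⟫ + ⟪f k, V s⟫ := by fun_prop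
    have h2 : Continuous fun s => -(ν * ‖f k‖ ^ 2) * ⟪e k, v s⟫ + ⟪f k, V' s⟫ := by fun_prop
    have h3 : (fun s => -(ν * ‖f k‖ ^ 2) * ⟪e k, u s + c • v s⟫ + ⟪f k, V s + c • V' s⟫) =
        fun s => (-(ν * ‖f k‖ ^ 2) * ⟪e k, u s⟫ + ⟪f k, V s⟫) +
          c * (-(ν * ‖f k‖ ^ 2) * ⟪e k, v s⟫ + ⟪f k, V' s⟫) := by
      funext s; simp only [inner_add_right, inner_smul_right]; ring
    rw [h3, intervalIntegral.integral_add (h1.intervalIntegrable _ _)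
      ((h2.const_mul c).intervalIntegrable _ _), intervalIntegral.integral_const_mul]
    simp only [inner_add_right, inner_smul_right, hu.coeff k t ht, hv.coeff k t ht]
    ring

lemma coeff_sq_add_integral_le (hu : IsHeatSolution e f ν t₀ t₁ V u₀ u) (hV : Continuous V)
    (hν : 0 < ν) (k : K) {t : ℝ} (ht : t ∈ Icc t₀ t₁) :
    ⟪e k, u t⟫ ^ 2 + ν * ‖f k‖ ^ 2 * ∫ s in t₀..t, ⟪e k, u s⟫ ^ 2 ≤
      ⟪e k, u₀⟫ ^ 2 + ν⁻¹ * ∫ s in t₀..t, ⟪f k, V s⟫ ^ 2 / ‖f k‖ ^ 2 := by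
  have hcu := hu.continuous
  have h := sq_add_integral_sq_le (y := fun s => ⟪e k, u s⟫) (F := fun s => ⟪f k, V s⟫)
    (κ := ν * ‖f k‖ ^ 2) (by fun_prop) (by fun_prop) (by positivity) ?_ (hu.coeff k) ht
  · refine h.trans_eq ?_
    rw [← intervalIntegral.integral_const_mul]
    congr 2
    funext s
    rw [div_mul_eq_div_div, inv_mul_eq_div, div_right_comm]
  · intro h0 s
    have : f k = 0 := by simpa [hν.ne'] using h0
    simp [this]

lemma sum_integral_le (hf : Pairwise fun k l => ⟪f k, f l⟫ = 0) (hV : Continuous V) (S : Finset K)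
    {t : ℝ} (ht : t₀ ≤ t) :
    ∑ k ∈ S, ∫ s in t₀..t, ⟪f k, V s⟫ ^ 2 / ‖f k‖ ^ 2 ≤ ∫ s in t₀..t, ‖V s‖ ^ 2 := by
  have hc : ∀ k, Continuous fun s => ⟪f k, V s⟫ ^ 2 / ‖f k‖ ^ 2 := fun k => by fun_prop
  rw [← intervalIntegral.integral_finsetSum fun k _ => (hc k).intervalIntegrable _ _]
  refine intervalIntegral.integral_mono_on ht
    ((continuous_finsetSum S fun k _ => hc k).intervalIntegrable _ _)
    (Continuous.intervalIntegrable (by fun_prop) _ _) fun s _ => sum_inner_sq_div_le hf S (V s)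

/-- The damping rate ν ‖f k‖² turns the forcing term F²/κ of the scalar estimate into exactly the
weight of Bessel's inequality. Hence a forcing in divergence form costs only the L² norm of `V`,
with no derivative of `V`. The dissipation term on the left is kept because it later produces the
weak gradient. -/
lemma sum_sq_add_integral_le (hu : IsHeatSolution e f ν t₀ t₁ V u₀ u)
    (hf : Pairwise fun k l => ⟪f k, f l⟫ = 0) (hV : Continuous V) (hν : 0 < ν) (S : Finset K)
    {t : ℝ} (ht : t ∈ Icc t₀ t₁) :
    (∑ k ∈ S, ⟪e k, u t⟫ ^ 2) + ν * ∑ k ∈ S, ‖f k‖ ^ 2 * ∫ s in t₀..t, ⟪e k, u s⟫ ^ 2 ≤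
      ‖u₀‖ ^ 2 + ν⁻¹ * ∫ s in t₀..t, ‖V s‖ ^ 2 := by
  have h1 := Finset.sum_le_sum fun k (_ : k ∈ S) => hu.coeff_sq_add_integral_le hV hν k ht
  rw [Finset.sum_add_distrib, Finset.sum_add_distrib] at h1
  simp only [mul_assoc ν] at h1
  rw [← Finset.mul_sum, ← Finset.mul_sum] at h1
  have h2 := sum_le_hasSum S (fun k _ => sq_nonneg _) (hasSum_inner_sq e u₀)
  have h3 := mul_le_mul_of_nonneg_left (sum_integral_le hf hV S ht.1) (inv_nonneg.2 hν.le)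
  linarith

lemma norm_sq_le (hu : IsHeatSolution e f ν t₀ t₁ V u₀ u)
    (hf : Pairwise fun k l => ⟪f k, f l⟫ = 0) (hV : Continuous V) (hν : 0 < ν) {t : ℝ}
    (ht : t ∈ Icc t₀ t₁) : ‖u t‖ ^ 2 ≤ ‖u₀‖ ^ 2 + ν⁻¹ * ∫ s in t₀..t, ‖V s‖ ^ 2 := by
  refine (hasSum_le_of_sum_le (hasSum_inner_sq e (u t))) fun S => ?_
  have h := hu.sum_sq_add_integral_le hf hV hν S ht
  have : 0 ≤ ν * ∑ k ∈ S, ‖f k‖ ^ 2 * ∫ s in t₀..t, ⟪e k, u s⟫ ^ 2 :=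
    mul_nonneg hν.le (Finset.sum_nonneg fun k _ => mul_nonneg (by positivity)
      (intervalIntegral.integral_nonneg ht.1 fun s _ => sq_nonneg _))
  linarith

end IsHeatSolution

/-- Continuous functions with prescribed coefficients, uniformly dominated in `ℓ²`. -/
lemma exists_continuous_of_coeff_sq_le [CompleteSpace H] (e : HilbertBasis K ℝ H) {y : K → ℝ → ℝ}
    {a : K → ℝ} (hy : ∀ k, Continuous (y k)) (hya : ∀ k t, y k t ^ 2 ≤ a k) (ha : Summable a) :
    ∃ u : ℝ → H, Continuous u ∧ ∀ k t, ⟪e k, u t⟫ = y k t := by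
  classical
  have ho : Pairwise fun k l => ⟪e k, e l⟫ = 0 := e.orthonormal.2
  have h1 : ∀ k, ‖e k‖ = 1 := e.orthonormal.1
  have hs : ∀ t, Summable fun k => y k t • e k := fun t => by
    refine summable_smul_of_orthogonal ho ?_
    simpa [h1] using Summable.of_nonneg_of_le (fun k => sq_nonneg _) (fun k => hya k t) ha
  refine ⟨fun t => ∑' k, y k t • e k, ?_, fun k t => ?_⟩
  · have hunif : TendstoUniformly (fun (S : Finset K) t => ∑ k ∈ S, y k t • e k)
        (fun t => ∑' k, y k t • e k) atTop := by
      rw [Metric.tendstoUniformly_iff]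
      intro ε hε
      obtain ⟨S₀, hS₀⟩ := summable_iff_vanishing_norm.1 ha ((ε / 2) ^ 2) (by positivity)
      filter_upwards [eventually_ge_atTop S₀] with S hS t
      have hlim := ((hs t).hasSum.sub_const (∑ k ∈ S, y k t • e k)).norm
      have hle : ‖(∑' k, y k t • e k) - ∑ k ∈ S, y k t • e k‖ ≤ ε / 2 := by
        refine le_of_tendsto hlim ?_
        filter_upwards [eventually_ge_atTop S] with T hT
        rw [← Finset.sum_sdiff hT, add_sub_cancel_right]
        refine (pow_le_pow_iff_left₀ (norm_nonneg _) (by positivity) two_ne_zero).1 ?_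
        rw [norm_sq_sum_smul_of_orthogonal ho]
        -- The tail is bounded by a tail of the series of `a`, which does not depend on `t`; this
        -- makes the convergence uniform.
        have hd : Disjoint (T \ S) S₀ := Finset.sdiff_disjoint.mono_right hS
        calc ∑ k ∈ T \ S, y k t ^ 2 * ‖e k‖ ^ 2 ≤ ∑ k ∈ T \ S, a k :=
              Finset.sum_le_sum fun k _ => by simpa [h1] using hya k t
          _ ≤ ‖∑ k ∈ T \ S, a k‖ := Real.le_norm_self _
          _ ≤ (ε / 2) ^ 2 := (hS₀ _ hd).le
      rw [dist_eq_norm]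
      linarith
    exact hunif.continuous (Frequently.of_forall fun S =>
      continuous_finsetSum S fun k _ => (hy k).smul continuous_const)
  · have h2 := (hs t).hasSum.mapL (innerSL ℝ (e k))
    have h3 := hasSum_single (f := fun l => innerSL ℝ (e k) (y l t • e l)) k fun l hl => by
      simp [ho hl.symm]
    simpa [inner_smul_right, h1] using h2.unique h3

/-- The scalar equations are solved one by one. The scalar energy estimate bounds the squared
coefficients on the interval by numbers `a k` independent of time, and these are summable by
Bessel's inequality, so the coefficients assemble to a continuous curve. -/
lemma exists_isHeatSolution [CompleteSpace H] (e : HilbertBasis K ℝ H)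
    (hf : Pairwise fun k l => ⟪f k, f l⟫ = 0) (hν : 0 < ν) (ht : t₀ ≤ t₁) (hV : Continuous V)
    (u₀ : H) : ∃ u, IsHeatSolution e f ν t₀ t₁ V u₀ u := by
  have hF : ∀ k, Continuous fun s => ⟪f k, V s⟫ := fun k => by fun_prop
  choose y hyc hy using fun k => exists_integral_eq t₀ (ν * ‖f k‖ ^ 2) ⟪e k, u₀⟫ (hF k)
  set a : K → ℝ := fun k => ⟪e k, u₀⟫ ^ 2 + ν⁻¹ * ∫ s in t₀..t₁, ⟪f k, V s⟫ ^ 2 / ‖f k‖ ^ 2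
  have hcq : ∀ k, Continuous fun s => ⟪f k, V s⟫ ^ 2 / ‖f k‖ ^ 2 := fun k => by fun_prop
  have ha : Summable a := by
    refine (hasSum_inner_sq e u₀).summable.add (Summable.mul_left _ ?_)
    exact summable_of_sum_le (fun k => intervalIntegral.integral_nonneg ht fun s _ => by positivity)
      fun S => IsHeatSolution.sum_integral_le hf hV S ht
  have hya : ∀ k, ∀ t ∈ Icc t₀ t₁, y k t ^ 2 ≤ a k := by
    intro k t htt
    have h := sq_add_integral_sq_le (hyc k) (hF k) (κ := ν * ‖f k‖ ^ 2) (by positivity) (fun h0 s => by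
      have : f k = 0 := by simpa [hν.ne'] using h0
      simp [this]) (fun t _ => hy k t) htt
    have h1 : 0 ≤ ν * ‖f k‖ ^ 2 * ∫ s in t₀..t, y k s ^ 2 :=
      mul_nonneg (by positivity) (intervalIntegral.integral_nonneg htt.1 fun s _ => sq_nonneg _)
    have h2 : ∫ s in t₀..t, ⟪f k, V s⟫ ^ 2 / (ν * ‖f k‖ ^ 2) =
        ν⁻¹ * ∫ s in t₀..t, ⟪f k, V s⟫ ^ 2 / ‖f k‖ ^ 2 := by
      rw [← intervalIntegral.integral_const_mul]
      congr 1
      funext s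
      rw [div_mul_eq_div_div, inv_mul_eq_div, div_right_comm]
    have h3 : ∫ s in t₀..t, ⟪f k, V s⟫ ^ 2 / ‖f k‖ ^ 2 ≤ ∫ s in t₀..t₁, ⟪f k, V s⟫ ^ 2 / ‖f k‖ ^ 2 :=
      intervalIntegral.integral_mono_interval le_rfl htt.1 htt.2
        (Eventually.of_forall fun s => by positivity) ((hcq k).intervalIntegrable _ _)
    have h4 := mul_le_mul_of_nonneg_left h3 (inv_nonneg.2 hν.le)
    simp only [a]
    linarith
  obtain ⟨u, huc, hu⟩ := exists_continuous_of_coeff_sq_le e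
    -- Outside the interval the coefficients are frozen at their end values, since the bound by `a
    -- k` is only known inside.
    (y := fun k t => y k (projIcc t₀ t₁ ht t)) (a := a)
    (fun k => (hyc k).comp (continuous_subtype_val.comp continuous_projIcc))
    (fun k t => hya k _ (projIcc t₀ t₁ ht t).2) ha
  have hu' : ∀ k, ∀ t ∈ Icc t₀ t₁, ⟪e k, u t⟫ = y k t := fun k t htt => by
    rw [hu, projIcc_of_mem ht htt]
  refine ⟨u, huc, fun k t htt => ?_⟩
  rw [hu' k t htt, hy k t]
  congr 1
  refine intervalIntegral.integral_congr fun s hs => ?_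
  rw [uIcc_of_le htt.1] at hs
  simp only [hu' k s ⟨hs.1, hs.2.trans htt.2⟩]

end ModalEquation

/-! ### The modal equation with a bounded drift operator; the weak gradient -/

section ModalEquation

variable {K H G : Type*} [NormedAddCommGroup H] [InnerProductSpace ℝ H]
  [NormedAddCommGroup G] [InnerProductSpace ℝ G]
  {e : HilbertBasis K ℝ H} {f : K → G} {ν t₀ t₁ : ℝ} {V : ℝ → G} {B : ℝ → H →L[ℝ] G} {u₀ : H}
  {u v : ℝ → H}

lemma exists_norm_clm_le (hB : Continuous B) (t₀ t₁ : ℝ) :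
    ∃ M, 0 ≤ M ∧ ∀ s ∈ Icc t₀ t₁, ∀ x, ‖B s x‖ ≤ M * ‖x‖ := by
  obtain ⟨M, hM⟩ := (isCompact_Icc (a := t₀) (b := t₁)).exists_bound_of_continuousOn
    hB.continuousOn
  refine ⟨max M 0, le_max_right _ _, fun s hs x => (B s).le_of_opNorm_le ?_ x⟩
  exact (hM s hs).trans (le_max_left _ _)

lemma integral_norm_clm_sq_le {M : ℝ} (hB : Continuous B)
    (hM : ∀ s ∈ Icc t₀ t₁, ∀ x, ‖B s x‖ ≤ M * ‖x‖) (hu : Continuous u) {t : ℝ}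
    (ht : t ∈ Icc t₀ t₁) :
    ∫ s in t₀..t, ‖B s (u s)‖ ^ 2 ≤ M ^ 2 * ∫ s in t₀..t, ‖u s‖ ^ 2 := by
  rw [← intervalIntegral.integral_const_mul]
  refine intervalIntegral.integral_mono_on ht.1 (Continuous.intervalIntegrable (by fun_prop) _ _)
    (Continuous.intervalIntegrable (by fun_prop) _ _) fun s hs => ?_
  rw [← mul_pow]
  gcongr
  exact hM s ⟨hs.1, hs.2.trans ht.2⟩ _

/-- Solutions of the modal equation are bounded by their initial values. -/
lemma exists_norm_le_of_isHeatSolution (e : HilbertBasis K ℝ H)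
    (hf : Pairwise fun k l => ⟪f k, f l⟫ = 0) (hν : 0 < ν) (hB : Continuous B) (t₀ t₁ : ℝ) :
    ∃ C, ∀ u₀ u, IsHeatSolution e f ν t₀ t₁ (fun s => B s (u s)) u₀ u →
      ∀ t ∈ Icc t₀ t₁, ‖u t‖ ≤ C * ‖u₀‖ := by
  obtain ⟨M, hM0, hM⟩ := exists_norm_clm_le hB t₀ t₁
  set D := ν⁻¹ * M ^ 2
  have hD : 0 ≤ D := by positivity
  refine ⟨√(Real.exp (D * (t₁ - t₀))), fun u₀ u hu t ht => ?_⟩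
  have hcu := hu.continuous
  have h := le_mul_exp_of_le_add_integral (a := fun t => ‖u t‖ ^ 2) (c := ‖u₀‖ ^ 2) (C := D)
    (t₀ := t₀) (t₁ := t₁) (by fun_prop) hD (fun t ht => ?_) ht
  · refine (pow_le_pow_iff_left₀ (norm_nonneg _) (by positivity) two_ne_zero).1 ?_
    rw [mul_pow, Real.sq_sqrt (Real.exp_pos _).le, mul_comm]
    refine h.trans ?_
    gcongr
    exact ht.2
  · refine (hu.norm_sq_le hf (by fun_prop) hν ht).trans ?_
    have := mul_le_mul_of_nonneg_left (integral_norm_clm_sq_le hB hM hcu ht) (inv_nonneg.2 hν.le)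
    simp only [D]
    linarith

lemma IsHeatSolution.eqOn (hf : Pairwise fun k l => ⟪f k, f l⟫ = 0) (hν : 0 < ν)
    (hB : Continuous B) (hu : IsHeatSolution e f ν t₀ t₁ (fun s => B s (u s)) u₀ u)
    (hv : IsHeatSolution e f ν t₀ t₁ (fun s => B s (v s)) u₀ v) : EqOn u v (Icc t₀ t₁) := by
  obtain ⟨C, hC⟩ := exists_norm_le_of_isHeatSolution e hf hν hB t₀ t₁
  have hcu := hu.continuous
  have hcv := hv.continuous
  intro t ht
  have h := hu.add_smul hv (by fun_prop) (by fun_prop) (-1)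
  have h' : IsHeatSolution e f ν t₀ t₁ (fun s => B s (u s + (-1 : ℝ) • v s)) (u₀ + (-1 : ℝ) • u₀)
      (fun s => u s + (-1 : ℝ) • v s) := by simpa using h
  have := hC _ _ h' t ht
  simpa [← sub_eq_add_neg, sub_eq_zero] using this

/-- Picard iteration: `T v` solves the equation whose drift is evaluated at `v`. An iterate of `T`
is a contraction on the whole interval, so no subdivision in time is needed. -/
lemma exists_modal_solution [CompleteSpace H] (e : HilbertBasis K ℝ H)
    (hf : Pairwise fun k l => ⟪f k, f l⟫ = 0) (hν : 0 < ν) (ht : t₀ ≤ t₁) (hB : Continuous B)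
    (u₀ : H) : ∃ u, IsHeatSolution e f ν t₀ t₁ (fun s => B s (u s)) u₀ u := by
  obtain ⟨M, hM0, hM⟩ := exists_norm_clm_le hB t₀ t₁
  have hext : ∀ v : C(Icc t₀ t₁, H), Continuous fun s => v (projIcc t₀ t₁ ht s) :=
    fun v => v.continuous.comp continuous_projIcc
  have hV : ∀ v : C(Icc t₀ t₁, H), Continuous fun s => B s (v (projIcc t₀ t₁ ht s)) := fun v => by
    have := hext v
    fun_prop
  choose U hU using fun v : C(Icc t₀ t₁, H) => exists_isHeatSolution e hf hν ht (hV v) u₀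
  set T : C(Icc t₀ t₁, H) → C(Icc t₀ t₁, H) := fun v =>
    ⟨fun t => U v t, (hU v).continuous.comp continuous_subtype_val⟩
  set D := ν⁻¹ * M ^ 2
  -- The difference of two images has initial value 0 and forcing B (v - w).
  have hstep : ∀ v w : C(Icc t₀ t₁, H), ∀ t : Icc t₀ t₁, ‖T v t - T w t‖ ^ 2 ≤
      D * ∫ s in t₀..t, ‖v (projIcc t₀ t₁ ht s) - w (projIcc t₀ t₁ ht s)‖ ^ 2 := by
    intro v w t
    have h := (hU v).add_smul (hU w) (hV v) (hV w) (-1)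
    have h1 := h.norm_sq_le hf ((hV v).add ((hV w).const_smul _)) hν t.2
    have h2 := integral_norm_clm_sq_le hB hM ((hext v).sub (hext w)) t.2
    have h3 := mul_le_mul_of_nonneg_left h2 (inv_nonneg.2 hν.le)
    simp only [neg_smul, one_smul, ← sub_eq_add_neg, sub_self, norm_zero, ← map_sub] at h1
    simp only [T, ContinuousMap.coe_mk, D]
    simp only [Pi.sub_apply] at h3
    refine h1.trans ?_
    linarith
  have hiter : ∀ (n : ℕ) (v w : C(Icc t₀ t₁, H)) (t : Icc t₀ t₁),
      ‖(T^[n] v) t - (T^[n] w) t‖ ^ 2 ≤ (D * (t - t₀)) ^ n / n.factorial * ‖v - w‖ ^ 2 := by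
    intro n v w
    induction n with
    | zero =>
      intro t
      simp only [Function.iterate_zero, id, pow_zero, Nat.factorial_zero, Nat.cast_one, div_one,
        one_mul]
      gcongr
      exact (v - w).norm_coe_le_norm t
    | succ n ih =>
      intro t
      rw [Function.iterate_succ_apply', Function.iterate_succ_apply']
      refine (hstep _ _ t).trans ?_
      have hmono : ∫ s in t₀..t, ‖(T^[n] v) (projIcc t₀ t₁ ht s) -
          (T^[n] w) (projIcc t₀ t₁ ht s)‖ ^ 2 ≤
          ∫ s in t₀..t, (D * (s - t₀)) ^ n / n.factorial * ‖v - w‖ ^ 2 := by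
        have h1 := hext (T^[n] v)
        have h2 := hext (T^[n] w)
        refine intervalIntegral.integral_mono_on t.2.1 (Continuous.intervalIntegrable (by fun_prop) _ _)
          (Continuous.intervalIntegrable (by fun_prop) _ _) fun s hs => ?_
        have hs' : s ∈ Icc t₀ t₁ := ⟨hs.1, hs.2.trans t.2.2⟩
        have := ih ⟨s, hs'⟩
        rwa [projIcc_of_mem ht hs']
      have hint : ∫ s in t₀..t, (D * (s - t₀)) ^ n / n.factorial * ‖v - w‖ ^ 2 =
          D ^ n * (t - t₀) ^ (n + 1) / (n + 1) / n.factorial * ‖v - w‖ ^ 2 := by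
        have hsh : ∫ s in t₀..(t : ℝ), (s - t₀) ^ n = (t - t₀) ^ (n + 1) / (n + 1) := by
          rw [intervalIntegral.integral_comp_sub_right (fun s => s ^ n), integral_pow]
          simp
        simp only [mul_pow, intervalIntegral.integral_mul_const, intervalIntegral.integral_div,
          intervalIntegral.integral_const_mul, hsh]
        ring
      refine (mul_le_mul_of_nonneg_left (hmono.trans_eq hint) (by positivity)).trans_eq ?_
      rw [Nat.factorial_succ, mul_pow D (_ - _)]
      push_cast
      field_simp
      ring
  have hlim := FloorSemiring.tendsto_pow_div_factorial_atTop (D * (t₁ - t₀))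
  -- The bound `hiter` is for squared norms, so 1/4 gives the contraction constant 1/2.
  obtain ⟨n, hn⟩ := (hlim.eventually (gt_mem_nhds (show (0 : ℝ) < 1 / 4 by norm_num))).exists
  have hcontr : ContractingWith (1 / 2) (T^[n]) := by
    refine ⟨by norm_num, LipschitzWith.of_dist_le_mul fun v w => ?_⟩
    rw [dist_eq_norm, dist_eq_norm, ContinuousMap.norm_le _ (by positivity)]
    intro t
    refine (pow_le_pow_iff_left₀ (norm_nonneg _) (by positivity) two_ne_zero).1 ?_
    rw [ContinuousMap.sub_apply]
    refine (hiter n v w t).trans ?_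
    have h1 : (D * (t - t₀)) ^ n / n.factorial ≤ (D * (t₁ - t₀)) ^ n / n.factorial := by
      have := t.2.1
      have := t.2.2
      have hD : 0 ≤ D * (t - t₀) := mul_nonneg (by positivity) (by linarith)
      gcongr
    rw [mul_pow _ ‖v - w‖]
    have h2 : ((1 / 2 : NNReal) : ℝ) ^ 2 = 1 / 4 := by norm_num
    rw [h2]
    exact mul_le_mul_of_nonneg_right (h1.trans hn.le) (by positivity)
  have : Nonempty C(Icc t₀ t₁, H) := ⟨0⟩
  -- The unique fixed point of an iterate of `T` is also fixed by `T`.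
  obtain ⟨v, hv⟩ : ∃ v, T v = v := ⟨_, hcontr.isFixedPt_fixedPoint_iterate⟩
  refine ⟨U v, (hU v).continuous, fun k t htt => ?_⟩
  rw [(hU v).coeff k t htt]
  congr 1
  refine intervalIntegral.integral_congr fun s hs => ?_
  rw [uIcc_of_le htt.1] at hs
  have hs' : s ∈ Icc t₀ t₁ := ⟨hs.1, hs.2.trans htt.2⟩
  have : U v s = v ⟨s, hs'⟩ := congrArg (fun w : C(Icc t₀ t₁, H) => w ⟨s, hs'⟩) hv
  simp only [projIcc_of_mem ht hs', this]

/-- The dissipation estimate bounds the time integral of ∑ ⟪e k, u⟫² ‖f k‖². By Tonelli the sum is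
finite for almost every time, and for orthogonal `f k` this is convergence of the gradient series.
Countability of `K` is what makes limits along finite sets measurable. -/
lemma IsHeatSolution.exists_gradient [Countable K] [CompleteSpace G]
    (hu : IsHeatSolution e f ν t₀ t₁ V u₀ u) (hf : Pairwise fun k l => ⟪f k, f l⟫ = 0)
    (hν : 0 < ν) (ht : t₀ ≤ t₁) (hV : Continuous V) :
    ∃ g : ℝ → G, MemLp g 2 (volume.restrict (Icc t₀ t₁)) ∧
      ∀ᵐ t ∂(volume.restrict (Icc t₀ t₁)), HasSum (fun k => ⟪e k, u t⟫ • f k) (g t) := by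
  have hcu := hu.continuous
  set q : K → ℝ → ℝ := fun k t => ⟪e k, u t⟫ ^ 2 * ‖f k‖ ^ 2
  have hq0 : ∀ k t, 0 ≤ q k t := fun k t => by positivity
  have hqc : ∀ k, Continuous (q k) := fun k => by fun_prop
  have hqi : ∀ k, IntegrableOn (q k) (Icc t₀ t₁) := fun k =>
    (hqc k).continuousOn.integrableOn_compact isCompact_Icc
  have hsum : ∑' k, ∫⁻ t in Icc t₀ t₁, ENNReal.ofReal (q k t) ≠ ⊤ := by
    have h1 : ∀ k, ∫⁻ t in Icc t₀ t₁, ENNReal.ofReal (q k t) =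
        ENNReal.ofReal (∫ t in Icc t₀ t₁, q k t) := fun k =>
      (ofReal_integral_eq_lintegral_ofReal (hqi k) (Eventually.of_forall (hq0 k))).symm
    simp only [h1]
    refine Summable.tsum_ofReal_ne_top (summable_of_sum_le
      -- This is the right-hand side of `sum_sq_add_integral_le` at `t₁`, divided by ν.
      (c := ν⁻¹ * (‖u₀‖ ^ 2 + ν⁻¹ * ∫ s in t₀..t₁, ‖V s‖ ^ 2))
      (fun k => integral_nonneg (hq0 k)) fun S => ?_)
    have h2 := hu.sum_sq_add_integral_le hf hV hν S (t := t₁) ⟨ht, le_rfl⟩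
    have h3 : ∑ k ∈ S, ∫ t in Icc t₀ t₁, q k t =
        ∑ k ∈ S, ‖f k‖ ^ 2 * ∫ s in t₀..t₁, ⟪e k, u s⟫ ^ 2 := by
      refine Finset.sum_congr rfl fun k _ => ?_
      rw [integral_Icc_eq_integral_Ioc, ← intervalIntegral.integral_of_le ht,
        intervalIntegral.integral_mul_const, mul_comm]
    have h4 : 0 ≤ ∑ k ∈ S, ⟪e k, u t₁⟫ ^ 2 := Finset.sum_nonneg fun k _ => sq_nonneg _
    rw [h3, ← mul_le_mul_iff_right₀ hν, mul_inv_cancel_left₀ hν.ne']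
    linarith
  rw [← lintegral_tsum fun k => (hqc k).measurable.ennreal_ofReal.aemeasurable] at hsum
  have hmeas : Measurable fun t => ∑' k, ENNReal.ofReal (q k t) :=
    Measurable.tsum fun k => (hqc k).measurable.ennreal_ofReal
  have hae : ∀ᵐ t ∂(volume.restrict (Icc t₀ t₁)), Summable fun k => q k t := by
    filter_upwards [ae_lt_top hmeas hsum] with t htt
    have := ENNReal.summable_toReal htt.ne
    simpa only [ENNReal.toReal_ofReal (hq0 _ t)] using this
  set g : ℝ → G := fun t => ∑' k, ⟪e k, u t⟫ • f k
  have hgs : ∀ᵐ t ∂(volume.restrict (Icc t₀ t₁)), HasSum (fun k => ⟪e k, u t⟫ • f k) (g t) := by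
    filter_upwards [hae] with t htt
    exact (summable_smul_of_orthogonal hf htt).hasSum
  have hgm : AEStronglyMeasurable g (volume.restrict (Icc t₀ t₁)) :=
    aestronglyMeasurable_of_tendsto_ae atTop
      (f := fun (S : Finset K) t => ∑ k ∈ S, ⟪e k, u t⟫ • f k)
      (fun S => (continuous_finsetSum S fun k _ => by fun_prop).aestronglyMeasurable) hgs
  refine ⟨g, ⟨hgm, ?_⟩, hgs⟩
  rw [eLpNorm_lt_top_iff_lintegral_rpow_enorm_lt_top two_ne_zero ENNReal.ofNat_ne_top]
  refine lt_of_le_of_lt (lintegral_mono_ae ?_) (lt_top_iff_ne_top.2 hsum)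
  filter_upwards [hae] with t htt
  have hn := norm_sq_tsum_smul_of_orthogonal hf htt
  rw [← ENNReal.ofReal_tsum_of_nonneg (fun k => hq0 k t) htt, ← hn, ENNReal.ofReal_pow (norm_nonneg _),
    ofReal_norm]
  simp [g]

end ModalEquation

/-! ### Divergence theorem and integration by parts on a box -/

section Box

variable {d : ℕ} {lo hi : Fin d → ℝ}

lemma interior_box (lo hi : Fin d → ℝ) : interior (Icc lo hi) = univ.pi fun i => Ioo (lo i) (hi i) := by
  rw [← pi_univ_Icc, interior_pi_set finite_univ]
  simp

lemma ae_mem_interior_box (lo hi : Fin d → ℝ) :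
    ∀ᵐ x ∂(volume.restrict (Icc lo hi)), x ∈ interior (Icc lo hi) := by
  have h := (convex_Icc lo hi).addHaar_frontier volume
  rw [ae_restrict_iff' measurableSet_Icc]
  have h' : ∀ᵐ x : Fin d → ℝ, x ∉ frontier (Icc lo hi) := measure_eq_zero_iff_ae_notMem.1 h
  filter_upwards [h'] with x hx hxI
  by_contra hn
  exact hx ⟨subset_closure hxI, hn⟩

lemma update_mem_box {x : Fin d → ℝ} (hx : x ∈ Icc lo hi) {j : Fin d} {t : ℝ}
    (ht : t ∈ Icc (lo j) (hi j)) : Function.update x j t ∈ Icc lo hi :=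
  ⟨le_update_iff.2 ⟨ht.1, fun i _ => hx.1 i⟩, update_le_iff.2 ⟨ht.2, fun i _ => hx.2 i⟩⟩

lemma ae_differentiableAt_of_lipschitzOn {F : Type*} [NormedAddCommGroup F] [NormedSpace ℝ F]
    [FiniteDimensional ℝ F] {f : (Fin d → ℝ) → F} {C : NNReal}
    (hf : LipschitzOnWith C f (Icc lo hi)) :
    ∀ᵐ x ∂(volume.restrict (Icc lo hi)), DifferentiableAt ℝ f x := by
  filter_upwards [hf.ae_differentiableWithinAt measurableSet_Icc, ae_mem_interior_box lo hi]
    with x hx hxi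
  exact hx.differentiableAt (mem_interior_iff_mem_nhds.1 hxi)

lemma integrableOn_pderiv_of_lipschitzOn {f : (Fin d → ℝ) → ℝ} {C : NNReal} (j : Fin d)
    (hf : LipschitzOnWith C f (Icc lo hi)) : IntegrableOn (pderiv j f) (Icc lo hi) := by
  refine Measure.integrableOn_of_bounded (M := C) isCompact_Icc.measure_lt_top.ne
    (measurable_fderiv_apply_const ℝ f _).aestronglyMeasurable ?_
  filter_upwards [ae_mem_interior_box lo hi] with x hxi
  refine (ContinuousLinearMap.le_opNorm _ _).trans ?_
  rw [Pi.norm_single, norm_one, mul_one]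
  exact norm_fderiv_le_of_lipschitzOn ℝ (mem_interior_iff_mem_nhds.1 hxi) hf

lemma hasDerivAt_insertNth {n : ℕ} (j : Fin (n + 1)) (y : Fin n → ℝ) (t : ℝ) :
    HasDerivAt (fun t => (j.insertNth t y : Fin (n + 1) → ℝ)) (Pi.single j 1) t := by
  rw [hasDerivAt_pi]
  intro i
  induction i using j.succAboveCases with
  | x => simpa using hasDerivAt_id' t
  | p i => simpa using hasDerivAt_const t (y i)

/-- The divergence theorem on a box for a Lipschitz function with equal values on two opposite
faces. -/
lemma integral_pderiv_eq_zero {f : (Fin d → ℝ) → ℝ} {C : NNReal} (hX : ∀ i, lo i ≤ hi i) (j : Fin d)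
    (hf : LipschitzOnWith C f (Icc lo hi))
    (hface : ∀ x ∈ Icc lo hi, f (Function.update x j (lo j)) = f (Function.update x j (hi j))) :
    ∫ x in Icc lo hi, pderiv j f x = 0 := by
  cases d with
  | zero => exact j.elim0
  | succ n =>
    -- The `j`-th coordinate is split off, so that by Fubini it suffices to integrate along lines in
    -- direction `j`.
    set Φ : (Fin n → ℝ) × ℝ ≃ᵐ (Fin (n + 1) → ℝ) :=
      MeasurableEquiv.prodComm.trans (MeasurableEquiv.piFinSuccAbove (fun _ => ℝ) j).symm
    have hΦ : MeasurePreserving Φ := (volume_preserving_piFinSuccAbove (fun _ => ℝ) j).symm.comp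
      Measure.measurePreserving_swap
    have hΦa : ∀ p : (Fin n → ℝ) × ℝ, Φ p = j.insertNth p.2 p.1 := fun p => rfl
    set lo' : Fin n → ℝ := fun i => lo (j.succAbove i)
    set hi' : Fin n → ℝ := fun i => hi (j.succAbove i)
    have hpre : Φ ⁻¹' Icc lo hi = Icc lo' hi' ×ˢ Icc (lo j) (hi j) := by
      ext p
      simp only [mem_preimage, hΦa, mem_prod, mem_Icc, Fin.le_insertNth_iff,
        Fin.insertNth_le_iff, lo', hi']
      tauto
    have hmem : ∀ y ∈ Icc lo' hi', ∀ t ∈ Icc (lo j) (hi j), j.insertNth t y ∈ Icc lo hi := by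
      intro y hy t ht
      have : (y, t) ∈ Φ ⁻¹' Icc lo hi := by rw [hpre]; exact ⟨hy, ht⟩
      exact this
    have hres : (volume : Measure ((Fin n → ℝ) × ℝ)).restrict (Φ ⁻¹' Icc lo hi) =
        (volume.restrict (Icc lo' hi')).prod (volume.restrict (Icc (lo j) (hi j))) := by
      rw [hpre, Measure.prod_restrict]; rfl
    have hmp : MeasurePreserving Φ
        ((volume.restrict (Icc lo' hi')).prod (volume.restrict (Icc (lo j) (hi j))))
        (volume.restrict (Icc lo hi)) := by
      rw [← hres]
      exact hΦ.restrict_preimage measurableSet_Icc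
    have hint := (hmp.integrable_comp_emb Φ.measurableEmbedding).2
      (integrableOn_pderiv_of_lipschitzOn j hf)
    -- By Rademacher's theorem and Fubini, almost every line meets the points of
    -- non-differentiability in a null set.
    have hdiff := Measure.ae_ae_of_ae_prod
      (hmp.quasiMeasurePreserving.ae (ae_differentiableAt_of_lipschitzOn hf))
    rw [← hmp.integral_comp Φ.measurableEmbedding]
    refine (integral_prod _ hint).trans ?_
    refine integral_eq_zero_of_ae ?_
    filter_upwards [hdiff, ae_restrict_mem measurableSet_Icc] with y hy hyI
    have hlip : LipschitzOnWith C (fun t => f (j.insertNth t y)) (uIcc (lo j) (hi j)) := by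
      rw [uIcc_of_le (hX j)]
      intro t ht s hs
      refine (hf (hmem y hyI t ht) (hmem y hyI s hs)).trans ?_
      gcongr
      rw [edist_pi_le_iff]
      intro i
      induction i using j.succAboveCases with
      | x => simp
      | p i => simp
    -- A Lipschitz function on a line is absolutely continuous, so the fundamental theorem of
    -- calculus holds with the a.e. derivative.
    have hFTC := hlip.absolutelyContinuousOnInterval.integral_deriv_eq_sub
    rw [intervalIntegral.integral_of_le (hX j), ← integral_Icc_eq_integral_Ioc] at hFTC
    have hface' : f (j.insertNth (hi j) y) - f (j.insertNth (lo j) y) = 0 := by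
      have := hface _ (hmem y hyI (lo j) ⟨le_rfl, hX j⟩)
      simp only [Fin.update_insertNth] at this
      rw [this, sub_self]
    rw [hface'] at hFTC
    simp only [Pi.zero_apply]
    rw [← hFTC]
    refine integral_congr_ae ?_
    filter_upwards [hy] with t ht
    have := ht.hasFDerivAt.comp_hasDerivAt t (hasDerivAt_insertNth j y t)
    exact this.deriv.symm

lemma exists_lipschitzOn_mul {f g : (Fin d → ℝ) → ℝ} {C D : NNReal}
    (hf : LipschitzOnWith C f (Icc lo hi)) (hg : LipschitzOnWith D g (Icc lo hi)) :
    ∃ E : NNReal, LipschitzOnWith E (fun x => f x * g x) (Icc lo hi) := by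
  obtain ⟨M, hM⟩ := isCompact_Icc.exists_bound_of_continuousOn hf.continuousOn
  obtain ⟨N, hN⟩ := isCompact_Icc.exists_bound_of_continuousOn hg.continuousOn
  refine ⟨M.toNNReal * D + N.toNNReal * C, LipschitzOnWith.of_dist_le_mul fun x hx y hy => ?_⟩
  have h1 := hf.dist_le_mul x hx y hy
  have h2 := hg.dist_le_mul x hx y hy
  rw [Real.dist_eq] at h1 h2 ⊢
  have h3 : f x * g x - f y * g y = f x * (g x - g y) + g y * (f x - f y) := by ring
  rw [h3]
  refine (abs_add_le _ _).trans ?_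
  rw [abs_mul, abs_mul]
  push_cast
  have hM' : |f x| ≤ max M 0 := (hM x hx).trans (le_max_left _ _)
  have hN' : |g y| ≤ max N 0 := (hN y hy).trans (le_max_left _ _)
  calc |f x| * |g x - g y| + |g y| * |f x - f y|
      ≤ max M 0 * (D * dist x y) + max N 0 * (C * dist x y) := by gcongr
    _ = _ := by simp only [Real.coe_toNNReal']; ring

lemma exists_lipschitzOn_of_contDiff {f : (Fin d → ℝ) → ℝ} (hf : ContDiff ℝ 1 f) :
    ∃ C : NNReal, LipschitzOnWith C f (Icc lo hi) :=
  (hf.locallyLipschitz.locallyLipschitzOn (s := Icc lo hi)).exists_lipschitzOnWith_of_compact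
    isCompact_Icc

lemma update_eq_add_single (x : Fin d → ℝ) (j : Fin d) :
    Function.update x j (hi j) = Function.update x j (lo j) + Pi.single j (hi j - lo j) := by
  ext i
  by_cases h : i = j
  · subst h; simp
  · simp [h]

lemma IsPeriodic.update_eq {F : Type*} {f : (Fin d → ℝ) → F} (hf : IsPeriodic lo hi f) (j : Fin d)
    (x : Fin d → ℝ) : f (Function.update x j (lo j)) = f (Function.update x j (hi j)) := by
  rw [update_eq_add_single (lo := lo) (hi := hi), hf]

lemma pderiv_mul {f g : (Fin d → ℝ) → ℝ} (j : Fin d) {x : Fin d → ℝ} (hf : DifferentiableAt ℝ f x)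
    (hg : DifferentiableAt ℝ g x) :
    pderiv j (fun x => f x * g x) x = pderiv j f x * g x + f x * pderiv j g x := by
  unfold pderiv
  rw [fderiv_fun_mul hf hg]
  simp
  ring

/-- Integration by parts on a box. -/
lemma integral_mul_pderiv_eq {f g : (Fin d → ℝ) → ℝ} (hX : ∀ i, lo i ≤ hi i) (j : Fin d)
    (hf : ContDiff ℝ 1 f) (hg : ContDiff ℝ 1 g)
    (hface : ∀ x ∈ Icc lo hi, f (Function.update x j (lo j)) * g (Function.update x j (lo j)) =
      f (Function.update x j (hi j)) * g (Function.update x j (hi j))) :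
    ∫ x in Icc lo hi, f x * pderiv j g x = -∫ x in Icc lo hi, pderiv j f x * g x := by
  obtain ⟨C, hC⟩ := exists_lipschitzOn_of_contDiff (lo := lo) (hi := hi) hf
  obtain ⟨D, hD⟩ := exists_lipschitzOn_of_contDiff (lo := lo) (hi := hi) hg
  obtain ⟨E, hE⟩ := exists_lipschitzOn_mul hC hD
  have h0 := integral_pderiv_eq_zero hX j hE hface
  have hf' : Continuous (pderiv j f) := (hf.continuous_fderiv one_ne_zero).clm_apply continuous_const
  have hg' : Continuous (pderiv j g) := (hg.continuous_fderiv one_ne_zero).clm_apply continuous_const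
  have h1 : ∫ x in Icc lo hi, pderiv j (fun x => f x * g x) x =
      ∫ x in Icc lo hi, (pderiv j f x * g x + f x * pderiv j g x) :=
    integral_congr_ae (Eventually.of_forall fun x =>
      pderiv_mul j (hf.differentiable one_ne_zero x) (hg.differentiable one_ne_zero x))
  have hfc := hf.continuous
  have hgc := hg.continuous
  have h2 : IntegrableOn (fun x => pderiv j f x * g x) (Icc lo hi) :=
    Continuous.integrableOn_Icc (by fun_prop)
  have h3 : IntegrableOn (fun x => f x * pderiv j g x) (Icc lo hi) :=
    Continuous.integrableOn_Icc (by fun_prop)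
  rw [integral_add h2 h3] at h1
  linarith

variable {bc : BoundaryCondition} {t₀ t₁ : ℝ} {b : ℝ → (Fin d → ℝ) → (Fin d → ℝ)}

/-- A divergence free field is orthogonal to gradients of test functions. -/
lemma IsDivFreeField.integral_sum_mul_pderiv_eq_zero (hb : IsDivFreeField bc lo hi t₀ t₁ b)
    (hX : ∀ i, lo i ≤ hi i) {t : ℝ} (ht : t ∈ Icc t₀ t₁) {w : (Fin d → ℝ) → ℝ}
    (hw : IsTestFunction bc lo hi w) :
    ∫ x in Icc lo hi, ∑ j, b t x j * pderiv j w x = 0 := by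
  have hw1 : ContDiff ℝ 1 w := hw.1.of_le (by exact_mod_cast le_top)
  obtain ⟨C, hC⟩ := (hb.locallyLipschitzOn t ht).exists_lipschitzOnWith_of_compact isCompact_Icc
  obtain ⟨D, hD⟩ := exists_lipschitzOn_of_contDiff (lo := lo) (hi := hi) hw1
  have hCj : ∀ j, LipschitzOnWith C (fun x => b t x j) (Icc lo hi) := fun j => by
    have := (LipschitzWith.eval (α := fun _ : Fin d => ℝ) j).comp_lipschitzOnWith hC
    rwa [one_mul] at this
  choose E hE using fun j => exists_lipschitzOn_mul (hCj j) hD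
  -- Periodicity makes the values on opposite faces equal; tangency makes the normal component of
  -- the field vanish on both. No condition on `w` is needed in the second case.
  have hface : ∀ j, ∀ x ∈ Icc lo hi,
      b t (Function.update x j (lo j)) j * w (Function.update x j (lo j)) =
        b t (Function.update x j (hi j)) j * w (Function.update x j (hi j)) := by
    intro j x hx
    have hbd := hb.boundary t ht
    have hw2 := hw.2
    cases bc with
    | periodic =>
      simp only at hbd hw2
      rw [hbd.update_eq j x, hw2.update_eq j x]
    | neumann =>
      simp only at hbd
      rw [hbd _ (update_mem_box hx ⟨le_rfl, hX j⟩) j (by simp),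
        hbd _ (update_mem_box hx ⟨hX j, le_rfl⟩) j (by simp), zero_mul, zero_mul]
  have h0 : ∑ j, ∫ x in Icc lo hi, pderiv j (fun x => b t x j * w x) x = 0 :=
    Finset.sum_eq_zero fun j _ => integral_pderiv_eq_zero hX j (hE j) (hface j)
  rw [← integral_finsetSum _ fun j _ => integrableOn_pderiv_of_lipschitzOn j (hE j)] at h0
  rw [← h0]
  refine integral_congr_ae ?_
  filter_upwards [ae_differentiableAt_of_lipschitzOn hC, hb.div_eq_zero t ht] with x hx hdiv
  have hj : ∀ j, pderiv j (fun x => b t x j * w x) x =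
      fderiv ℝ (b t) x (Pi.single j 1) j * w x + b t x j * pderiv j w x := by
    intro j
    have hxj : HasFDerivAt (fun x => b t x j) _ x := (hasFDerivAt_pi'.1 hx.hasFDerivAt) j
    rw [pderiv_mul j hxj.differentiableAt (hw1.differentiable one_ne_zero x)]
    congr 2
    unfold pderiv
    rw [hxj.fderiv]
    rfl
  simp only [hj, Finset.sum_add_distrib, ← Finset.sum_mul, hdiv, zero_mul, zero_add]

end Box

/-! ### Products of functions of one variable -/

section ProductFunctions

variable {d : ℕ}

/-- The product function `x ↦ ∏ᵢ Fᵢ(xᵢ)`. -/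
def prodFun (F : Fin d → ℝ → ℝ) (x : Fin d → ℝ) : ℝ := ∏ i, F i (x i)

lemma contDiff_prodFun {F : Fin d → ℝ → ℝ} (hF : ∀ i, ContDiff ℝ ∞ (F i)) :
    ContDiff ℝ ∞ (prodFun F) :=
  contDiff_prod fun i _ => (hF i).comp (contDiff_apply ℝ ℝ i)

lemma prodFun_update_apply (F : Fin d → ℝ → ℝ) (j : Fin d) (g : ℝ → ℝ) (x : Fin d → ℝ) :
    prodFun (Function.update F j g) x = g (x j) * ∏ i ∈ Finset.univ.erase j, F i (x i) := by
  unfold prodFun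
  rw [← Finset.mul_prod_erase _ _ (Finset.mem_univ j), Function.update_self]
  congr 1
  exact Finset.prod_congr rfl fun i hi => by rw [Function.update_of_ne (Finset.ne_of_mem_erase hi)]

lemma pderiv_prodFun {F : Fin d → ℝ → ℝ} (hF : ∀ i, Differentiable ℝ (F i)) (j : Fin d) :
    pderiv j (prodFun F) = prodFun (Function.update F j (deriv (F j))) := by
  funext x
  have h : HasFDerivAt (prodFun F) _ x := HasFDerivAt.finsetProd (u := Finset.univ)
    (g := fun i (x : Fin d → ℝ) => F i (x i)) fun i _ =>
      (hF i (x i)).hasDerivAt.hasFDerivAt.comp x (hasFDerivAt_apply (𝕜 := ℝ) i x)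
  unfold pderiv
  rw [h.fderiv, prodFun_update_apply]
  simp only [sum_apply, smul_apply,
    ContinuousLinearMap.comp_apply, ContinuousLinearMap.proj_apply]
  rw [Finset.sum_eq_single j]
  · simp [mul_comm]
  · intro i _ hij
    simp [hij]
  · simp

lemma integral_prodFun (lo hi : Fin d → ℝ) (F : Fin d → ℝ → ℝ) :
    ∫ x in Icc lo hi, prodFun F x = ∏ i, ∫ x in Icc (lo i) (hi i), F i x := by
  rw [← pi_univ_Icc, volume_pi, Measure.restrict_pi_pi]
  exact integral_fintype_prod_eq_prod F

lemma prodFun_mul (F G : Fin d → ℝ → ℝ) (x : Fin d → ℝ) :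
    prodFun F x * prodFun G x = prodFun (fun i => F i * G i) x := by
  simp [prodFun, Finset.prod_mul_distrib]

/-- The product is multilinear in its factors. The induction runs over the set of coordinates whose
factor is only a combination of modes, expanding one such factor at a time. -/
lemma prodFun_mem_span {I : Type*} {m : Fin d → I → ℝ → ℝ} {F : Fin d → ℝ → ℝ}
    (hF : ∀ i, F i ∈ Submodule.span ℝ (range (m i))) :
    prodFun F ∈ Submodule.span ℝ (range fun k : Fin d → I => prodFun fun i => m i (k i)) := by
  classical
  set L : MultilinearMap ℝ (fun _ : Fin d => ℝ → ℝ) ((Fin d → ℝ) → ℝ) :=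
    (MultilinearMap.mkPiAlgebra ℝ (Fin d) ((Fin d → ℝ) → ℝ)).compLinearMap
      fun i => LinearMap.funLeft ℝ ℝ (fun x : Fin d → ℝ => x i)
  have hL : ∀ F, L F = prodFun F := fun F => by
    funext x
    simp [L, prodFun, LinearMap.funLeft_apply]
  rw [← hL]
  suffices h : ∀ s : Finset (Fin d), ∀ F : Fin d → ℝ → ℝ,
      (∀ i ∈ s, F i ∈ Submodule.span ℝ (range (m i))) → (∀ i ∉ s, F i ∈ range (m i)) →
      L F ∈ Submodule.span ℝ (range fun k : Fin d → I => prodFun fun i => m i (k i)) from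
    h Finset.univ F (fun i _ => hF i) (by simp)
  intro s
  induction s using Finset.induction_on with
  | empty =>
    intro F _ h
    choose k hk using fun i => h i (Finset.notMem_empty i)
    refine Submodule.subset_span ⟨k, ?_⟩
    rw [hL]
    exact congrArg prodFun (funext hk)
  | insert a s ha ih =>
    intro F h1 h2
    have key : ∀ g ∈ Submodule.span ℝ (range (m a)), L (Function.update F a g) ∈
        Submodule.span ℝ (range fun k : Fin d → I => prodFun fun i => m i (k i)) := by
      intro g hg
      induction hg using Submodule.span_induction with
      | mem g hg =>
        refine ih _ (fun i hi => ?_) fun i hi => ?_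
        · rw [Function.update_of_ne (ne_of_mem_of_not_mem hi ha)]
          exact h1 i (Finset.mem_insert_of_mem hi)
        · by_cases hia : i = a
          · subst hia; simpa using hg
          · rw [Function.update_of_ne hia]
            exact h2 i (by simp [hia, hi])
      | zero => rw [MultilinearMap.map_update_zero]; exact Submodule.zero_mem _
      | add g g' _ _ hg hg' => rw [MultilinearMap.map_update_add]; exact Submodule.add_mem _ hg hg'
      | smul c g _ hg => rw [MultilinearMap.map_update_smul]; exact Submodule.smul_mem _ c hg
    simpa using key (F a) (h1 a (Finset.mem_insert_self a s))

end ProductFunctions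

/-! ### Eigenfunctions of the Laplacian on a box -/

/-- One-dimensional eigenfunctions of the Laplacian on the edges of a box, with the boundary
condition `bc`. -/
structure Modes {d : ℕ} (bc : BoundaryCondition) (lo hi : Fin d → ℝ) (I : Type) where
  /-- the eigenfunctions on the `i`-th edge -/
  mode : Fin d → I → ℝ → ℝ
  /-- the square roots of the eigenvalues -/
  freq : Fin d → I → ℝ
  contDiff : ∀ i n, ContDiff ℝ ∞ (mode i n)
  deriv_deriv : ∀ i n, deriv (deriv (mode i n)) = -(freq i n) ^ 2 • mode i n
  orthogonal : ∀ i m n, m ≠ n → ∫ x in Icc (lo i) (hi i), mode i m x * mode i n x = 0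
  normalized : ∀ i n, ∫ x in Icc (lo i) (hi i), mode i n x * mode i n x = 1
  boundary : match bc with
    | .periodic => ∀ i n x, mode i n (x + (hi i - lo i)) = mode i n x
    | .neumann => ∀ i n, deriv (mode i n) (lo i) = 0 ∧ deriv (mode i n) (hi i) = 0
  -- These two conditions make the span of the modes an algebra, as the Stone-Weierstrass theorem
  -- requires.
  one_mem : ∀ i, (1 : ℝ → ℝ) ∈ Submodule.span ℝ (range (mode i))
  mul_mem : ∀ i m n, mode i m * mode i n ∈ Submodule.span ℝ (range (mode i))
  -- Periodic modes cannot separate the two end points. This weak form suffices, since only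
  -- functions vanishing near the boundary have to be approximated.
  separates : ∀ i, ∀ x ∈ Icc (lo i) (hi i), ∀ y ∈ Icc (lo i) (hi i),
    (∀ n, mode i n x = mode i n y) → x ≠ y →
      (x = lo i ∨ x = hi i) ∧ (y = lo i ∨ y = hi i)

namespace Modes

variable {d : ℕ} {bc : BoundaryCondition} {lo hi : Fin d → ℝ} {I : Type}

/-- The eigenfunction on the box with index `k`. -/
def eig (M : Modes bc lo hi I) (k : Fin d → I) : (Fin d → ℝ) → ℝ :=
  prodFun fun i => M.mode i (k i)

lemma contDiff_eig (M : Modes bc lo hi I) (k : Fin d → I) : ContDiff ℝ ∞ (M.eig k) :=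
  contDiff_prodFun fun i => M.contDiff i (k i)

lemma contDiff_deriv_mode (M : Modes bc lo hi I) (i : Fin d) (n : I) :
    ContDiff ℝ ∞ (deriv (M.mode i n)) := (contDiff_infty_iff_deriv.1 (M.contDiff i n)).2

lemma pderiv_eig (M : Modes bc lo hi I) (j : Fin d) (k : Fin d → I) :
    pderiv j (M.eig k) =
      prodFun (Function.update (fun i => M.mode i (k i)) j (deriv (M.mode j (k j)))) :=
  pderiv_prodFun (fun i => (M.contDiff i (k i)).differentiable (by simp)) j

lemma contDiff_update (M : Modes bc lo hi I) (j : Fin d) (k : Fin d → I) (i : Fin d) :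
    ContDiff ℝ ∞ (Function.update (fun i => M.mode i (k i)) j (deriv (M.mode j (k j))) i) := by
  by_cases h : i = j
  · subst h; simpa using M.contDiff_deriv_mode i (k i)
  · simpa [h] using M.contDiff i (k i)

lemma contDiff_pderiv_eig (M : Modes bc lo hi I) (j : Fin d) (k : Fin d → I) :
    ContDiff ℝ ∞ (pderiv j (M.eig k)) := by
  rw [pderiv_eig]
  exact contDiff_prodFun fun i => M.contDiff_update j k i

lemma pderiv_pderiv_eig (M : Modes bc lo hi I) (j : Fin d) (k : Fin d → I) (x : Fin d → ℝ) :
    pderiv j (pderiv j (M.eig k)) x = -(M.freq j (k j)) ^ 2 * M.eig k x := by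
  rw [pderiv_eig, pderiv_prodFun fun i => (M.contDiff_update j k i).differentiable (by simp)]
  simp only [Function.update_self, Function.update_idem, M.deriv_deriv]
  rw [prodFun_update_apply, eig, prodFun, ← Finset.mul_prod_erase _ _ (Finset.mem_univ j)]
  simp only [Pi.smul_apply, smul_eq_mul]
  ring

lemma isPeriodic_eig (M : Modes .periodic lo hi I) (k : Fin d → I) :
    IsPeriodic lo hi (M.eig k) := by
  intro j x
  unfold eig prodFun
  refine Finset.prod_congr rfl fun i _ => ?_
  by_cases h : i = j
  · subst h; simpa using M.boundary i (k i) (x i)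
  · simp [h]

lemma isTestFunction_eig (M : Modes bc lo hi I) (k : Fin d → I) :
    IsTestFunction bc lo hi (M.eig k) := by
  refine ⟨M.contDiff_eig k, ?_⟩
  cases bc with
  | periodic => exact M.isPeriodic_eig k
  | neumann => trivial

lemma pderiv_eig_eq_zero (M : Modes .neumann lo hi I) (j : Fin d) (k : Fin d → I) {x : Fin d → ℝ}
    (hx : x j = lo j ∨ x j = hi j) : pderiv j (M.eig k) x = 0 := by
  rw [pderiv_eig, prodFun_update_apply]
  rcases hx with h | h
  · rw [h, (M.boundary j (k j)).1, zero_mul]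
  · rw [h, (M.boundary j (k j)).2, zero_mul]

end Modes

lemma IsPeriodic.pderiv {d : ℕ} {lo hi : Fin d → ℝ} {w : (Fin d → ℝ) → ℝ}
    (hw : IsPeriodic lo hi w) (j : Fin d) : IsPeriodic lo hi (pderiv j w) := by
  intro i x
  have h : (fun y => w (y + Pi.single i (hi i - lo i))) = w := funext fun y => hw i y
  unfold FokkerPlanck.pderiv
  rw [← fderiv_comp_add_right, h]

namespace Modes

variable {d : ℕ} {bc : BoundaryCondition} {lo hi : Fin d → ℝ} {I : Type}

/-- Neumann test functions are unrestricted on the faces; the boundary terms vanish through the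
normal derivative of the eigenfunction. -/
lemma face_eq (M : Modes bc lo hi I) {w : (Fin d → ℝ) → ℝ} (hw : IsTestFunction bc lo hi w)
    (j : Fin d) (k : Fin d → I) (x : Fin d → ℝ) :
    w (Function.update x j (lo j)) * pderiv j (M.eig k) (Function.update x j (lo j)) =
      w (Function.update x j (hi j)) * pderiv j (M.eig k) (Function.update x j (hi j)) := by
  cases bc with
  | periodic => rw [IsPeriodic.update_eq hw.2 j x, ((M.isPeriodic_eig k).pderiv j).update_eq j x]
  | neumann =>
    rw [M.pderiv_eig_eq_zero j k (by simp), M.pderiv_eig_eq_zero j k (by simp), mul_zero, mul_zero]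

lemma integral_pderiv_mul_pderiv_eig (M : Modes bc lo hi I) (hX : ∀ i, lo i ≤ hi i)
    {w : (Fin d → ℝ) → ℝ} (hw : IsTestFunction bc lo hi w) (j : Fin d) (k : Fin d → I) :
    ∫ x in Icc lo hi, pderiv j w x * pderiv j (M.eig k) x =
      M.freq j (k j) ^ 2 * ∫ x in Icc lo hi, w x * M.eig k x := by
  have h := integral_mul_pderiv_eq hX j (hw.1.of_le (by exact_mod_cast le_top))
    ((M.contDiff_pderiv_eig j k).of_le (by exact_mod_cast le_top)) (fun x _ => M.face_eq hw j k x)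
  simp only [M.pderiv_pderiv_eig] at h
  rw [eq_comm, neg_eq_iff_eq_neg] at h
  rw [h, ← integral_const_mul, ← integral_neg]
  congr 1
  funext x
  ring

lemma integral_eig_mul_eig (M : Modes bc lo hi I) {k l : Fin d → I} (hkl : k ≠ l) :
    ∫ x in Icc lo hi, M.eig k x * M.eig l x = 0 := by
  simp only [eig, prodFun_mul]
  rw [integral_prodFun]
  obtain ⟨i, hi⟩ := Function.ne_iff.1 hkl
  exact Finset.prod_eq_zero (Finset.mem_univ i) (M.orthogonal i _ _ hi)

lemma integral_eig_mul_self (M : Modes bc lo hi I) (k : Fin d → I) :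
    ∫ x in Icc lo hi, M.eig k x * M.eig k x = 1 := by
  simp only [eig, prodFun_mul]
  rw [integral_prodFun]
  exact Finset.prod_eq_one fun i _ => M.normalized i (k i)

end Modes

/-! ### Phase-shifted cosines, common to both boundary conditions -/

section Trigonometric

/-- The harmonic oscillation `x ↦ A cos (μ (x - a) + θ)`. -/
noncomputable def wave (a A μ θ x : ℝ) : ℝ := A * Real.cos (μ * (x - a) + θ)

lemma contDiff_wave (a A μ θ : ℝ) : ContDiff ℝ ∞ (wave a A μ θ) :=
  contDiff_const.mul
    (Real.contDiff_cos.comp ((contDiff_const.mul (contDiff_id.sub contDiff_const)).add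
      contDiff_const))

lemma deriv_wave (a A μ θ : ℝ) : deriv (wave a A μ θ) = wave a (-(A * μ)) μ (θ - Real.pi / 2) := by
  funext x
  have h : HasDerivAt (fun x => μ * (x - a) + θ) (μ * 1) x :=
    (((hasDerivAt_id' x).sub_const a).const_mul μ).add_const θ
  have h2 : HasDerivAt (wave a A μ θ) _ x := h.cos.const_mul A
  rw [h2.deriv, wave, ← add_sub_assoc, Real.cos_sub_pi_div_two]
  ring

lemma deriv_deriv_wave (a A μ θ : ℝ) :
    deriv (deriv (wave a A μ θ)) = -μ ^ 2 • wave a A μ θ := by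
  rw [deriv_wave, deriv_wave]
  funext x
  have h : μ * (x - a) + (θ - Real.pi / 2 - Real.pi / 2) = μ * (x - a) + θ - Real.pi := by ring
  simp only [wave, h, Real.cos_sub_pi, Pi.smul_apply, smul_eq_mul]
  ring

lemma integral_cos_eq_zero {a c ν θ : ℝ} (hac : a ≤ c) (hν : ν ≠ 0)
    (h : Real.sin (ν * (c - a) + θ) = Real.sin θ) :
    ∫ x in Icc a c, Real.cos (ν * (x - a) + θ) = 0 := by
  rw [integral_Icc_eq_integral_Ioc, ← intervalIntegral.integral_of_le hac,
    intervalIntegral.integral_eq_sub_of_hasDerivAt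
      (f := fun x => ν⁻¹ * Real.sin (ν * (x - a) + θ)) (fun x _ => ?_)
      (Continuous.intervalIntegrable (by fun_prop) _ _)]
  · simp [h]
  · have h : HasDerivAt (fun x => ν * (x - a) + θ) (ν * 1) x :=
      (((hasDerivAt_id' x).sub_const a).const_mul ν).add_const θ
    convert! h.sin.const_mul ν⁻¹ using 1
    field_simp

lemma integral_cos_const {a c θ : ℝ} (hac : a ≤ c) :
    ∫ x in Icc a c, Real.cos (0 * (x - a) + θ) = (c - a) * Real.cos θ := by
  simp [hac]

lemma wave_mul_wave (a A B μ μ' θ θ' x : ℝ) : wave a A μ θ x * wave a B μ' θ' x =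
    A * B / 2 * (Real.cos ((μ - μ') * (x - a) + (θ - θ')) +
      Real.cos ((μ + μ') * (x - a) + (θ + θ'))) := by
  have h1 : (μ - μ') * (x - a) + (θ - θ') = (μ * (x - a) + θ) - (μ' * (x - a) + θ') := by ring
  have h2 : (μ + μ') * (x - a) + (θ + θ') = (μ * (x - a) + θ) + (μ' * (x - a) + θ') := by ring
  rw [h1, h2, Real.cos_sub, Real.cos_add (μ * (x - a) + θ)]
  simp only [wave]
  ring

/-- Orthogonality and normalisation of the modes reduce to integrals of single cosines with the sum
and the difference of the frequencies. -/
lemma integral_wave_mul_wave (a c A B μ μ' θ θ' : ℝ) :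
    ∫ x in Icc a c, wave a A μ θ x * wave a B μ' θ' x =
      A * B / 2 * ((∫ x in Icc a c, Real.cos ((μ - μ') * (x - a) + (θ - θ'))) +
        ∫ x in Icc a c, Real.cos ((μ + μ') * (x - a) + (θ + θ'))) := by
  simp only [wave_mul_wave]
  rw [integral_const_mul, integral_add]
  · exact Continuous.integrableOn_Icc (by fun_prop)
  · exact Continuous.integrableOn_Icc (by fun_prop)

end Trigonometric

/-! ### Neumann modes -/

section Neumann

variable {d : ℕ} {lo hi : Fin d → ℝ}

/-- The amplitude that normalises `x ↦ cos (π n (x - a) / L)` on an interval of length `L`. -/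
noncomputable def neumannAmplitude (L : ℝ) (n : ℕ) : ℝ := if n = 0 then √(1 / L) else √(2 / L)

lemma neumannAmplitude_ne_zero {L : ℝ} (hL : 0 < L) (n : ℕ) : neumannAmplitude L n ≠ 0 := by
  unfold neumannAmplitude
  split_ifs <;> positivity

/-- Negative frequencies are admitted because products of modes involve the frequency `m - n`. -/
lemma cos_mem_span_neumann {a L : ℝ} (hL : 0 < L) (z : ℤ) :
    (fun x => Real.cos (Real.pi * z / L * (x - a))) ∈ Submodule.span ℝ
      (range fun n : ℕ => wave a (neumannAmplitude L n) (Real.pi * n / L) 0) := by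
  have h : (fun x => Real.cos (Real.pi * z / L * (x - a))) = (neumannAmplitude L z.natAbs)⁻¹ •
      wave a (neumannAmplitude L z.natAbs) (Real.pi * z.natAbs / L) 0 := by
    funext x
    simp only [wave, Pi.smul_apply, smul_eq_mul, add_zero]
    rw [inv_mul_cancel_left₀ (neumannAmplitude_ne_zero hL _)]
    rcases Int.natAbs_eq z with hz | hz
    · conv_lhs => rw [hz]
      simp
    · conv_lhs => rw [hz, ← Real.cos_neg]
      congr 1
      simp only [Int.cast_neg, Int.cast_natCast]
      ring
  rw [h]
  exact Submodule.smul_mem _ _ (Submodule.subset_span ⟨_, rfl⟩)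

/-- The cosine modes. -/
noncomputable def neumannModes (hX : ∀ i, lo i < hi i) : Modes .neumann lo hi ℕ where
  mode i n := wave (lo i) (neumannAmplitude (hi i - lo i) n) (Real.pi * n / (hi i - lo i)) 0
  freq i n := Real.pi * n / (hi i - lo i)
  contDiff i n := contDiff_wave _ _ _ _
  deriv_deriv i n := deriv_deriv_wave _ _ _ _
  orthogonal i m n hmn := by
    have hL : 0 < hi i - lo i := sub_pos.2 (hX i)
    rw [integral_wave_mul_wave]
    have hz : ∀ z : ℤ, z ≠ 0 → ∫ x in Icc (lo i) (hi i),
        Real.cos (Real.pi * z / (hi i - lo i) * (x - lo i) + 0) = 0 := fun z hz => by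
      refine integral_cos_eq_zero (hX i).le ?_ ?_
      · have : (z : ℝ) ≠ 0 := by exact_mod_cast hz
        positivity
      · rw [div_mul_cancel₀ _ hL.ne', add_zero, mul_comm, Real.sin_int_mul_pi, Real.sin_zero]
    have h1 := hz (m - n) (by omega)
    have h2 := hz (m + n) (by omega)
    push_cast at h1 h2
    rw [← sub_div, ← add_div, ← mul_sub, ← mul_add, sub_zero, add_zero, h1, h2]
    simp
  normalized i n := by
    have hL : 0 < hi i - lo i := sub_pos.2 (hX i)
    rw [integral_wave_mul_wave, sub_self, sub_self, integral_cos_const (hX i).le, Real.cos_zero]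
    by_cases hn : n = 0
    · subst hn
      simp only [Nat.cast_zero, mul_zero, zero_div]
      rw [add_zero (0 : ℝ), integral_cos_const (hX i).le, Real.cos_zero, neumannAmplitude, if_pos rfl,
        Real.mul_self_sqrt (by positivity)]
      field_simp
      norm_num
    · rw [integral_cos_eq_zero (hX i).le]
      · simp only [neumannAmplitude, hn, if_false]
        rw [Real.mul_self_sqrt (by positivity)]
        field_simp
        norm_num
      · have : (n : ℝ) ≠ 0 := by exact_mod_cast hn
        positivity
      · have h : (Real.pi * n / (hi i - lo i) + Real.pi * n / (hi i - lo i)) * (hi i - lo i)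
            + (0 + 0) = ((2 * n : ℕ) : ℝ) * Real.pi := by
          push_cast
          field_simp
          ring
        rw [h, Real.sin_nat_mul_pi, add_zero, Real.sin_zero]
  boundary i n := by
    have hL : 0 < hi i - lo i := sub_pos.2 (hX i)
    constructor
    · rw [deriv_wave, wave]
      simp
    · rw [deriv_wave, wave, div_mul_cancel₀ _ hL.ne', zero_sub, ← sub_eq_add_neg,
        Real.cos_sub_pi_div_two, mul_comm Real.pi, Real.sin_nat_mul_pi, mul_zero]
  one_mem i := by
    have h := cos_mem_span_neumann (a := lo i) (sub_pos.2 (hX i)) 0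
    convert! h using 1
    funext x
    simp
  mul_mem i m n := by
    have hL : 0 < hi i - lo i := sub_pos.2 (hX i)
    have h1 := cos_mem_span_neumann (a := lo i) hL (m - n)
    have h2 := cos_mem_span_neumann (a := lo i) hL (m + n)
    convert! Submodule.smul_mem _ (neumannAmplitude (hi i - lo i) m *
      neumannAmplitude (hi i - lo i) n / 2) (Submodule.add_mem _ h1 h2) using 1
    funext x
    rw [Pi.mul_apply, wave_mul_wave]
    simp only [Pi.smul_apply, Pi.add_apply, smul_eq_mul]
    push_cast
    congr 3 <;> ring
  separates i x hx y hy h hxy := by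
    have hL : 0 < hi i - lo i := sub_pos.2 (hX i)
    refine absurd ?_ hxy
    -- The mode with index 1 alone separates points: it is a multiple of the cosine, rescaled to [0,
    -- π], where it is injective.
    have h1 := h 1
    simp only [wave, Nat.cast_one, mul_one, add_zero] at h1
    have h2 := mul_left_cancel₀ (neumannAmplitude_ne_zero hL 1) h1
    have hmem : ∀ z ∈ Icc (lo i) (hi i), Real.pi / (hi i - lo i) * (z - lo i) ∈ Icc 0 Real.pi := by
      intro z hz
      have h3 : 0 ≤ z - lo i := sub_nonneg.2 hz.1
      refine ⟨by positivity, ?_⟩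
      rw [div_mul_eq_mul_div, div_le_iff₀ hL]
      gcongr
      exact hz.2
    have h3 := Real.injOn_cos (hmem x hx) (hmem y hy) h2
    have h4 := mul_left_cancel₀ (by positivity) h3
    linarith

end Neumann

/-! ### Periodic modes -/

section Periodic

variable {d : ℕ} {lo hi : Fin d → ℝ}

/-- By the phase -π/4, the modes `z` and `-z` are proportional to cos + sin and cos - sin, with the
same factor. Their sum gives the cosine and their difference the sine. -/
lemma cos_mem_span_periodic {a L : ℝ} (hL : 0 < L) (z : ℤ) :
    (fun x => Real.cos (2 * Real.pi * z / L * (x - a))) ∈ Submodule.span ℝ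
      (range fun n : ℤ => wave a √(2 / L) (2 * Real.pi * n / L) (-(Real.pi / 4))) := by
  have hA : √(2 / L) ≠ 0 := by positivity
  have h : (fun x => Real.cos (2 * Real.pi * z / L * (x - a))) =
      (√(2 / L) * √2)⁻¹ • (wave a √(2 / L) (2 * Real.pi * z / L) (-(Real.pi / 4)) +
        wave a √(2 / L) (2 * Real.pi * (-z : ℤ) / L) (-(Real.pi / 4))) := by
    funext x
    have h1 : 2 * Real.pi * (-z : ℤ) / L * (x - a) = -(2 * Real.pi * z / L * (x - a)) := by
      push_cast; ring
    simp only [wave, Pi.smul_apply, Pi.add_apply, smul_eq_mul, h1, Real.cos_add, Real.cos_neg,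
      Real.sin_neg, Real.cos_pi_div_four, Real.sin_pi_div_four]
    field_simp
    ring
  rw [h]
  exact Submodule.smul_mem _ _ (Submodule.add_mem _ (Submodule.subset_span ⟨z, rfl⟩)
    (Submodule.subset_span ⟨-z, rfl⟩))

lemma sin_mem_span_periodic {a L : ℝ} (hL : 0 < L) (z : ℤ) :
    (fun x => Real.sin (2 * Real.pi * z / L * (x - a))) ∈ Submodule.span ℝ
      (range fun n : ℤ => wave a √(2 / L) (2 * Real.pi * n / L) (-(Real.pi / 4))) := by
  have hA : √(2 / L) ≠ 0 := by positivity
  have h : (fun x => Real.sin (2 * Real.pi * z / L * (x - a))) =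
      (√(2 / L) * √2)⁻¹ • (wave a √(2 / L) (2 * Real.pi * z / L) (-(Real.pi / 4)) -
        wave a √(2 / L) (2 * Real.pi * (-z : ℤ) / L) (-(Real.pi / 4))) := by
    funext x
    have h1 : 2 * Real.pi * (-z : ℤ) / L * (x - a) = -(2 * Real.pi * z / L * (x - a)) := by
      push_cast; ring
    simp only [wave, Pi.smul_apply, Pi.sub_apply, smul_eq_mul, h1, Real.cos_add, Real.cos_neg,
      Real.sin_neg, Real.cos_pi_div_four, Real.sin_pi_div_four]
    field_simp
    ring
  rw [h]
  exact Submodule.smul_mem _ _ (Submodule.sub_mem _ (Submodule.subset_span ⟨z, rfl⟩)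
    (Submodule.subset_span ⟨-z, rfl⟩))

lemma integral_cos_periodic {a c θ : ℝ} (hac : a < c) {z : ℤ} (hz : z ≠ 0) :
    ∫ x in Icc a c, Real.cos (2 * Real.pi * z / (c - a) * (x - a) + θ) = 0 := by
  have hL : 0 < c - a := sub_pos.2 hac
  refine integral_cos_eq_zero hac.le ?_ ?_
  · have : (z : ℝ) ≠ 0 := by exact_mod_cast hz
    positivity
  · rw [div_mul_cancel₀ _ hL.ne', add_comm, mul_comm _ (z : ℝ), Real.sin_add_int_mul_two_pi]

/-- Twice the phase is -π/2, where the cosine vanishes, so frequency sum 0 is no exception. Hence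
the modes `n` and `-n` are orthogonal, and the constant mode has the same amplitude as the others.
-/
lemma integral_cos_periodic_add {a c : ℝ} (hac : a < c) (z : ℤ) :
    ∫ x in Icc a c, Real.cos (2 * Real.pi * z / (c - a) * (x - a) +
      (-(Real.pi / 4) + -(Real.pi / 4))) = 0 := by
  by_cases hz : z = 0
  · have h : -(Real.pi / 4) + -(Real.pi / 4) = -(Real.pi / 2) := by ring
    subst hz
    simp only [Int.cast_zero, mul_zero, zero_div]
    rw [integral_cos_const hac.le, h, Real.cos_neg, Real.cos_pi_div_two, mul_zero]
  · exact integral_cos_periodic hac hz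

/-- The modes `x ↦ cos (2 π n (x - a) / L) + sin (2 π n (x - a) / L)`, normalised. -/
noncomputable def periodicModes (hX : ∀ i, lo i < hi i) : Modes .periodic lo hi ℤ where
  mode i n := wave (lo i) √(2 / (hi i - lo i)) (2 * Real.pi * n / (hi i - lo i)) (-(Real.pi / 4))
  freq i n := 2 * Real.pi * n / (hi i - lo i)
  contDiff i n := contDiff_wave _ _ _ _
  deriv_deriv i n := deriv_deriv_wave _ _ _ _
  orthogonal i m n hmn := by
    rw [integral_wave_mul_wave, ← sub_div, ← add_div, ← mul_sub, ← mul_add, ← Int.cast_sub,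
      ← Int.cast_add, integral_cos_periodic (hX i) (sub_ne_zero.2 hmn),
      integral_cos_periodic_add (hX i)]
    simp
  normalized i n := by
    have hL : 0 < hi i - lo i := sub_pos.2 (hX i)
    rw [integral_wave_mul_wave, sub_self, sub_self, integral_cos_const (hX i).le, Real.cos_zero,
      ← add_div, ← mul_add, ← Int.cast_add, integral_cos_periodic_add (hX i),
      Real.mul_self_sqrt (by positivity)]
    field_simp
    norm_num
  boundary i n x := by
    have hL : 0 < hi i - lo i := sub_pos.2 (hX i)
    have h : 2 * Real.pi * n / (hi i - lo i) * (x + (hi i - lo i) - lo i) + -(Real.pi / 4) =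
        2 * Real.pi * n / (hi i - lo i) * (x - lo i) + -(Real.pi / 4) + n * (2 * Real.pi) := by
      field_simp
      ring
    simp only [wave]
    rw [h, Real.cos_add_int_mul_two_pi]
  one_mem i := by
    have h := cos_mem_span_periodic (a := lo i) (sub_pos.2 (hX i)) 0
    convert! h using 1
    funext x
    simp
  mul_mem i m n := by
    have hL : 0 < hi i - lo i := sub_pos.2 (hX i)
    have h1 := cos_mem_span_periodic (a := lo i) hL (m - n)
    have h2 := sin_mem_span_periodic (a := lo i) hL (m + n)
    convert! Submodule.smul_mem _ (√(2 / (hi i - lo i)) * √(2 / (hi i - lo i)) / 2)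
      (Submodule.add_mem _ h1 h2) using 1
    funext x
    rw [Pi.mul_apply, wave_mul_wave]
    simp only [Pi.smul_apply, Pi.add_apply, smul_eq_mul]
    -- In the product the two phases add up to -π/2 and turn the sum-frequency cosine into a sine.
    rw [← Real.cos_sub_pi_div_two]
    push_cast
    congr 3 <;> ring
  separates i x hx y hy h hxy := by
    have hL : 0 < hi i - lo i := sub_pos.2 (hX i)
    have hspan : ∀ g ∈ Submodule.span ℝ (range fun n : ℤ => wave (lo i) √(2 / (hi i - lo i))
        (2 * Real.pi * n / (hi i - lo i)) (-(Real.pi / 4))), g x = g y := by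
      intro g hg
      induction hg using Submodule.span_induction with
      | mem g hg => obtain ⟨n, rfl⟩ := hg; exact h n
      | zero => rfl
      | add g g' _ _ h1 h2 => simp [h1, h2]
      | smul c g _ h1 => simp [h1]
    have hc := hspan _ (cos_mem_span_periodic (a := lo i) hL 1)
    have hs := hspan _ (sin_mem_span_periodic (a := lo i) hL 1)
    simp only [Int.cast_one, mul_one] at hc hs
    -- Equal cosines and sines force x - y to be an integer multiple of the edge length; for
    -- distinct points of the edge this leaves only opposite ends.
    have h1 : Real.cos (2 * Real.pi / (hi i - lo i) * (x - lo i) -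
        2 * Real.pi / (hi i - lo i) * (y - lo i)) = 1 := by
      rw [Real.cos_sub, hc, hs, ← sq, ← sq, Real.cos_sq_add_sin_sq]
    obtain ⟨z, hz⟩ := (Real.cos_eq_one_iff _).1 h1
    have h2 : (z : ℝ) * (hi i - lo i) = x - y := by
      field_simp at hz
      have := Real.pi_pos
      nlinarith
    have hx1 := hx.1
    have hx2 := hx.2
    have hy1 := hy.1
    have hy2 := hy.2
    have hz0 : z ≠ 0 := by
      rintro rfl
      simp only [Int.cast_zero, zero_mul] at h2
      exact hxy (by linarith)
    rcases lt_or_gt_of_ne hz0 with hneg | hpos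
    · have : (z : ℝ) ≤ -1 := by exact_mod_cast (by omega : z ≤ -1)
      have h3 : x - y ≤ -(hi i - lo i) := by nlinarith
      exact ⟨Or.inl (by linarith), Or.inr (by linarith)⟩
    · have : (1 : ℝ) ≤ z := by exact_mod_cast hpos
      have h3 : hi i - lo i ≤ x - y := by nlinarith
      exact ⟨Or.inr (by linarith), Or.inl (by linarith)⟩

end Periodic

lemma exists_modes {d : ℕ} {lo hi : Fin d → ℝ} (hX : ∀ i, lo i < hi i) (bc : BoundaryCondition) :
    ∃ I : Type, Countable I ∧ Nonempty (Modes bc lo hi I) := by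
  cases bc with
  | periodic => exact ⟨ℤ, inferInstance, ⟨periodicModes hX⟩⟩
  | neumann => exact ⟨ℕ, inferInstance, ⟨neumannModes hX⟩⟩

/-! ### Stone-Weierstrass and completeness of the modes -/

section StoneWeierstrass

/-- The Stone-Weierstrass theorem for functions that need not separate points. -/
lemma mem_closure_of_forall_eq {X : Type*} [TopologicalSpace X] [CompactSpace X]
    (A : Subalgebra ℝ C(X, ℝ)) (f : C(X, ℝ))
    (hf : ∀ x y, (∀ a ∈ A, a x = a y) → f x = f y) : f ∈ A.topologicalClosure := by
  -- On the quotient that identifies the points not separated by `A`, the functions of `A` separate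
  -- points and `f` is still defined.
  let s : Setoid X := ⟨fun x y => ∀ a ∈ A, a x = a y, fun _ _ _ => rfl,
    fun h a ha => (h a ha).symm, fun h h' a ha => (h a ha).trans (h' a ha)⟩
  let π : C(X, Quotient s) := ⟨Quotient.mk s, continuous_quotient_mk'⟩
  let Φ : C(Quotient s, ℝ) →ₐ[ℝ] C(X, ℝ) := ContinuousMap.compRightAlgHom ℝ ℝ π
  have hsep : (A.comap Φ).SeparatesPoints := by
    intro p q
    refine Quotient.inductionOn₂ p q fun x y hxy => ?_
    have : ¬ ∀ a ∈ A, a x = a y := fun h => hxy (Quotient.sound h)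
    push Not at this
    obtain ⟨a, ha, hne⟩ := this
    let a' : C(Quotient s, ℝ) := ⟨Quotient.lift a fun x y h => h a ha, a.continuous.quotient_lift _⟩
    have h1 : Φ a' = a := by ext x; rfl
    exact ⟨a', ⟨a', by simpa [h1] using ha, rfl⟩, hne⟩
  let f' : C(Quotient s, ℝ) := ⟨Quotient.lift f hf, f.continuous.quotient_lift _⟩
  have h1 : Φ f' = f := by ext x; rfl
  have h2 : f' ∈ (A.comap Φ).topologicalClosure := by
    rw [ContinuousMap.subalgebra_topologicalClosure_eq_top_of_separatesPoints _ hsep]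
    trivial
  rw [← h1]
  have hΦ : Continuous Φ := ContinuousMap.continuous_precomp π
  exact map_mem_closure hΦ h2 fun g hg => hg

end StoneWeierstrass

/-! ### Continuous functions in L², and the basis of eigenfunctions -/

section L2

variable {d : ℕ} {lo hi : Fin d → ℝ}

instance isFiniteMeasure_box : IsFiniteMeasure (volume.restrict (Icc lo hi)) :=
  isFiniteMeasure_restrict.2 isCompact_Icc.measure_lt_top.ne

lemma memLp_of_continuous {w : (Fin d → ℝ) → ℝ} (hw : Continuous w) (p : ENNReal) :
    MemLp w p (volume.restrict (Icc lo hi)) := by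
  obtain ⟨C, hC⟩ := (isCompact_Icc (a := lo) (b := hi)).exists_bound_of_continuousOn hw.continuousOn
  exact MemLp.of_bound hw.aestronglyMeasurable C
    ((ae_restrict_iff' measurableSet_Icc).2 (Eventually.of_forall hC))

/-- A continuous function as an element of `L²`. -/
noncomputable def toL2 (w : (Fin d → ℝ) → ℝ) (hw : Continuous w) : L2 lo hi :=
  (memLp_of_continuous hw 2).toLp w

lemma coeFn_toL2 {w : (Fin d → ℝ) → ℝ} (hw : Continuous w) :
    (toL2 w hw : L2 lo hi) =ᵐ[volume.restrict (Icc lo hi)] w := MemLp.coeFn_toLp _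

lemma inner_toL2 {w : (Fin d → ℝ) → ℝ} (hw : Continuous w) (v : L2 lo hi) :
    ⟪toL2 w hw, v⟫ = ∫ x in Icc lo hi, v x * w x := by
  rw [L2.inner_def]
  refine integral_congr_ae ?_
  filter_upwards [coeFn_toL2 (lo := lo) (hi := hi) hw] with x hx
  rw [hx]
  rfl

lemma inner_toL2_toL2 {w v : (Fin d → ℝ) → ℝ} (hw : Continuous w) (hv : Continuous v) :
    ⟪(toL2 w hw : L2 lo hi), toL2 v hv⟫ = ∫ x in Icc lo hi, v x * w x := by
  rw [inner_toL2]
  refine integral_congr_ae ?_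
  filter_upwards [coeFn_toL2 (lo := lo) (hi := hi) hv] with x hx
  rw [hx]

lemma integrable_mul_of_continuous (v : L2 lo hi) {w : (Fin d → ℝ) → ℝ} (hw : Continuous w) :
    IntegrableOn (fun x => v x * w x) (Icc lo hi) :=
  (Lp.memLp v).integrable_mul (memLp_of_continuous hw 2)

lemma eq_zero_of_forall_integral_eq_zero {v : L2 lo hi}
    (h : ∀ φ : (Fin d → ℝ) → ℝ, ContDiff ℝ ∞ φ → HasCompactSupport φ →
      tsupport φ ⊆ interior (Icc lo hi) → ∫ x in Icc lo hi, v x * φ x = 0) : v = 0 := by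
  have hint : IntegrableOn v (Icc lo hi) := (Lp.memLp v).integrable (by norm_num)
  have h1 := isOpen_interior.ae_eq_zero_of_integral_contDiff_smul_eq_zero (μ := volume) (f := v)
    (hint.mono_set interior_subset).locallyIntegrableOn (fun φ h1 h2 h3 => by
      rw [← h φ h1 h2 h3]
      rw [← setIntegral_eq_integral_of_forall_compl_eq_zero (s := Icc lo hi)]
      · simp only [smul_eq_mul, mul_comm]
      · intro x hx
        rw [image_eq_zero_of_notMem_tsupport fun hx' => hx (interior_subset (h3 hx')), zero_smul])
  refine Lp.eq_zero_iff_ae_eq_zero.2 ?_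
  filter_upwards [ae_restrict_of_ae h1, ae_mem_interior_box lo hi] with x hx hxi
  exact hx hxi

lemma eq_of_forall_inner_eq {v v' : L2 lo hi}
    (h : ∀ (φ : (Fin d → ℝ) → ℝ) (hφ : ContDiff ℝ ∞ φ), HasCompactSupport φ →
      tsupport φ ⊆ interior (Icc lo hi) →
        ⟪toL2 φ hφ.continuous, v⟫ = ⟪toL2 φ hφ.continuous, v'⟫) : v = v' := by
  rw [← sub_eq_zero]
  refine eq_zero_of_forall_integral_eq_zero fun φ h1 h2 h3 => ?_
  rw [← inner_toL2 h1.continuous, inner_sub_right, h φ h1 h2 h3, sub_self]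

end L2

namespace Modes

variable {d : ℕ} {bc : BoundaryCondition} {lo hi : Fin d → ℝ} {I : Type}

/-- The eigenfunctions as elements of `L²`. -/
noncomputable def eigL2 (M : Modes bc lo hi I) (k : Fin d → I) : L2 lo hi :=
  toL2 (M.eig k) (M.contDiff_eig k).continuous

lemma orthonormal_eigL2 (M : Modes bc lo hi I) : Orthonormal ℝ M.eigL2 := by
  refine ⟨fun k => ?_, fun k l hkl => ?_⟩
  · have h : ⟪M.eigL2 k, M.eigL2 k⟫ = 1 := by
      rw [eigL2, inner_toL2_toL2, M.integral_eig_mul_self]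
    rw [real_inner_self_eq_norm_sq] at h
    exact (pow_eq_one_iff_of_nonneg (norm_nonneg _) two_ne_zero).1 h
  · exact (inner_toL2_toL2 _ _).trans (M.integral_eig_mul_eig hkl.symm)

/-- The algebra of linear combinations of eigenfunctions. -/
noncomputable def spanAlgebra (M : Modes bc lo hi I) : Subalgebra ℝ ((Fin d → ℝ) → ℝ) :=
  (Submodule.span ℝ (range M.eig)).toSubalgebra
    (by
      have h := prodFun_mem_span (m := M.mode) (F := fun _ => 1) M.one_mem
      convert! h using 1
      funext x
      simp [prodFun])
    (by
      intro f g hf hg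
      have hle : Submodule.span ℝ (range M.eig) * Submodule.span ℝ (range M.eig) ≤
          Submodule.span ℝ (range M.eig) := by
        rw [Submodule.span_mul_span, Submodule.span_le]
        rintro _ ⟨_, ⟨k, rfl⟩, _, ⟨l, rfl⟩, rfl⟩
        have h := prodFun_mem_span (m := M.mode) (F := fun i => M.mode i (k i) * M.mode i (l i))
          fun i => M.mul_mem i (k i) (l i)
        convert! h using 1
        funext x
        exact prodFun_mul _ _ x
      exact hle (Submodule.mul_mem_mul hf hg))

lemma mem_spanAlgebra (M : Modes bc lo hi I) {w : (Fin d → ℝ) → ℝ} :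
    w ∈ M.spanAlgebra ↔ w ∈ Submodule.span ℝ (range M.eig) := Iff.rfl

lemma coord_mem_spanAlgebra (M : Modes bc lo hi I) (i : Fin d) (n : I) :
    (fun x : Fin d → ℝ => M.mode i n (x i)) ∈ M.spanAlgebra := by
  rw [mem_spanAlgebra]
  have h := prodFun_mem_span (m := M.mode) (F := Function.update (fun _ => 1) i (M.mode i n))
    (fun l => by
      by_cases hl : l = i
      · subst hl; simpa using Submodule.subset_span (mem_range_self n)
      · simpa [hl] using M.one_mem l)
  convert! h using 1
  funext x
  simp [prodFun_update_apply]

lemma continuous_of_mem_spanAlgebra (M : Modes bc lo hi I) {w : (Fin d → ℝ) → ℝ}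
    (hw : w ∈ M.spanAlgebra) : Continuous w := by
  rw [mem_spanAlgebra] at hw
  induction hw using Submodule.span_induction with
  | mem w hw => obtain ⟨k, rfl⟩ := hw; exact (M.contDiff_eig k).continuous
  | zero => exact continuous_const
  | add f g _ _ hf hg => exact hf.add hg
  | smul c f _ hf => exact hf.const_smul c

lemma integral_mul_eq_zero_of_mem_spanAlgebra (M : Modes bc lo hi I) {v : L2 lo hi}
    (hv : ∀ k, ⟪M.eigL2 k, v⟫ = 0) {w : (Fin d → ℝ) → ℝ} (hw : w ∈ M.spanAlgebra) :
    ∫ x in Icc lo hi, v x * w x = 0 := by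
  rw [mem_spanAlgebra] at hw
  induction hw using Submodule.span_induction with
  | mem w hw =>
    obtain ⟨k, rfl⟩ := hw
    rw [← inner_toL2 (M.contDiff_eig k).continuous]
    exact hv k
  | zero => simp
  | add f g hf hg h1 h2 =>
    have h3 := integrable_mul_of_continuous v (M.continuous_of_mem_spanAlgebra hf)
    have h4 := integrable_mul_of_continuous v (M.continuous_of_mem_spanAlgebra hg)
    simp only [Pi.add_apply, mul_add]
    rw [integral_add h3 h4, h1, h2, add_zero]
  | smul c f _ h1 =>
    simp only [Pi.smul_apply, smul_eq_mul, mul_left_comm _ c]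
    rw [integral_const_mul, h1, mul_zero]

/-- Functions supported in the interior of the box are uniform limits of linear combinations of
eigenfunctions. -/
lemma exists_mem_spanAlgebra_near (M : Modes bc lo hi I) {φ : (Fin d → ℝ) → ℝ}
    (hφ : Continuous φ) (hs : tsupport φ ⊆ interior (Icc lo hi)) {ε : ℝ} (hε : 0 < ε) :
    ∃ w ∈ M.spanAlgebra, ∀ x ∈ Icc lo hi, |φ x - w x| < ε := by
  let R : ((Fin d → ℝ) → ℝ) →ₐ[ℝ] (Icc lo hi → ℝ) :=
    AlgHom.pi fun x => Pi.evalAlgHom ℝ (fun _ : Fin d → ℝ => ℝ) x.1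
  let A : Subalgebra ℝ C(Icc lo hi, ℝ) :=
    (M.spanAlgebra.map R).comap (ContinuousMap.coeFnAlgHom ℝ)
  let f : C(Icc lo hi, ℝ) := ⟨fun x => φ x, hφ.comp continuous_subtype_val⟩
  have hA : ∀ w (hw : w ∈ M.spanAlgebra), (⟨fun x => w x, (M.continuous_of_mem_spanAlgebra hw).comp
      continuous_subtype_val⟩ : C(Icc lo hi, ℝ)) ∈ A := fun w hw => ⟨w, hw, rfl⟩
  have hmem : f ∈ A.topologicalClosure := by
    refine mem_closure_of_forall_eq A f fun x y hxy => ?_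
    by_cases hne : x = y
    · rw [hne]
    obtain ⟨i, hxyi⟩ := Function.ne_iff.1 fun h => hne (Subtype.ext h)
    have hsep := M.separates i (x.1 i) ⟨x.2.1 i, x.2.2 i⟩ (y.1 i) ⟨y.2.1 i, y.2.2 i⟩
      (fun n => hxy _ (hA _ (M.coord_mem_spanAlgebra i n))) hxyi
    -- Two distinct points that no element of `A` separates have a coordinate in which both lie on a
    -- face, and there φ is 0.
    have hzero : ∀ z : Fin d → ℝ, z i = lo i ∨ z i = hi i → φ z = 0 := by
      intro z hz
      refine image_eq_zero_of_notMem_tsupport fun hz' => ?_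
      have h := hs hz'
      rw [interior_box] at h
      have h' := h i (mem_univ i)
      rcases hz with hz | hz
      · exact h'.1.ne' hz
      · exact h'.2.ne hz
    exact (hzero _ hsep.1).trans (hzero _ hsep.2).symm
  obtain ⟨g, ⟨w, hw, hwg⟩, hg⟩ := Metric.mem_closure_iff.1 hmem ε hε
  refine ⟨w, hw, fun x hx => ?_⟩
  have h1 : w x = g ⟨x, hx⟩ := congrFun hwg ⟨x, hx⟩
  rw [h1]
  exact (ContinuousMap.dist_apply_le_dist (f := f) (g := g) ⟨x, hx⟩).trans_lt hg

/-- This is completeness: `v` annihilates the span of the modes, hence every smooth function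
supported in the interior by uniform approximation, and these detect `v`. -/
lemma eq_zero_of_forall_inner_eigL2_eq_zero (M : Modes bc lo hi I) {v : L2 lo hi}
    (hv : ∀ k, ⟪M.eigL2 k, v⟫ = 0) : v = 0 := by
  refine eq_zero_of_forall_integral_eq_zero fun φ hφ _ hs => ?_
  have hint : IntegrableOn v (Icc lo hi) := (Lp.memLp v).integrable (by norm_num)
  set N := ∫ x in Icc lo hi, |v x|
  have hN : 0 ≤ N := integral_nonneg fun x => abs_nonneg _
  rw [← abs_nonpos_iff]
  refine le_of_forall_pos_le_add fun ε hε => ?_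
  -- The error in the integral is at most the L¹ norm `N` times the uniform error; adding 1 avoids
  -- dividing by 0.
  obtain ⟨w, hw, hwφ⟩ := M.exists_mem_spanAlgebra_near hφ.continuous hs
    (ε := ε / (N + 1)) (by positivity)
  have hwc := M.continuous_of_mem_spanAlgebra hw
  have h1 : ∫ x in Icc lo hi, v x * φ x = ∫ x in Icc lo hi, v x * (φ x - w x) := by
    simp only [mul_sub]
    rw [integral_sub (integrable_mul_of_continuous v hφ.continuous)
      (integrable_mul_of_continuous v hwc), M.integral_mul_eq_zero_of_mem_spanAlgebra hv hw,
      sub_zero]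
  have h2 : |∫ x in Icc lo hi, v x * (φ x - w x)| ≤ ∫ x in Icc lo hi, |v x| * (ε / (N + 1)) := by
    rw [← Real.norm_eq_abs]
    refine norm_integral_le_of_norm_le (hint.abs.mul_const _) ?_
    filter_upwards [ae_restrict_mem measurableSet_Icc] with x hx
    rw [Real.norm_eq_abs, abs_mul]
    exact mul_le_mul_of_nonneg_left (hwφ x hx).le (abs_nonneg _)
  rw [h1, zero_add]
  refine h2.trans ?_
  rw [integral_mul_const, mul_div_assoc', div_le_iff₀ (by positivity)]
  nlinarith

/-- The orthonormal basis of eigenfunctions. -/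
noncomputable def basis (M : Modes bc lo hi I) : HilbertBasis (Fin d → I) ℝ (L2 lo hi) :=
  HilbertBasis.mkOfOrthogonalEqBot M.orthonormal_eigL2 (by
    rw [Submodule.eq_bot_iff]
    intro v hv
    exact M.eq_zero_of_forall_inner_eigL2_eq_zero fun k =>
      (Submodule.mem_orthogonal _ _).1 hv _ (Submodule.subset_span (mem_range_self k)))

lemma basis_apply (M : Modes bc lo hi I) (k : Fin d → I) : M.basis k = M.eigL2 k := by
  rw [basis, HilbertBasis.coe_mkOfOrthogonalEqBot]

end Modes

/-! ### Cutoffs, and testing weak derivatives with derivatives of eigenfunctions -/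

section Cutoff

/-- A smooth cutoff function for the interval `[a, c]`. -/
noncomputable def cutoff (a c δ t : ℝ) : ℝ := Real.smoothTransition ((t - a) * (c - t) / δ - 1)

lemma contDiff_cutoff (a c δ : ℝ) : ContDiff ℝ ∞ (cutoff a c δ) :=
  Real.smoothTransition.contDiff.comp
    ((((contDiff_id.sub contDiff_const).mul (contDiff_const.sub contDiff_id)).div_const δ).sub
      contDiff_const)

lemma abs_cutoff_le_one (a c δ t : ℝ) : |cutoff a c δ t| ≤ 1 := by
  rw [cutoff, abs_of_nonneg (Real.smoothTransition.nonneg _)]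
  exact Real.smoothTransition.le_one _

lemma cutoff_eq_zero {a c δ t : ℝ} (hδ : 0 < δ) (h : (t - a) * (c - t) ≤ δ) :
    cutoff a c δ t = 0 := by
  refine Real.smoothTransition.zero_of_nonpos ?_
  rw [sub_nonpos, div_le_one hδ]
  exact h

lemma cutoff_eq_one {a c δ t : ℝ} (hδ : 0 < δ) (h : 2 * δ ≤ (t - a) * (c - t)) :
    cutoff a c δ t = 1 := by
  refine Real.smoothTransition.one_of_one_le ?_
  rw [le_sub_iff_add_le, le_div_iff₀ hδ]
  linarith

/-- The derivative lives only where (t - a)(c - t) lies between δ and 2δ, and there it is of order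
(c - a)/δ. The product is therefore bounded uniformly in δ. -/
lemma exists_deriv_cutoff_le (a c : ℝ) : ∃ R, 0 ≤ R ∧ ∀ δ > 0, ∀ t ∈ Icc a c,
    |deriv (cutoff a c δ) t| * ((t - a) * (c - t)) ≤ R * (c - a) := by
  have hρ : ContDiff ℝ 1 Real.smoothTransition := Real.smoothTransition.contDiff
  obtain ⟨R, hR⟩ := (isCompact_Icc (a := (0 : ℝ)) (b := 1)).exists_bound_of_continuousOn
    (hρ.continuous_deriv le_rfl).continuousOn
  have hR0 : 0 ≤ R := (norm_nonneg _).trans (hR 0 ⟨le_rfl, zero_le_one⟩)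
  refine ⟨2 * R, by positivity, fun δ hδ t ht => ?_⟩
  have hD : 0 ≤ (t - a) * (c - t) := mul_nonneg (sub_nonneg.2 ht.1) (sub_nonneg.2 ht.2)
  have hca : 0 ≤ c - a := by linarith [ht.1, ht.2]
  rcases lt_or_ge ((t - a) * (c - t)) δ with h1 | h1
  · have hev : cutoff a c δ =ᶠ[𝓝 t] fun _ => 0 := by
      have : ∀ᶠ s in 𝓝 t, (s - a) * (c - s) < δ :=
        (by fun_prop : Continuous fun s => (s - a) * (c - s)).continuousAt.eventually_lt_const h1
      filter_upwards [this] with s hs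
      exact cutoff_eq_zero hδ hs.le
    rw [hev.deriv_eq]
    simp only [deriv_const, abs_zero, zero_mul]
    positivity
  rcases lt_or_ge (2 * δ) ((t - a) * (c - t)) with h2 | h2
  · have hev : cutoff a c δ =ᶠ[𝓝 t] fun _ => 1 := by
      have : ∀ᶠ s in 𝓝 t, 2 * δ < (s - a) * (c - s) :=
        (by fun_prop : Continuous fun s => (s - a) * (c - s)).continuousAt.eventually_const_lt h2
      filter_upwards [this] with s hs
      exact cutoff_eq_one hδ hs.le
    rw [hev.deriv_eq]
    simp only [deriv_const, abs_zero, zero_mul]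
    positivity
  have hy : (t - a) * (c - t) / δ - 1 ∈ Icc (0 : ℝ) 1 := by
    constructor
    · rw [sub_nonneg, le_div_iff₀ hδ]; linarith
    · rw [sub_le_iff_le_add, div_le_iff₀ hδ]; linarith
  have hin : HasDerivAt (fun s => (s - a) * (c - s) / δ - 1)
      ((1 * (c - t) + (t - a) * -1) / δ) t :=
    ((((hasDerivAt_id' t).sub_const a).mul ((hasDerivAt_id' t).const_sub c)).div_const δ).sub_const 1
  have hd := ((hρ.differentiable one_ne_zero _).hasDerivAt.comp t hin).deriv
  have hd' : deriv (cutoff a c δ) t = deriv Real.smoothTransition ((t - a) * (c - t) / δ - 1) *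
      ((1 * (c - t) + (t - a) * -1) / δ) := hd
  have h3 := hR _ hy
  rw [Real.norm_eq_abs] at h3
  have h4 : |1 * (c - t) + (t - a) * -1| ≤ c - a := by
    rw [abs_le]
    constructor <;> linarith [ht.1, ht.2]
  rw [hd', abs_mul, abs_div, abs_of_pos hδ]
  calc _ ≤ R * ((c - a) / δ) * (2 * δ) := by gcongr
    _ = 2 * R * (c - a) := by field_simp

/-- Approximation of a smooth function on `[a, c]` by functions supported in the interior. If the
function vanishes at the end points, then the derivatives remain bounded. -/
lemma exists_interior_approx {a c : ℝ} (hac : a < c) {s : ℝ → ℝ} (hs : ContDiff ℝ ∞ s) :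
    ∃ F : ℕ → ℝ → ℝ, (∀ n, ContDiff ℝ ∞ (F n)) ∧
      (∀ n, ∃ a' c', a < a' ∧ c' < c ∧ ∀ x ∉ Icc a' c', F n x = 0) ∧
      (∃ C, ∀ n, ∀ x ∈ Icc a c, |F n x| ≤ C) ∧
      (∀ x ∈ Ioo a c, ∀ᶠ n in atTop, F n x = s x) ∧
      (∀ x ∈ Ioo a c, ∀ᶠ n in atTop, deriv (F n) x = deriv s x) ∧
      (s a = 0 → s c = 0 → ∃ C, ∀ n, ∀ x ∈ Icc a c, |deriv (F n) x| ≤ C) := by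
  have hL : 0 < c - a := sub_pos.2 hac
  have hδ : ∀ n : ℕ, (0 : ℝ) < 1 / (n + 1) := fun n => by positivity
  obtain ⟨S₀, hS₀⟩ := (isCompact_Icc (a := a) (b := c)).exists_bound_of_continuousOn
    hs.continuous.continuousOn
  obtain ⟨S, hS⟩ := (isCompact_Icc (a := a) (b := c)).exists_bound_of_continuousOn
    (hs.continuous_deriv (by simp)).continuousOn
  have hnear : ∀ x ∈ Ioo a c, ∀ᶠ n : ℕ in atTop,
      (fun t => cutoff a c (1 / (n + 1)) t * s t) =ᶠ[𝓝 x] s := by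
    intro x hx
    have hD : 0 < (x - a) * (c - x) := mul_pos (sub_pos.2 hx.1) (sub_pos.2 hx.2)
    have hlim := (tendsto_one_div_add_atTop_nhds_zero_nat (𝕜 := ℝ)).const_mul 2
    rw [mul_zero] at hlim
    filter_upwards [hlim.eventually (gt_mem_nhds hD)] with n hn
    have : ∀ᶠ t in 𝓝 x, 2 * (1 / ((n : ℝ) + 1)) < (t - a) * (c - t) :=
      (by fun_prop : Continuous fun s => (s - a) * (c - s)).continuousAt.eventually_const_lt hn
    filter_upwards [this] with t ht
    rw [cutoff_eq_one (hδ n) ht.le, one_mul]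
  refine ⟨fun n t => cutoff a c (1 / (n + 1)) t * s t, fun n => (contDiff_cutoff _ _ _).mul hs,
    fun n => ?_, ⟨S₀, fun n x hx => ?_⟩, fun x hx => ?_, fun x hx => ?_, fun ha hc => ?_⟩
  · set δ : ℝ := 1 / (n + 1)
    -- Where the cutoff is non-zero, (x - a)(c - x) > δ; as each factor is at most c - a, each
    -- exceeds δ/(c - a).
    refine ⟨a + δ / (c - a), c - δ / (c - a), ?_, ?_, fun x hx => ?_⟩
    · have := hδ n
      have : 0 < δ / (c - a) := by positivity
      linarith
    · have := hδ n
      have : 0 < δ / (c - a) := by positivity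
      linarith
    · refine mul_eq_zero_of_left (cutoff_eq_zero (hδ n) ?_) _
      by_contra hcon
      push Not at hcon
      have hD : 0 < (x - a) * (c - x) := (hδ n).trans hcon
      have hx1 : a < x ∧ x < c := by
        rcases mul_pos_iff.1 hD with h | h
        · exact ⟨by linarith [h.1], by linarith [h.2]⟩
        · linarith [h.1, h.2]
      refine hx ⟨?_, ?_⟩
      · have : δ / (c - a) ≤ x - a := by
          rw [div_le_iff₀ hL]
          nlinarith [hx1.1, hx1.2]
        linarith
      · have : δ / (c - a) ≤ c - x := by
          rw [div_le_iff₀ hL]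
          nlinarith [hx1.1, hx1.2]
        linarith
  · rw [abs_mul]
    calc _ ≤ 1 * S₀ := by
          gcongr
          · exact abs_cutoff_le_one _ _ _ _
          · exact hS₀ x hx
      _ = S₀ := one_mul _
  · filter_upwards [hnear x hx] with n hn
    exact hn.eq_of_nhds
  · filter_upwards [hnear x hx] with n hn
    exact hn.deriv_eq
  · obtain ⟨R, hR0, hR⟩ := exists_deriv_cutoff_le a c
    have hsd : Differentiable ℝ s := hs.differentiable (by simp)
    have hS0 : 0 ≤ S := (norm_nonneg _).trans (hS a ⟨le_rfl, hac.le⟩)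
    refine ⟨2 * S * R + S, fun n x hx => ?_⟩
    have hsx : ∀ y ∈ Icc a c, |s x - s y| ≤ S * |x - y| := fun y hy =>
      (convex_Icc a c).norm_image_sub_le_of_norm_deriv_le (fun z _ => hsd z) hS hy hx
    have h1 := hsx a ⟨le_rfl, hac.le⟩
    have h2 := hsx c ⟨hac.le, le_rfl⟩
    rw [ha, sub_zero, abs_of_nonneg (sub_nonneg.2 hx.1)] at h1
    rw [hc, sub_zero, abs_sub_comm, abs_of_nonneg (sub_nonneg.2 hx.2)] at h2
    -- The two Lipschitz bounds at the end points are multiplied by the distance to the opposite end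
    -- and added. Thus `s` vanishes at the rate needed to compensate the derivative of the cutoff.
    have h3 : |s x| * (c - a) ≤ 2 * S * ((x - a) * (c - x)) := by
      have e1 := mul_le_mul_of_nonneg_right h1 (sub_nonneg.2 hx.2)
      have e2 := mul_le_mul_of_nonneg_right h2 (sub_nonneg.2 hx.1)
      nlinarith
    have hder : deriv (fun t => cutoff a c (1 / (n + 1)) t * s t) x =
        deriv (cutoff a c (1 / (n + 1))) x * s x + cutoff a c (1 / (n + 1)) x * deriv s x :=
      deriv_fun_mul ((contDiff_cutoff _ _ _).differentiable (by simp) x) (hsd x)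
    rw [hder]
    refine (abs_add_le _ _).trans (add_le_add ?_ ?_)
    · rw [abs_mul]
      have h4 := hR _ (hδ n) x hx
      have h5 : |deriv (cutoff a c (1 / (n + 1))) x| * |s x| * (c - a) ≤
          2 * S * R * (c - a) := by
        calc _ = |deriv (cutoff a c (1 / (n + 1))) x| * (|s x| * (c - a)) := by ring
          _ ≤ |deriv (cutoff a c (1 / (n + 1))) x| * (2 * S * ((x - a) * (c - x))) := by gcongr
          _ = 2 * S * (|deriv (cutoff a c (1 / (n + 1))) x| * ((x - a) * (c - x))) := by ring
          _ ≤ 2 * S * (R * (c - a)) := by gcongr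
          _ = _ := by ring
      exact le_of_mul_le_mul_right h5 hL
    · rw [abs_mul]
      calc _ ≤ 1 * S := by
            gcongr
            · exact abs_cutoff_le_one _ _ _ _
            · exact hS x hx
        _ = S := one_mul _

end Cutoff

namespace Modes

variable {d : ℕ} {bc : BoundaryCondition} {lo hi : Fin d → ℝ} {I : Type}

/-- The weak derivative of a function in `H¹` may be tested with derivatives of eigenfunctions. -/
lemma integral_weakPartial_mul_pderiv_eig (M : Modes bc lo hi I) (hX : ∀ i, lo i < hi i)
    {j : Fin d} {v g : L2 lo hi} (h : IsWeakPartial bc lo hi j v g) (k : Fin d → I) :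
    ∫ x in Icc lo hi, g x * pderiv j (M.eig k) x =
      M.freq j (k j) ^ 2 * ∫ x in Icc lo hi, v x * M.eig k x := by
  suffices hmain : ∫ x in Icc lo hi, v x * pderiv j (pderiv j (M.eig k)) x =
      -∫ x in Icc lo hi, g x * pderiv j (M.eig k) x by
    simp only [M.pderiv_pderiv_eig] at hmain
    rw [eq_comm, neg_eq_iff_eq_neg] at hmain
    rw [hmain, ← integral_const_mul, ← integral_neg]
    congr 1
    funext x
    ring
  cases bc with
  | periodic => exact h _ ⟨M.contDiff_pderiv_eig j k, (M.isPeriodic_eig k).pderiv j⟩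
  | neumann =>
    -- The partial derivative of the eigenfunction is not compactly supported, so each factor is
    -- approximated from the interior. Only the `j`-th factor gets differentiated; it is the
    -- derivative of a Neumann mode and vanishes at both ends, so its approximations have bounded
    -- derivatives. The other factors need only be bounded, and dominated convergence applies.
    set s : Fin d → ℝ → ℝ := Function.update (fun i => M.mode i (k i)) j (deriv (M.mode j (k j)))
    have hs : ∀ i, ContDiff ℝ ∞ (s i) := M.contDiff_update j k
    choose F hF hsupp hbd hlim hlim' hbd' using fun i => exists_interior_approx (hX i) (hs i)
    choose C hC using hbd
    have hsj : s j = deriv (M.mode j (k j)) := by simp [s]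
    obtain ⟨C', hC'⟩ := hbd' j (by rw [hsj]; exact (M.boundary j (k j)).1)
      (by rw [hsj]; exact (M.boundary j (k j)).2)
    choose a' c' ha' hc' hac' using hsupp
    set ψ : ℕ → (Fin d → ℝ) → ℝ := fun n => prodFun fun i => F i n
    have hψ : ∀ n, ContDiff ℝ ∞ (ψ n) := fun n => contDiff_prodFun fun i => hF i n
    have hts : ∀ n, tsupport (ψ n) ⊆ Icc (fun i => a' i n) (fun i => c' i n) := by
      intro n
      refine closure_minimal (fun x hx => ?_) isClosed_Icc
      have hx' : ∀ i, x i ∈ Icc (a' i n) (c' i n) := by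
        intro i
        by_contra hcon
        exact hx (Finset.prod_eq_zero (Finset.mem_univ i) (hac' i n _ hcon))
      exact ⟨fun i => (hx' i).1, fun i => (hx' i).2⟩
    have htest : ∀ n, IsDerivTestFunction .neumann lo hi (ψ n) := by
      refine fun n => ⟨hψ n, isCompact_Icc.of_isClosed_subset (isClosed_tsupport _) (hts n),
        (hts n).trans fun x hx => ?_⟩
      rw [interior_box]
      exact fun i _ => ⟨(ha' i n).trans_le (hx.1 i), (hx.2 i).trans_lt (hc' i n)⟩
    have hp : ∀ n, pderiv j (ψ n) = prodFun (Function.update (fun i => F i n) j (deriv (F j n))) :=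
      fun n => pderiv_prodFun (fun i => (hF i n).differentiable (by simp)) j
    have hp1 : pderiv j (M.eig k) = prodFun s := M.pderiv_eig j k
    have hp2 : pderiv j (pderiv j (M.eig k)) = prodFun (Function.update s j (deriv (s j))) := by
      rw [hp1, pderiv_prodFun fun i => (hs i).differentiable (by simp)]
    have hvint : IntegrableOn v (Icc lo hi) := (Lp.memLp v).integrable (by norm_num)
    have hgint : IntegrableOn g (Icc lo hi) := (Lp.memLp g).integrable (by norm_num)
    have hcomp : ∀ x ∈ Icc lo hi, ∀ i, x i ∈ Icc (lo i) (hi i) := fun x hx i => ⟨hx.1 i, hx.2 i⟩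
    have hψ' : ∀ n, Continuous (pderiv j (ψ n)) := fun n => by
      refine ((hψ n).continuous_fderiv (by simp)).clm_apply continuous_const
    have key : ∀ (w : L2 lo hi) (Ψ : ℕ → (Fin d → ℝ) → ℝ) (Ψ' : (Fin d → ℝ) → ℝ) (D : ℝ),
        (∀ n, Continuous (Ψ n)) → (∀ n, ∀ x ∈ Icc lo hi, |Ψ n x| ≤ D) →
        (∀ x ∈ interior (Icc lo hi), ∀ᶠ n in atTop, Ψ n x = Ψ' x) →
        Tendsto (fun n => ∫ x in Icc lo hi, w x * Ψ n x) atTop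
          (𝓝 (∫ x in Icc lo hi, w x * Ψ' x)) := by
      intro w Ψ Ψ' D hΨ hΨD hΨl
      have hwint : IntegrableOn w (Icc lo hi) := (Lp.memLp w).integrable (by norm_num)
      refine tendsto_integral_of_dominated_convergence (fun x => |w x| * D)
        (fun n => (integrable_mul_of_continuous w (hΨ n)).aestronglyMeasurable)
        (hwint.abs.mul_const D) (fun n => ?_) ?_
      · filter_upwards [ae_restrict_mem measurableSet_Icc] with x hx
        rw [Real.norm_eq_abs, abs_mul]
        exact mul_le_mul_of_nonneg_left (hΨD n x hx) (abs_nonneg _)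
      · filter_upwards [ae_mem_interior_box lo hi] with x hx
        exact tendsto_const_nhds.congr' ((hΨl x hx).mono fun n hn => by simp only [hn])
    have hL1 := key v (fun n => pderiv j (ψ n)) (pderiv j (pderiv j (M.eig k)))
      (C' * ∏ i ∈ Finset.univ.erase j, C i) hψ' (fun n x hx => by
        rw [hp n, prodFun_update_apply, abs_mul, Finset.abs_prod]
        have hpos : 0 ≤ C' := (abs_nonneg _).trans (hC' n _ (hcomp x hx j))
        gcongr with i hi
        · exact hC' n _ (hcomp x hx j)
        · exact hC i n _ (hcomp x hx i)) (fun x hx => by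
        rw [interior_box] at hx
        have e1 := eventually_all.2 fun i => hlim i (x i) (hx i (mem_univ i))
        filter_upwards [e1, hlim' j (x j) (hx j (mem_univ j))] with n h1 h2
        rw [hp n, hp2, prodFun_update_apply, prodFun_update_apply, h2]
        congr 1
        exact Finset.prod_congr rfl fun i _ => h1 i)
    have hL2 := key g ψ (pderiv j (M.eig k)) (∏ i, C i) (fun n => (hψ n).continuous)
      (fun n x hx => by
        simp only [ψ, prodFun]
        rw [Finset.abs_prod]
        gcongr with i hi
        exact hC i n _ (hcomp x hx i)) (fun x hx => by
        rw [interior_box] at hx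
        have e1 := eventually_all.2 fun i => hlim i (x i) (hx i (mem_univ i))
        filter_upwards [e1] with n h1
        rw [hp1]
        exact Finset.prod_congr rfl fun i _ => h1 i)
    refine tendsto_nhds_unique hL1 ?_
    have : (fun n => ∫ x in Icc lo hi, v x * pderiv j (ψ n) x) =
        fun n => -∫ x in Icc lo hi, g x * ψ n x := funext fun n => h (ψ n) (htest n)
    rw [this]
    exact hL2.neg

end Modes

/-! ### Gradients and their expansion in the modes -/

section Gradient

variable {d : ℕ} {lo hi : Fin d → ℝ}

/-- Square integrable vector fields on the box. -/
abbrev GradL2 (lo hi : Fin d → ℝ) : Type := PiLp 2 fun _ : Fin d => L2 lo hi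

lemma continuous_pderiv {w : (Fin d → ℝ) → ℝ} (hw : ContDiff ℝ 1 w) (j : Fin d) :
    Continuous (pderiv j w) :=
  (hw.continuous_fderiv one_ne_zero).clm_apply continuous_const

lemma _root_.ContDiff.one_of_infty {w : (Fin d → ℝ) → ℝ} (hw : ContDiff ℝ ∞ w) : ContDiff ℝ 1 w :=
  hw.of_le (by exact_mod_cast le_top)

/-- The gradient of a continuously differentiable function, as an element of `L²`. -/
noncomputable def gradL2 (w : (Fin d → ℝ) → ℝ) (hw : ContDiff ℝ 1 w) : GradL2 lo hi :=
  WithLp.toLp 2 fun j => toL2 (pderiv j w) (continuous_pderiv hw j)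

lemma gradL2_apply {w : (Fin d → ℝ) → ℝ} (hw : ContDiff ℝ 1 w) (j : Fin d) :
    (gradL2 w hw : GradL2 lo hi) j = toL2 (pderiv j w) (continuous_pderiv hw j) := rfl

lemma inner_gradL2 {w : (Fin d → ℝ) → ℝ} (hw : ContDiff ℝ 1 w) (v : GradL2 lo hi) :
    ⟪gradL2 w hw, v⟫ = ∑ j, ∫ x in Icc lo hi, v j x * pderiv j w x := by
  rw [PiLp.inner_apply]
  exact Finset.sum_congr rfl fun j _ => inner_toL2 (continuous_pderiv hw j) _

lemma inner_gradL2_gradL2 {w v : (Fin d → ℝ) → ℝ} (hw : ContDiff ℝ 1 w) (hv : ContDiff ℝ 1 v) :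
    ⟪(gradL2 w hw : GradL2 lo hi), gradL2 v hv⟫ =
      ∑ j, ∫ x in Icc lo hi, pderiv j v x * pderiv j w x := by
  rw [PiLp.inner_apply]
  exact Finset.sum_congr rfl fun j _ =>
    inner_toL2_toL2 (continuous_pderiv hw j) (continuous_pderiv hv j)

lemma integral_mul_pderiv_of_tsupport (hX : ∀ i, lo i ≤ hi i) {w φ : (Fin d → ℝ) → ℝ}
    (hw : ContDiff ℝ 1 w) (hφ : ContDiff ℝ 1 φ) (hs : tsupport φ ⊆ interior (Icc lo hi))
    (j : Fin d) :
    ∫ x in Icc lo hi, w x * pderiv j φ x = -∫ x in Icc lo hi, pderiv j w x * φ x := by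
  have hzero : ∀ z : Fin d → ℝ, z j = lo j ∨ z j = hi j → φ z = 0 := by
    intro z hz
    refine image_eq_zero_of_notMem_tsupport fun hz' => ?_
    have h := hs hz'
    rw [interior_box] at h
    have h' := h j (mem_univ j)
    rcases hz with hz | hz
    · exact h'.1.ne' hz
    · exact h'.2.ne hz
  refine integral_mul_pderiv_eq hX j hw hφ fun x _ => ?_
  rw [hzero _ (by simp), hzero (Function.update x j (hi j)) (by simp), mul_zero, mul_zero]

end Gradient

namespace Modes

variable {d : ℕ} {bc : BoundaryCondition} {lo hi : Fin d → ℝ} {I : Type}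

/-- The gradients of the eigenfunctions. -/
noncomputable def gradEig (M : Modes bc lo hi I) (k : Fin d → I) : GradL2 lo hi :=
  gradL2 (M.eig k) (M.contDiff_eig k).one_of_infty

/-- Both derivatives are moved onto the eigenfunction, whose negative Laplacian is ∑ freq² times
itself. Orthogonality and norms of the gradients follow by taking `w` to be an eigenfunction. -/
lemma inner_gradEig_gradL2_eq_sum_freq (M : Modes bc lo hi I) (hX : ∀ i, lo i ≤ hi i)
    {w : (Fin d → ℝ) → ℝ} (hw : IsTestFunction bc lo hi w) (k : Fin d → I) :
    ⟪M.gradEig k, gradL2 w hw.1.one_of_infty⟫ =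
      (∑ j, M.freq j (k j) ^ 2) * ⟪M.basis k, toL2 w hw.1.continuous⟫ := by
  rw [gradEig, inner_gradL2_gradL2, basis_apply, eigL2, inner_toL2_toL2, Finset.sum_mul]
  exact Finset.sum_congr rfl fun j _ => M.integral_pderiv_mul_pderiv_eig hX hw j k

lemma orthogonal_gradEig (M : Modes bc lo hi I) (hX : ∀ i, lo i ≤ hi i) :
    Pairwise fun k l => ⟪M.gradEig k, M.gradEig l⟫ = 0 := by
  intro k l hkl
  refine (M.inner_gradEig_gradL2_eq_sum_freq hX (M.isTestFunction_eig l) k).trans ?_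
  have h := M.orthonormal_eigL2.2 hkl
  rw [basis_apply]
  exact mul_eq_zero_of_right _ h

lemma norm_sq_gradEig (M : Modes bc lo hi I) (hX : ∀ i, lo i ≤ hi i) (k : Fin d → I) :
    ‖M.gradEig k‖ ^ 2 = ∑ j, M.freq j (k j) ^ 2 := by
  rw [← real_inner_self_eq_norm_sq]
  refine (M.inner_gradEig_gradL2_eq_sum_freq hX (M.isTestFunction_eig k) k).trans ?_
  have h : ⟪M.eigL2 k, M.eigL2 k⟫ = 1 := by
    rw [real_inner_self_eq_norm_sq, M.orthonormal_eigL2.1, one_pow]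
  rw [basis_apply]
  exact (congrArg _ h).trans (mul_one _)

lemma inner_gradEig_gradL2 (M : Modes bc lo hi I) (hX : ∀ i, lo i ≤ hi i)
    {w : (Fin d → ℝ) → ℝ} (hw : IsTestFunction bc lo hi w) (k : Fin d → I) :
    ⟪M.gradEig k, gradL2 w hw.1.one_of_infty⟫ =
      ‖M.gradEig k‖ ^ 2 * ⟪M.basis k, toL2 w hw.1.continuous⟫ := by
  rw [M.norm_sq_gradEig hX, M.inner_gradEig_gradL2_eq_sum_freq hX hw]

/-- Weak partial derivatives of a function in `H¹` in terms of its coefficients. -/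
lemma inner_gradEig_of_isWeakPartial (M : Modes bc lo hi I) (hX : ∀ i, lo i < hi i)
    {v : L2 lo hi} {g : GradL2 lo hi} (h : ∀ j, IsWeakPartial bc lo hi j v (g j))
    (k : Fin d → I) : ⟪M.gradEig k, g⟫ = ‖M.gradEig k‖ ^ 2 * ⟪M.basis k, v⟫ := by
  rw [M.norm_sq_gradEig fun i => (hX i).le, gradEig, inner_gradL2, basis_apply, eigL2, inner_toL2,
    Finset.sum_mul]
  exact Finset.sum_congr rfl fun j _ => M.integral_weakPartial_mul_pderiv_eig hX (h j) k

/-- For fixed φ both sides are continuous linear functionals, of `v` and of `g`, so integration by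
parts passes from the modes to the series. The hypothesis `hibp` covers both periodic φ and φ
supported in the interior. -/
lemma integral_mul_pderiv_of_hasSum (M : Modes bc lo hi I) {j : Fin d} {φ : (Fin d → ℝ) → ℝ}
    (hφ : ContDiff ℝ 1 φ) (hibp : ∀ k, ∫ x in Icc lo hi, M.eig k x * pderiv j φ x =
      -∫ x in Icc lo hi, pderiv j (M.eig k) x * φ x) {v : L2 lo hi} {g : GradL2 lo hi}
    (hg : HasSum (fun k => ⟪M.basis k, v⟫ • M.gradEig k) g) :
    ∫ x in Icc lo hi, v x * pderiv j φ x = -∫ x in Icc lo hi, g j x * φ x := by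
  have h1 : HasSum (fun k => ⟪M.basis k, v⟫ • M.basis k) v := by
    simpa only [HilbertBasis.repr_apply_apply] using M.basis.hasSum_repr v
  have h2 := h1.mapL (innerSL ℝ (toL2 (pderiv j φ) (continuous_pderiv hφ j)))
  have h3 := (hg.mapL (PiLp.proj 2 (𝕜 := ℝ) (fun _ : Fin d => L2 lo hi) j)).mapL
    (innerSL ℝ (toL2 φ hφ.continuous))
  simp only [innerSL_apply_apply, PiLp.proj_apply, map_smul, smul_eq_mul] at h2 h3
  rw [← inner_toL2 (continuous_pderiv hφ j), ← inner_toL2 hφ.continuous]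
  refine h2.unique ?_
  refine h3.neg.congr_fun fun k => ?_
  rw [← mul_neg]
  congr 1
  rw [basis_apply, eigL2, inner_toL2_toL2, hibp k]
  congr 1
  rw [gradEig, gradL2_apply, inner_toL2_toL2]

lemma isWeakPartial_of_hasSum (M : Modes bc lo hi I) (hX : ∀ i, lo i ≤ hi i) {v : L2 lo hi}
    {g : GradL2 lo hi} (hg : HasSum (fun k => ⟪M.basis k, v⟫ • M.gradEig k) g) (j : Fin d) :
    IsWeakPartial bc lo hi j v (g j) := by
  intro φ hφ
  refine M.integral_mul_pderiv_of_hasSum hφ.1.one_of_infty (fun k => ?_) hg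
  have hk := (M.contDiff_eig k).one_of_infty
  cases bc with
  | periodic =>
    refine integral_mul_pderiv_eq hX j hk hφ.1.one_of_infty fun x _ => ?_
    rw [(M.isPeriodic_eig k).update_eq j x, IsPeriodic.update_eq hφ.2 j x]
  | neumann => exact integral_mul_pderiv_of_tsupport hX hk hφ.1.one_of_infty hφ.2.2 j

/-- Gradients of test functions are limits of linear combinations of gradients of
eigenfunctions. -/
lemma hasSum_gradL2 (M : Modes bc lo hi I) (hX : ∀ i, lo i ≤ hi i) {w : (Fin d → ℝ) → ℝ}
    (hw : IsTestFunction bc lo hi w) :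
    HasSum (fun k => ⟪M.basis k, toL2 w hw.1.continuous⟫ • M.gradEig k)
      (gradL2 w hw.1.one_of_infty) := by
  have hs : Summable fun k => ⟪M.basis k, toL2 w hw.1.continuous⟫ • M.gradEig k := by
    refine summable_smul_of_orthogonal (M.orthogonal_gradEig hX) ?_
    refine (summable_inner_sq_div (M.orthogonal_gradEig hX)
      (gradL2 w hw.1.one_of_infty)).congr fun k => ?_
    rw [M.inner_gradEig_gradL2 hX hw]
    by_cases h : ‖M.gradEig k‖ = 0
    · simp [h]
    · field_simp
  obtain ⟨g, hg⟩ := hs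
  -- Both sides are weak gradients of `w` when tested with functions supported in the interior, and
  -- these determine an element of L².
  have hgw : g = gradL2 w hw.1.one_of_infty := by
    ext1 j
    refine eq_of_forall_inner_eq fun φ hφ _ hsupp => ?_
    have h1 := M.integral_mul_pderiv_of_hasSum (j := j) hφ.one_of_infty (fun k =>
      integral_mul_pderiv_of_tsupport hX (M.contDiff_eig k).one_of_infty hφ.one_of_infty hsupp j) hg
    have h2 := integral_mul_pderiv_of_tsupport hX hw.1.one_of_infty hφ.one_of_infty hsupp j
    rw [gradL2_apply, inner_toL2_toL2, inner_toL2]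
    rw [← inner_toL2 (continuous_pderiv hφ.one_of_infty j), inner_toL2_toL2, h2, neg_inj] at h1
    exact h1.symm
  rwa [hgw] at hg

end Modes

/-! ### Multiplication by the vector field -/

section FieldOperator

variable {d : ℕ} {lo hi : Fin d → ℝ} {t₀ t₁ : ℝ} {b : ℝ → (Fin d → ℝ) → (Fin d → ℝ)}

/-- The nearest point projection onto the box. -/
def clampBox (hX : ∀ i, lo i ≤ hi i) : C(Fin d → ℝ, Icc lo hi) where
  toFun x := ⟨fun i => max (lo i) (min (hi i) (x i)),
    fun i => le_max_left _ _, fun i => max_le (hX i) (min_le_left _ _)⟩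
  continuous_toFun := by
    refine Continuous.subtype_mk ?_ _
    fun_prop

lemma clampBox_of_mem (hX : ∀ i, lo i ≤ hi i) {x : Fin d → ℝ} (hx : x ∈ Icc lo hi) :
    clampBox hX x = ⟨x, hx⟩ := by
  ext i
  simp only [clampBox, ContinuousMap.coe_mk]
  rw [min_eq_right (hx.2 i), max_eq_right (hx.1 i)]

/-- Multiplication by a continuous vector field as a family of bounded operators. -/
lemma exists_field_operator (hX : ∀ i, lo i ≤ hi i) (ht : t₀ ≤ t₁)
    (hb : ContinuousOn (Function.uncurry b) (Icc t₀ t₁ ×ˢ Icc lo hi)) :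
    ∃ B : ℝ → L2 lo hi →L[ℝ] GradL2 lo hi, Continuous B ∧ ∀ s ∈ Icc t₀ t₁, ∀ v j,
      (B s v) j =ᵐ[volume.restrict (Icc lo hi)] fun x => v x * b s x j := by
  let β : Fin d → C(ℝ × Icc lo hi, ℝ) := fun j =>
    ⟨fun p => b (projIcc t₀ t₁ ht p.1) p.2 j, by
      have h : Continuous fun p : ℝ × Icc lo hi =>
          Function.uncurry b ((projIcc t₀ t₁ ht p.1 : ℝ), (p.2 : Fin d → ℝ)) :=
        hb.comp_continuous (by fun_prop) fun p => ⟨(projIcc t₀ t₁ ht p.1).2, p.2.2⟩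
      exact (continuous_apply j).comp h⟩
  -- Clamping extends the field from the box to a bounded continuous function on the whole space;
  -- the values outside are irrelevant for the restricted measure. Currying over the compact box
  -- makes it depend continuously on time in the supremum norm, hence also as an operator.
  let m : Fin d → ℝ → BoundedContinuousFunction (Fin d → ℝ) ℝ := fun j s =>
    (BoundedContinuousFunction.mkOfCompact ((β j).curry s)).compContinuous (clampBox hX)
  have hm : ∀ j, Continuous (m j) := fun j =>
    (BoundedContinuousFunction.continuous_compContinuous _).comp
      ((ContinuousMap.isometryEquivBoundedOfCompact (Icc lo hi) ℝ).continuous.comp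
        (β j).curry.continuous)
  let Q : Fin d → ℝ → L2 lo hi →L[ℝ] L2 lo hi := fun j s =>
    (ContinuousLinearMap.mul ℝ ℝ).holderL (volume.restrict (Icc lo hi)) ⊤ 2 2
      (BoundedContinuousFunction.toLp ⊤ (volume.restrict (Icc lo hi)) ℝ (m j s))
  have hQ : ∀ j, Continuous (Q j) := fun j =>
    (ContinuousLinearMap.continuous _).comp ((ContinuousLinearMap.continuous _).comp (hm j))
  let ι : Fin d → L2 lo hi →L[ℝ] GradL2 lo hi := fun j =>
    ((PiLp.continuousLinearEquiv 2 ℝ fun _ : Fin d => L2 lo hi).symm :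
      (Fin d → L2 lo hi) →L[ℝ] GradL2 lo hi).comp (ContinuousLinearMap.single ℝ (fun _ => L2 lo hi) j)
  refine ⟨fun s => ∑ j, (ι j).comp (Q j s), ?_, fun s hs v j => ?_⟩
  · refine continuous_finsetSum _ fun j _ => ?_
    have := hQ j
    fun_prop
  · have h1 : (∑ i, (ι i).comp (Q i s)) v j = Q j s v := by
      simp only [_root_.sum_apply, ContinuousLinearMap.comp_apply, WithLp.ofLp_sum,
        Finset.sum_apply, ι]
      rw [Finset.sum_eq_single j]
      · simp
      · intro i _ hij
        simp [hij.symm]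
      · simp
    rw [h1]
    have h2 := (ContinuousLinearMap.mul ℝ ℝ).coeFn_holder (r := 2)
      (BoundedContinuousFunction.toLp ⊤ (volume.restrict (Icc lo hi)) ℝ (m j s)) v
    have h3 := BoundedContinuousFunction.coeFn_toLp ⊤ (volume.restrict (Icc lo hi)) ℝ (m j s)
    filter_upwards [h2, h3, ae_restrict_mem measurableSet_Icc] with x hx2 hx3 hx
    refine hx2.trans ?_
    rw [hx3, ContinuousLinearMap.mul_apply', mul_comm]
    congr 1
    simp only [m, BoundedContinuousFunction.compContinuous_apply,
      BoundedContinuousFunction.mkOfCompact_apply, clampBox_of_mem hX hx]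
    simp [β, projIcc_of_mem ht hs]

end FieldOperator

/-! ### Weak solutions are solutions of the modal equation -/

section WeakSolutions

variable {d : ℕ} {bc : BoundaryCondition} {lo hi : Fin d → ℝ} {I : Type} {t₀ t₁ ε : ℝ}
  {b : ℝ → (Fin d → ℝ) → (Fin d → ℝ)} {B : ℝ → L2 lo hi →L[ℝ] GradL2 lo hi} {u₀ : L2 lo hi}
  {u : ℝ → L2 lo hi}

lemma inner_gradL2_field
    (hBb : ∀ s ∈ Icc t₀ t₁, ∀ v j,
      (B s v) j =ᵐ[volume.restrict (Icc lo hi)] fun x => v x * b s x j)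
    {s : ℝ} (hs : s ∈ Icc t₀ t₁) {w : (Fin d → ℝ) → ℝ} (hw : ContDiff ℝ 1 w) (v : L2 lo hi) :
    ⟪gradL2 w hw, B s v⟫ = ∑ j, ∫ x in Icc lo hi, v x * b s x j * pderiv j w x := by
  rw [inner_gradL2]
  refine Finset.sum_congr rfl fun j _ => integral_congr_ae ?_
  filter_upwards [hBb s hs v j] with x hx
  rw [hx]

/-- Weak solutions satisfy the modal equation. -/
lemma IsWeakSolution.isHeatSolution (M : Modes bc lo hi I) (hX : ∀ i, lo i < hi i) (ht : t₀ ≤ t₁)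
    (hBb : ∀ s ∈ Icc t₀ t₁, ∀ v j,
      (B s v) j =ᵐ[volume.restrict (Icc lo hi)] fun x => v x * b s x j)
    (hu : IsWeakSolution bc lo hi t₀ t₁ ε b u₀ u) :
    IsHeatSolution M.basis M.gradEig (ε ^ 2 / 2) t₀ t₁
      (fun s => B s (u (projIcc t₀ t₁ ht s))) u₀ (fun s => u (projIcc t₀ t₁ ht s)) := by
  obtain ⟨g, -, hgw, hgeq⟩ := hu.weak
  refine ⟨hu.continuousOn.comp_continuous (by fun_prop) fun s => (projIcc t₀ t₁ ht s).2,
    fun k t htt => ?_⟩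
  have heq := hgeq (M.eig k) (M.isTestFunction_eig k) t htt
  have hin : ∀ v : L2 lo hi, ∫ x in Icc lo hi, v x * M.eig k x = ⟪M.basis k, v⟫ := fun v => by
    rw [M.basis_apply, Modes.eigL2, inner_toL2]
  rw [hin, hin, sub_eq_iff_eq_add'] at heq
  rw [projIcc_of_mem ht htt]
  refine heq.trans ?_
  congr 1
  refine intervalIntegral.integral_congr_ae ?_
  rw [uIoc_of_le htt.1]
  have hgw' := (ae_restrict_iff' measurableSet_Icc).1 hgw
  filter_upwards [hgw'] with s hs hsI
  have hs' : s ∈ Icc t₀ t₁ := ⟨hsI.1.le, hsI.2.trans htt.2⟩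
  have h1 := M.inner_gradEig_of_isWeakPartial hX (v := u s)
    (g := WithLp.toLp 2 fun j => g j s) (hs hs') k
  rw [Modes.gradEig, inner_gradL2] at h1
  have h2 := inner_gradL2_field hBb hs' (M.contDiff_eig k).one_of_infty (u s)
  simp only [projIcc_of_mem ht hs']
  rw [Modes.gradEig, h2]
  congr 1
  refine (congrArg (-(ε ^ 2 / 2) * ·) h1).trans ?_
  ring

/-- Solutions of the modal equation are weak solutions. -/
lemma IsHeatSolution.isWeakSolution [Countable I] (M : Modes bc lo hi I) (hX : ∀ i, lo i < hi i)
    (ht : t₀ ≤ t₁) (hε : 0 < ε) (hB : Continuous B)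
    (hBb : ∀ s ∈ Icc t₀ t₁, ∀ v j,
      (B s v) j =ᵐ[volume.restrict (Icc lo hi)] fun x => v x * b s x j)
    (hu : IsHeatSolution M.basis M.gradEig (ε ^ 2 / 2) t₀ t₁ (fun s => B s (u s)) u₀ u) :
    IsWeakSolution bc lo hi t₀ t₁ ε b u₀ u := by
  have hX' : ∀ i, lo i ≤ hi i := fun i => (hX i).le
  have hcu := hu.continuous
  have hBu : Continuous fun s => B s (u s) := by fun_prop
  obtain ⟨g, hgL, hg⟩ := hu.exists_gradient (M.orthogonal_gradEig hX') (by positivity) ht hBu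
  refine ⟨hcu.continuousOn, hu.initial ht, fun j s => g s j, fun j => ?_, ?_, fun w hw t htt => ?_⟩
  · exact (PiLp.proj 2 (𝕜 := ℝ) (fun _ : Fin d => L2 lo hi) j).comp_memLp' hgL
  · filter_upwards [hg] with s hs j
    exact M.isWeakPartial_of_hasSum hX' hs j
  have hgi : IntervalIntegrable g volume t₀ t := by
    rw [intervalIntegrable_iff_integrableOn_Icc_of_le htt.1]
    have h : IntegrableOn g (Icc t₀ t₁) := hgL.integrable (by norm_num)
    exact h.mono_set (Icc_subset_Icc_right htt.2)
  have hBi : IntervalIntegrable (fun s => B s (u s)) volume t₀ t := hBu.intervalIntegrable _ _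
  -- `J` is the time-integrated flux: tested with `w`, the equation says that the inner product of
  -- u(t) - u₀ with `w` equals that of `J` with the gradient of `w`.
  set J : GradL2 lo hi := -(ε ^ 2 / 2) • (∫ s in t₀..t, g s) + ∫ s in t₀..t, B s (u s)
  have hJ : ∀ v : GradL2 lo hi,
      ∫ s in t₀..t, (-(ε ^ 2 / 2) * ⟪v, g s⟫ + ⟪v, B s (u s)⟫) = ⟪v, J⟫ := by
    intro v
    have e1 := (innerSL ℝ v).intervalIntegral_comp_comm hgi
    have e2 := (innerSL ℝ v).intervalIntegral_comp_comm hBi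
    simp only [innerSL_apply_apply] at e1 e2
    have i1 : IntervalIntegrable (fun s => ⟪v, g s⟫) volume t₀ t :=
      ⟨(innerSL ℝ v).integrable_comp hgi.1, (innerSL ℝ v).integrable_comp hgi.2⟩
    have i2 : IntervalIntegrable (fun s => ⟪v, B s (u s)⟫) volume t₀ t :=
      Continuous.intervalIntegrable (by fun_prop) _ _
    rw [intervalIntegral.integral_add (i1.const_mul _) i2, intervalIntegral.integral_const_mul,
      e1, e2]
    simp only [J, inner_add_right, inner_smul_right]
  have hcoef : ∀ k, ⟪M.basis k, u t - u₀⟫ = ⟪M.gradEig k, J⟫ := by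
    intro k
    rw [inner_sub_right, hu.coeff k t htt, add_sub_cancel_left, ← hJ]
    refine intervalIntegral.integral_congr_ae ?_
    rw [uIoc_of_le htt.1]
    have hg' := (ae_restrict_iff' measurableSet_Icc).1 hg
    filter_upwards [hg'] with s hs hsI
    have hs' : s ∈ Icc t₀ t₁ := ⟨hsI.1.le, hsI.2.trans htt.2⟩
    rw [M.inner_gradEig_of_isWeakPartial hX (M.isWeakPartial_of_hasSum hX' (hs hs')) k]
    ring
  -- The identity holds for the modes by `hcoef`; expanding `w` and its gradient with the same
  -- coefficients extends it to every test function.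
  have hfull : ⟪toL2 w hw.1.continuous, u t - u₀⟫ = ⟪gradL2 w hw.1.one_of_infty, J⟫ := by
    have s1 : HasSum (fun k => ⟪M.basis k, toL2 w hw.1.continuous⟫ • M.basis k)
        (toL2 w hw.1.continuous) := by
      simpa only [HilbertBasis.repr_apply_apply] using
        M.basis.hasSum_repr (toL2 w hw.1.continuous)
    have s1' := s1.mapL (innerSL ℝ (u t - u₀))
    have s2' := (M.hasSum_gradL2 hX' hw).mapL (innerSL ℝ J)
    simp only [map_smul, innerSL_apply_apply, smul_eq_mul] at s1' s2'
    rw [real_inner_comm, real_inner_comm J]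
    refine s1'.unique (s2'.congr_fun fun k => ?_)
    exact congrArg _ ((real_inner_comm _ _).trans ((hcoef k).trans (real_inner_comm _ _)))
  rw [← inner_toL2 hw.1.continuous, ← inner_toL2 hw.1.continuous, ← inner_sub_right, hfull, ← hJ]
  refine intervalIntegral.integral_congr fun s hs => ?_
  rw [uIcc_of_le htt.1] at hs
  have hs' : s ∈ Icc t₀ t₁ := ⟨hs.1, hs.2.trans htt.2⟩
  simp only
  rw [inner_gradL2_field hBb hs', inner_gradL2]

end WeakSolutions

/-! ### Entropy dissipation, and invariance under a divergence-free drift -/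

section Entropy

variable {d : ℕ} {bc : BoundaryCondition} {lo hi : Fin d → ℝ} {I : Type} {t₀ t₁ : ℝ}
  {b : ℝ → (Fin d → ℝ) → (Fin d → ℝ)} {B : ℝ → L2 lo hi →L[ℝ] GradL2 lo hi}

lemma IsTestFunction.comp_left {φ : ℝ → ℝ} {w : (Fin d → ℝ) → ℝ} (hw : IsTestFunction bc lo hi w)
    (hφ : ContDiff ℝ ∞ φ) : IsTestFunction bc lo hi fun x => φ (w x) := by
  refine ⟨hφ.comp hw.1, ?_⟩
  cases bc
  · exact fun i x => congrArg φ (hw.2 i x)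
  · trivial

lemma IsTestFunction.sum_mul {K : Type*} {w : K → (Fin d → ℝ) → ℝ}
    (hw : ∀ k, IsTestFunction bc lo hi (w k)) (S : Finset K) (c : K → ℝ) :
    IsTestFunction bc lo hi fun x => ∑ k ∈ S, c k * w k x := by
  refine ⟨ContDiff.sum fun k _ => contDiff_const.mul (hw k).1, ?_⟩
  cases bc
  · exact fun i x => Finset.sum_congr rfl fun k _ => congrArg _ ((hw k).2 i x)
  · trivial

lemma pderiv_comp_left {φ : ℝ → ℝ} {φ' : ℝ} {w : (Fin d → ℝ) → ℝ} (j : Fin d) {x : Fin d → ℝ}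
    (hφ : HasDerivAt φ φ' (w x)) (hw : DifferentiableAt ℝ w x) :
    pderiv j (fun x => φ (w x)) x = φ' * pderiv j w x := by
  have h : HasFDerivAt (fun x => φ (w x)) (φ' • fderiv ℝ w x) x :=
    hφ.comp_hasFDerivAt x hw.hasFDerivAt
  rw [pderiv, h.fderiv]
  simp [pderiv]

lemma pderiv_sum_mul {K : Type*} {w : K → (Fin d → ℝ) → ℝ} (hw : ∀ k, Differentiable ℝ (w k))
    (S : Finset K) (c : K → ℝ) (j : Fin d) (x : Fin d → ℝ) :
    pderiv j (fun x => ∑ k ∈ S, c k * w k x) x = ∑ k ∈ S, c k * pderiv j (w k) x := by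
  have h : HasFDerivAt (fun x => ∑ k ∈ S, c k * w k x) (∑ k ∈ S, c k • fderiv ℝ (w k) x) x :=
    HasFDerivAt.fun_sum fun k _ => (hw k x).hasFDerivAt.const_mul (c k)
  rw [pderiv, h.fderiv]
  simp [pderiv]

lemma toL2_sum_mul {K : Type*} {w : K → (Fin d → ℝ) → ℝ} (hw : ∀ k, Continuous (w k))
    (S : Finset K) (c : K → ℝ) (h : Continuous fun x => ∑ k ∈ S, c k * w k x) :
    (toL2 (fun x => ∑ k ∈ S, c k * w k x) h : L2 lo hi) = ∑ k ∈ S, c k • toL2 (w k) (hw k) := by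
  refine ext_inner_right ℝ fun v => ?_
  rw [inner_toL2, sum_inner]
  simp only [real_inner_smul_left, inner_toL2, Finset.mul_sum, ← integral_const_mul]
  rw [integral_finsetSum]
  · exact Finset.sum_congr rfl fun k _ => integral_congr_ae (.of_forall fun x => by ring)
  · intro k _
    exact integrable_mul_of_continuous v (continuous_const.mul (hw k))

lemma gradL2_sum_mul {K : Type*} {w : K → (Fin d → ℝ) → ℝ} (hw : ∀ k, ContDiff ℝ 1 (w k))
    (S : Finset K) (c : K → ℝ) (h : ContDiff ℝ 1 fun x => ∑ k ∈ S, c k * w k x) :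
    (gradL2 (fun x => ∑ k ∈ S, c k * w k x) h : GradL2 lo hi) =
      ∑ k ∈ S, c k • gradL2 (w k) (hw k) := by
  ext1 j
  have hd : pderiv j (fun x => ∑ k ∈ S, c k * w k x) = fun x => ∑ k ∈ S, c k * pderiv j (w k) x :=
    funext fun x => pderiv_sum_mul (fun k => (hw k).differentiable one_ne_zero) S c j x
  have hc := continuous_pderiv h j
  simp only [gradL2_apply, WithLp.ofLp_sum, Finset.sum_apply, PiLp.smul_apply]
  simp only [hd] at hc ⊢
  exact toL2_sum_mul (fun k => continuous_pderiv (hw k) j) S c hc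

/-- The dissipation of a convex entropy with derivative `φ`. -/
lemma mul_norm_sq_gradL2_comp_le {φ ψ : ℝ → ℝ} {δ : ℝ} (hφ : ∀ s, HasDerivAt φ (ψ s) s)
    (hψ : ∀ s, δ * ψ s ^ 2 ≤ ψ s) {v : (Fin d → ℝ) → ℝ} (hv : ContDiff ℝ 1 v)
    (hφv : ContDiff ℝ 1 fun x => φ (v x)) :
    δ * ‖(gradL2 (fun x => φ (v x)) hφv : GradL2 lo hi)‖ ^ 2 ≤
      ⟪(gradL2 (fun x => φ (v x)) hφv : GradL2 lo hi), gradL2 v hv⟫ := by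
  rw [← real_inner_self_eq_norm_sq, inner_gradL2_gradL2, inner_gradL2_gradL2, Finset.mul_sum]
  refine Finset.sum_le_sum fun j _ => ?_
  rw [← integral_const_mul]
  have hc := continuous_pderiv hφv j
  have hc' := continuous_pderiv hv j
  have hint : ∀ f : (Fin d → ℝ) → ℝ, Continuous f → IntegrableOn f (Icc lo hi) := fun f hf =>
    hf.continuousOn.integrableOn_compact isCompact_Icc
  refine integral_mono (hint _ (by fun_prop)) (hint _ (by fun_prop)) fun x => ?_
  simp only [pderiv_comp_left j (hφ (v x)) (hv.differentiable one_ne_zero x)]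
  -- Pointwise, δ ψ² |∂v|² ≤ ψ |∂v|², which compares δ |∂φ(v)|² with ∂φ(v) ∂v.
  nlinarith [mul_le_mul_of_nonneg_right (hψ (v x)) (sq_nonneg (pderiv j v x))]

lemma IsDivFreeField.sum_integral_mul_pderiv_eq_zero (hb : IsDivFreeField bc lo hi t₀ t₁ b)
    (hX : ∀ i, lo i ≤ hi i) {s : ℝ} (hs : s ∈ Icc t₀ t₁) {w : (Fin d → ℝ) → ℝ}
    (hw : IsTestFunction bc lo hi w) :
    ∑ j, ∫ x in Icc lo hi, b s x j * pderiv j w x = 0 := by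
  rw [← hb.integral_sum_mul_pderiv_eq_zero hX hs hw, integral_finsetSum]
  intro j _
  have hbc : ContinuousOn (b s) (Icc lo hi) :=
    hb.continuousOn.comp (f := fun x => (s, x)) (by fun_prop) fun x hx => ⟨hs, hx⟩
  have hbj : ContinuousOn (fun x => b s x j) (Icc lo hi) :=
    (continuous_apply j).comp_continuousOn hbc
  exact (hbj.mul (continuous_pderiv hw.1.one_of_infty j).continuousOn).integrableOn_compact
    isCompact_Icc

/-- A divergence-free drift does not change an entropy. -/
lemma inner_gradL2_comp_field (hb : IsDivFreeField bc lo hi t₀ t₁ b) (hX : ∀ i, lo i ≤ hi i)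
    (hBb : ∀ s ∈ Icc t₀ t₁, ∀ v j,
      (B s v) j =ᵐ[volume.restrict (Icc lo hi)] fun x => v x * b s x j)
    {s : ℝ} (hs : s ∈ Icc t₀ t₁) {φ ψ G : ℝ → ℝ} (hφ : ∀ r, HasDerivAt φ (ψ r) r)
    (hG : ∀ r, HasDerivAt G (r * ψ r) r) (hGc : ContDiff ℝ ∞ G) {v : (Fin d → ℝ) → ℝ}
    (hv : IsTestFunction bc lo hi v) (hφv : ContDiff ℝ 1 fun x => φ (v x)) :
    ⟪gradL2 (fun x => φ (v x)) hφv, B s (toL2 v hv.1.continuous)⟫ = 0 := by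
  have hGv := hv.comp_left hGc
  have hv1 : Differentiable ℝ v := hv.1.one_of_infty.differentiable one_ne_zero
  rw [inner_gradL2_field hBb hs, ← hb.sum_integral_mul_pderiv_eq_zero hX hs hGv]
  refine Finset.sum_congr rfl fun j _ => integral_congr_ae ?_
  filter_upwards [coeFn_toL2 (lo := lo) (hi := hi) hv.1.continuous] with x hx
  -- By the choice of `G`, the integrand v b · ∇φ(v) equals b · ∇G(v), whose integral vanishes.
  rw [hx, pderiv_comp_left j (hφ (v x)) (hv1 x), pderiv_comp_left j (hG (v x)) (hv1 x)]
  ring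

end Entropy

/-! ### Truncation to finitely many modes -/

section Truncation

variable {d : ℕ} {bc : BoundaryCondition} {lo hi : Fin d → ℝ} {I : Type} {t₀ t₁ ν : ℝ}
  {b : ℝ → (Fin d → ℝ) → (Fin d → ℝ)} {B : ℝ → L2 lo hi →L[ℝ] GradL2 lo hi} {u₀ : L2 lo hi}
  {u : ℝ → L2 lo hi}

namespace Modes

/-- The span of the gradients of finitely many modes. -/
noncomputable def gradSpan (M : Modes bc lo hi I) (S : Finset (Fin d → I)) : Submodule ℝ (GradL2 lo hi) :=
  Submodule.span ℝ (M.gradEig '' (S : Set (Fin d → I)))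

instance (M : Modes bc lo hi I) (S : Finset (Fin d → I)) : FiniteDimensional ℝ (M.gradSpan S) :=
  FiniteDimensional.span_of_finite ℝ (S.finite_toSet.image _)

lemma monotone_gradSpan (M : Modes bc lo hi I) : Monotone M.gradSpan := fun _ _ h =>
  Submodule.span_mono (image_mono (Finset.coe_subset.2 h))

/-- The closed span of the gradients of all modes. -/
noncomputable def gradClosure (M : Modes bc lo hi I) : Submodule ℝ (GradL2 lo hi) :=
  (⨆ S, M.gradSpan S).topologicalClosure

instance (M : Modes bc lo hi I) : CompleteSpace M.gradClosure :=
  (Submodule.isClosed_topologicalClosure _).completeSpace_coe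

lemma gradEig_mem_gradSpan (M : Modes bc lo hi I) {S : Finset (Fin d → I)} {k : Fin d → I}
    (hk : k ∈ S) : M.gradEig k ∈ M.gradSpan S :=
  Submodule.subset_span (mem_image_of_mem _ hk)

lemma gradL2_mem_gradClosure (M : Modes bc lo hi I) (hX : ∀ i, lo i ≤ hi i)
    {w : (Fin d → ℝ) → ℝ} (hw : IsTestFunction bc lo hi w) :
    gradL2 w hw.1.one_of_infty ∈ M.gradClosure := by
  refine mem_closure_of_tendsto (M.hasSum_gradL2 hX hw) (Eventually.of_forall fun S => ?_)
  refine Submodule.sum_mem _ fun k hk => Submodule.smul_mem _ _ ?_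
  exact Submodule.mem_iSup_of_mem S (M.gradEig_mem_gradSpan hk)

/-- Projecting a gradient onto finitely many `gradEig k` is the same as truncating the function and
then taking the gradient. This translates the sum over `S` in the truncated equation into an inner
product of vector fields. -/
lemma starProjection_gradSpan_gradL2 (M : Modes bc lo hi I) (hX : ∀ i, lo i ≤ hi i)
    {w : (Fin d → ℝ) → ℝ} (hw : IsTestFunction bc lo hi w) (S : Finset (Fin d → I)) :
    (M.gradSpan S).starProjection (gradL2 w hw.1.one_of_infty) =
      ∑ k ∈ S, ⟪M.basis k, toL2 w hw.1.continuous⟫ • M.gradEig k := by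
  refine Submodule.eq_starProjection_of_mem_of_inner_eq_zero
    (Submodule.sum_mem _ fun k hk => Submodule.smul_mem _ _ (M.gradEig_mem_gradSpan hk))
    fun v hv => ?_
  induction hv using Submodule.span_induction with
  | mem v hv =>
    obtain ⟨l, hl, rfl⟩ := hv
    rw [real_inner_comm, inner_sub_right, M.inner_gradEig_gradL2 hX hw,
      inner_sum_smul_of_orthogonal (M.orthogonal_gradEig hX) _ hl, mul_comm, sub_self]
  | zero => exact inner_zero_right _
  | add v v' _ _ h h' => rw [inner_add_right, h, h', add_zero]
  | smul c v _ h => rw [inner_smul_right, h, mul_zero]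

/-- The sum of the first terms of the expansion of `v` in the modes. -/
noncomputable def truncate (M : Modes bc lo hi I) (S : Finset (Fin d → I)) (v : L2 lo hi) :
    L2 lo hi := ∑ k ∈ S, ⟪M.basis k, v⟫ • M.basis k

lemma continuous_truncate (M : Modes bc lo hi I) (S : Finset (Fin d → I)) :
    Continuous (M.truncate S) := by
  unfold truncate
  fun_prop

lemma tendsto_truncate (M : Modes bc lo hi I) (v : L2 lo hi) :
    Tendsto (fun S => M.truncate S v) atTop (𝓝 v) := by
  have h : HasSum (fun k => ⟪M.basis k, v⟫ • M.basis k) v := by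
    simpa only [HilbertBasis.repr_apply_apply] using M.basis.hasSum_repr v
  exact h

lemma norm_truncate_le (M : Modes bc lo hi I) (S : Finset (Fin d → I)) (v : L2 lo hi) :
    ‖M.truncate S v‖ ≤ ‖v‖ := by
  refine le_of_sq_le_sq ?_ (norm_nonneg _)
  rw [truncate, norm_sq_sum_smul_of_orthogonal fun k l hkl => M.basis.orthonormal.2 hkl]
  simp only [M.basis.orthonormal.1, one_pow, mul_one]
  exact sum_le_hasSum S (fun k _ => sq_nonneg _) (hasSum_inner_sq M.basis v)

/-- The truncation as a smooth function. -/
noncomputable def truncateFun (M : Modes bc lo hi I) (S : Finset (Fin d → I)) (v : L2 lo hi)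
    (x : Fin d → ℝ) : ℝ := ∑ k ∈ S, ⟪M.basis k, v⟫ * M.eig k x

lemma isTestFunction_truncateFun (M : Modes bc lo hi I) (S : Finset (Fin d → I)) (v : L2 lo hi) :
    IsTestFunction bc lo hi (M.truncateFun S v) :=
  IsTestFunction.sum_mul M.isTestFunction_eig S _

lemma toL2_truncateFun (M : Modes bc lo hi I) (S : Finset (Fin d → I)) (v : L2 lo hi) :
    toL2 (M.truncateFun S v) (M.isTestFunction_truncateFun S v).1.continuous = M.truncate S v := by
  refine (toL2_sum_mul (fun k => (M.contDiff_eig k).continuous) S _ _).trans ?_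
  simp only [truncate, M.basis_apply, eigL2]

lemma gradL2_truncateFun (M : Modes bc lo hi I) (S : Finset (Fin d → I)) (v : L2 lo hi) :
    gradL2 (M.truncateFun S v) (M.isTestFunction_truncateFun S v).1.one_of_infty =
      ∑ k ∈ S, ⟪M.basis k, v⟫ • M.gradEig k :=
  gradL2_sum_mul (fun k => (M.contDiff_eig k).one_of_infty) S _ _

/-- The error made in the drift term by truncating the equation to finitely many modes. -/
noncomputable def remainder (M : Modes bc lo hi I) (B : ℝ → L2 lo hi →L[ℝ] GradL2 lo hi)
    (S : Finset (Fin d → I)) (s : ℝ) (v : L2 lo hi) : GradL2 lo hi :=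
  -- The first term arises from replacing `v` by its truncation in the drift, the second from
  -- projecting the drift onto the modes in `S`. The projection onto `gradClosure`, rather than the
  -- identity, is what the finite projections converge to; it makes no difference when tested with
  -- gradients of test functions.
  B s (v - M.truncate S v) -
    (M.gradClosure.starProjection (B s v) - (M.gradSpan S).starProjection (B s v))

lemma continuous_remainder (M : Modes bc lo hi I) (hB : Continuous B) (S : Finset (Fin d → I))
    (hu : Continuous u) : Continuous fun s => M.remainder B S s (u s) := by
  have := M.continuous_truncate S
  unfold remainder
  fun_prop

lemma tendsto_remainder (M : Modes bc lo hi I) (s : ℝ) (v : L2 lo hi) :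
    Tendsto (fun S => M.remainder B S s v) atTop (𝓝 0) := by
  have h1 : Tendsto (fun S => B s (v - M.truncate S v)) atTop (𝓝 (B s (v - v))) :=
    ((B s).continuous.tendsto _).comp (tendsto_const_nhds.sub (M.tendsto_truncate v))
  have h2 : Tendsto (fun S => (M.gradSpan S).starProjection (B s v)) atTop
      (𝓝 (M.gradClosure.starProjection (B s v))) :=
    Submodule.starProjection_tendsto_closure_iSup M.gradSpan M.monotone_gradSpan _
  have h3 := h1.sub ((tendsto_const_nhds (x := M.gradClosure.starProjection (B s v))).sub h2)
  rwa [sub_self, sub_self, map_zero, sub_zero] at h3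

lemma norm_remainder_le (M : Modes bc lo hi I) {C : ℝ} (hC : 0 ≤ C) {s : ℝ}
    (h : ∀ v, ‖B s v‖ ≤ C * ‖v‖) (S : Finset (Fin d → I)) (v : L2 lo hi) :
    ‖M.remainder B S s v‖ ≤ 4 * C * ‖v‖ := by
  have h1 : ‖v - M.truncate S v‖ ≤ 2 * ‖v‖ :=
    (norm_sub_le _ _).trans (by linarith [M.norm_truncate_le S v])
  have h2 := (h _).trans (mul_le_mul_of_nonneg_left h1 hC)
  have h3 := (M.gradClosure.norm_starProjection_apply_le (B s v)).trans (h v)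
  have h4 := ((M.gradSpan S).norm_starProjection_apply_le (B s v)).trans (h v)
  have h5 := norm_sub_le (B s (v - M.truncate S v))
    (M.gradClosure.starProjection (B s v) - (M.gradSpan S).starProjection (B s v))
  have h6 := norm_sub_le (M.gradClosure.starProjection (B s v))
    ((M.gradSpan S).starProjection (B s v))
  unfold remainder
  linarith

/-- The truncated equation tested with the derivative of an entropy. -/
lemma sum_coeff_mul_inner_le (M : Modes bc lo hi I) (hb : IsDivFreeField bc lo hi t₀ t₁ b)
    (hX : ∀ i, lo i ≤ hi i)
    (hBb : ∀ s ∈ Icc t₀ t₁, ∀ v j,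
      (B s v) j =ᵐ[volume.restrict (Icc lo hi)] fun x => v x * b s x j)
    {s : ℝ} (hs : s ∈ Icc t₀ t₁) (hν : 0 < ν) {φ ψ G : ℝ → ℝ} {δ : ℝ} (hδ : 0 < δ)
    (hφ : ∀ r, HasDerivAt φ (ψ r) r) (hψ : ∀ r, δ * ψ r ^ 2 ≤ ψ r)
    (hG : ∀ r, HasDerivAt G (r * ψ r) r) (hGc : ContDiff ℝ ∞ G) (hφc : ContDiff ℝ ∞ φ)
    (S : Finset (Fin d → I)) (v : L2 lo hi) {w : (Fin d → ℝ) → ℝ}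
    (hw : w = fun x => φ (M.truncateFun S v x)) (hwc : Continuous w) :
    ∑ k ∈ S, (-(ν * ‖M.gradEig k‖ ^ 2) * ⟪M.basis k, v⟫ + ⟪M.gradEig k, B s v⟫) *
        ⟪M.basis k, toL2 w hwc⟫ ≤ ‖M.remainder B S s v‖ ^ 2 / (4 * ν * δ) := by
  have hv := M.isTestFunction_truncateFun S v
  have hwt : IsTestFunction bc lo hi w := hw ▸ hv.comp_left hφc
  set g := gradL2 (lo := lo) (hi := hi) w hwt.1.one_of_infty with hg
  have h1 : δ * ‖g‖ ^ 2 ≤ ⟪g, gradL2 _ hv.1.one_of_infty⟫ := by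
    subst hw
    exact mul_norm_sq_gradL2_comp_le hφ hψ hv.1.one_of_infty _
  have h2 : ⟪g, B s (M.truncate S v)⟫ = 0 := by
    subst hw
    rw [← M.toL2_truncateFun]
    exact inner_gradL2_comp_field hb hX hBb hs hφ hG hGc hv _
  have h3 : ⟪g, M.gradClosure.starProjection (B s v)⟫ = ⟪g, B s v⟫ := by
    rw [← Submodule.inner_starProjection_left_eq_right,
      Submodule.starProjection_eq_self_iff.2 (M.gradL2_mem_gradClosure hX hwt)]
  have h4 : ⟪g, (M.gradSpan S).starProjection (B s v)⟫ =
      ∑ k ∈ S, ⟪M.gradEig k, B s v⟫ * ⟪M.basis k, toL2 w hwc⟫ := by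
    rw [← Submodule.inner_starProjection_left_eq_right, M.starProjection_gradSpan_gradL2 hX hwt,
      sum_inner]
    refine Finset.sum_congr rfl fun k _ => ?_
    rw [real_inner_smul_left, mul_comm]
  have h5 : ⟪g, gradL2 _ hv.1.one_of_infty⟫ =
      ∑ k ∈ S, ‖M.gradEig k‖ ^ 2 * ⟪M.basis k, v⟫ * ⟪M.basis k, toL2 w hwc⟫ := by
    rw [M.gradL2_truncateFun, inner_sum]
    refine Finset.sum_congr rfl fun k _ => ?_
    rw [real_inner_smul_right, real_inner_comm (M.gradEig k) g, M.inner_gradEig_gradL2 hX hwt]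
    ring
  have h6 : ∑ k ∈ S, (-(ν * ‖M.gradEig k‖ ^ 2) * ⟪M.basis k, v⟫ + ⟪M.gradEig k, B s v⟫) *
        ⟪M.basis k, toL2 w hwc⟫ =
      -ν * ⟪g, gradL2 _ hv.1.one_of_infty⟫ + ⟪g, M.remainder B S s v⟫ := by
    rw [remainder, inner_sub_right, inner_sub_right, map_sub, inner_sub_right, h2, h3, h4, h5,
      Finset.mul_sum]
    simp only [add_mul, Finset.sum_add_distrib, neg_mul, mul_assoc, Finset.sum_neg_distrib]
    ring
  have h7 := real_inner_le_norm g (M.remainder B S s v)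
  have h8 := mul_le_mul_of_nonneg_left h1 hν.le
  -- It remains to bound -νδ ‖g‖² + ‖g‖ ‖r‖, with `r` the remainder; completing the square gives the
  -- maximum ‖r‖² / (4νδ).
  rw [h6, le_div_iff₀ (by positivity)]
  nlinarith [sq_nonneg (2 * ν * δ * ‖g‖ - ‖M.remainder B S s v‖), mul_pos hν hδ]

end Modes

end Truncation

/-! ### Integrals of Lipschitz functions of an L² function -/

section EntropyIntegral

variable {d : ℕ} {lo hi : Fin d → ℝ}

lemma one_eq_toL2 : one lo hi = toL2 (fun _ => 1) continuous_const := by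
  refine Lp.ext ?_
  filter_upwards [indicatorConstLp_coeFn (p := 2) (μ := volume.restrict (Icc lo hi))
    (s := Icc lo hi) (hs := measurableSet_Icc) (hμs := isCompact_Icc.measure_lt_top.ne) (c := (1 : ℝ)),
    coeFn_toL2 (lo := lo) (hi := hi) (w := fun _ => (1 : ℝ)) continuous_const,
    ae_restrict_mem measurableSet_Icc] with x h1 h2 hx
  rw [one, h1, h2, indicator_of_mem hx]

lemma inner_one (v : L2 lo hi) : ⟪one lo hi, v⟫ = ∫ x in Icc lo hi, v x := by
  rw [one_eq_toL2, inner_toL2]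
  simp only [mul_one]

lemma integrableOn_coeFn (v : L2 lo hi) : IntegrableOn v (Icc lo hi) :=
  (Lp.memLp v).integrable (by norm_num)

lemma integral_abs_le (v : L2 lo hi) : ∫ x in Icc lo hi, |v x| ≤ ‖one lo hi‖ * ‖v‖ := by
  have h1 : ∫ x in Icc lo hi, |v x| = ⟪one lo hi, |v|⟫ := by
    rw [inner_one]
    exact integral_congr_ae (Lp.coeFn_abs v).symm
  rw [h1, ← norm_abs_eq_norm v]
  exact real_inner_le_norm _ _

variable {j : ℝ → ℝ}

lemma integrableOn_comp (hj : LipschitzWith 1 j) (v : L2 lo hi) :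
    IntegrableOn (fun x => j (v x)) (Icc lo hi) := by
  refine Integrable.mono' (g := fun x => |j 0| + |v x|)
    ((integrable_const _).add (integrableOn_coeFn v).abs)
    (hj.continuous.comp_aestronglyMeasurable (Lp.aestronglyMeasurable v))
    (Eventually.of_forall fun x => ?_)
  have h := hj.dist_le_mul (v x) 0
  rw [Real.dist_eq, Real.dist_eq, NNReal.coe_one, one_mul, sub_zero] at h
  have h' := abs_sub_abs_le_abs_sub (j (v x)) (j 0)
  rw [Real.norm_eq_abs]
  linarith

lemma abs_integral_comp_sub_le (hj : LipschitzWith 1 j) (v w : L2 lo hi) :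
    |(∫ x in Icc lo hi, j (v x)) - ∫ x in Icc lo hi, j (w x)| ≤ ‖one lo hi‖ * ‖v - w‖ := by
  refine le_trans ?_ (integral_abs_le (v - w))
  rw [← integral_sub (integrableOn_comp hj v) (integrableOn_comp hj w)]
  refine abs_integral_le_integral_abs.trans (integral_mono_ae ?_ ?_ ?_)
  · exact ((integrableOn_comp hj v).sub (integrableOn_comp hj w)).abs
  · exact (integrableOn_coeFn (v - w)).abs
  · filter_upwards [Lp.coeFn_sub v w] with x hx
    have h := hj.dist_le_mul (v x) (w x)
    rw [Real.dist_eq, Real.dist_eq, NNReal.coe_one, one_mul] at h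
    rwa [hx]

lemma continuous_integral_comp (hj : LipschitzWith 1 j) :
    Continuous fun v : L2 lo hi => ∫ x in Icc lo hi, j (v x) := by
  refine (LipschitzWith.of_dist_le_mul (K := ⟨‖one lo hi‖, norm_nonneg _⟩) fun v w => ?_).continuous
  rw [Real.dist_eq, dist_eq_norm]
  exact abs_integral_comp_sub_le hj v w

end EntropyIntegral

/-! ### Entropies along solutions -/

section Entropy

variable {d : ℕ} {bc : BoundaryCondition} {lo hi : Fin d → ℝ} {I : Type} {t₀ t₁ ν : ℝ}
  {b : ℝ → (Fin d → ℝ) → (Fin d → ℝ)} {B : ℝ → L2 lo hi →L[ℝ] GradL2 lo hi} {u₀ : L2 lo hi}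
  {u : ℝ → L2 lo hi} {V : ℝ → GradL2 lo hi}

lemma integral_comp_truncate (M : Modes bc lo hi I) (j : ℝ → ℝ) (S : Finset (Fin d → I))
    (v : L2 lo hi) :
    ∫ x in Icc lo hi, j (M.truncate S v x) = ∫ x in Icc lo hi, j (M.truncateFun S v x) := by
  refine integral_congr_ae ?_
  rw [← M.toL2_truncateFun]
  filter_upwards [coeFn_toL2 (lo := lo) (hi := hi)
    (M.isTestFunction_truncateFun S v).1.continuous] with x hx
  rw [hx]

/-- The derivative of an entropy along the truncation of a solution. -/
lemma IsHeatSolution.hasDerivAt_integral_comp_truncateFun (M : Modes bc lo hi I)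
    (hV : Continuous V) (hu : IsHeatSolution M.basis M.gradEig ν t₀ t₁ V u₀ u) {j φ : ℝ → ℝ}
    (hj : ∀ r, HasDerivAt j (φ r) r) (hφ : Continuous φ) (hφ1 : ∀ r, |φ r| ≤ 1)
    (S : Finset (Fin d → I)) {t : ℝ} (ht : t ∈ Ioo t₀ t₁)
    (hwc : Continuous fun x => φ (M.truncateFun S (u t) x)) :
    HasDerivAt (fun t => ∫ x in Icc lo hi, j (M.truncateFun S (u t) x))
      (∑ k ∈ S, (-(ν * ‖M.gradEig k‖ ^ 2) * ⟪M.basis k, u t⟫ + ⟪M.gradEig k, V t⟫) *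
        ⟪M.basis k, toL2 (fun x => φ (M.truncateFun S (u t) x)) hwc⟫) t := by
  have hcu := hu.continuous
  set c : (Fin d → I) → ℝ → ℝ := fun k t =>
    -(ν * ‖M.gradEig k‖ ^ 2) * ⟪M.basis k, u t⟫ + ⟪M.gradEig k, V t⟫ with hc
  have hcc : ∀ k, Continuous (c k) := fun k => by fun_prop
  have hec : ∀ k, Continuous (M.eig k) := fun k => (M.contDiff_eig k).continuous
  have hjc : Continuous j := continuous_iff_continuousAt.2 fun r => (hj r).continuousAt
  have htc : ∀ s, Continuous (M.truncateFun S (u s)) := fun s =>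
    (M.isTestFunction_truncateFun S (u s)).1.continuous
  have hd : ∀ k, ∀ s ∈ Ioo t₀ t₁, HasDerivAt (fun s => ⟪M.basis k, u s⟫) (c k s) s :=
    fun k s hs => hasDerivAt_of_integral_eq (by fun_prop) (by fun_prop) (hu.coeff k) hs
  have hd' : ∀ s ∈ Ioo t₀ t₁, ∀ x, HasDerivAt (fun s => j (M.truncateFun S (u s) x))
      (φ (M.truncateFun S (u s) x) * ∑ k ∈ S, c k s * M.eig k x) s := fun s hs x =>
    -- The truncation is a finite sum of smooth functions with differentiable coefficients, so the
    -- classical chain rule applies pointwise.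
    (hj _).comp s (HasDerivAt.fun_sum fun k _ => (hd k s hs).mul_const _)
  obtain ⟨C, hC⟩ := (isCompact_Icc.prod isCompact_Icc :
    IsCompact (Icc t₀ t₁ ×ˢ Icc lo hi)).exists_bound_of_continuousOn
      (f := fun p : ℝ × (Fin d → ℝ) => ∑ k ∈ S, c k p.1 * M.eig k p.2)
      (Continuous.continuousOn (by fun_prop))
  have hmain := hasDerivAt_integral_of_dominated_loc_of_deriv_le (𝕜 := ℝ)
    (μ := volume.restrict (Icc lo hi)) (F := fun s x => j (M.truncateFun S (u s) x))
    (F' := fun s x => φ (M.truncateFun S (u s) x) * ∑ k ∈ S, c k s * M.eig k x)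
    (bound := fun _ => C) (Ioo_mem_nhds ht.1 ht.2)
    (Eventually.of_forall fun s => (hjc.comp (htc s)).aestronglyMeasurable)
    ((hjc.comp (htc t)).continuousOn.integrableOn_compact isCompact_Icc)
    (Continuous.aestronglyMeasurable (by have := htc t; fun_prop))
    ?_ (integrable_const C) (Eventually.of_forall fun x s hs => hd' s hs x)
  · refine hmain.2.congr_deriv (Eq.symm ?_)
    have hin : ∀ k, ⟪M.basis k, toL2 (fun x => φ (M.truncateFun S (u t) x)) hwc⟫ =
        ∫ x in Icc lo hi, φ (M.truncateFun S (u t) x) * M.eig k x := fun k => by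
      rw [M.basis_apply, Modes.eigL2, inner_toL2_toL2]
    simp only [Finset.mul_sum]
    rw [integral_finsetSum]
    · refine Finset.sum_congr rfl fun k _ => ?_
      rw [hin, ← integral_const_mul]
      exact integral_congr_ae (.of_forall fun x => by ring)
    · intro k _
      have hk := hec k
      exact Continuous.integrableOn_Icc (by fun_prop)
  · filter_upwards [ae_restrict_mem measurableSet_Icc] with x hx s hs
    rw [norm_mul]
    have h1 := hC (s, x) ⟨Ioo_subset_Icc_self hs, hx⟩
    have h2 := mul_le_mul (hφ1 (M.truncateFun S (u s) x)) h1 (norm_nonneg _) zero_le_one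
    rwa [one_mul] at h2

/-- Entropies of the truncation of a solution increase by at most the truncation error. -/
lemma IsHeatSolution.integral_comp_truncate_le (M : Modes bc lo hi I)
    (hb : IsDivFreeField bc lo hi t₀ t₁ b) (hX : ∀ i, lo i ≤ hi i) (hB : Continuous B)
    (hBb : ∀ s ∈ Icc t₀ t₁, ∀ v j,
      (B s v) j =ᵐ[volume.restrict (Icc lo hi)] fun x => v x * b s x j)
    (hν : 0 < ν) (hu : IsHeatSolution M.basis M.gradEig ν t₀ t₁ (fun s => B s (u s)) u₀ u)
    {j φ ψ G : ℝ → ℝ} {δ : ℝ} (hδ : 0 < δ) (hj1 : LipschitzWith 1 j)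
    (hj : ∀ r, HasDerivAt j (φ r) r) (hφ1 : ∀ r, |φ r| ≤ 1)
    (hφ : ∀ r, HasDerivAt φ (ψ r) r) (hψ : ∀ r, δ * ψ r ^ 2 ≤ ψ r)
    (hG : ∀ r, HasDerivAt G (r * ψ r) r) (hGc : ContDiff ℝ ∞ G) (hφc : ContDiff ℝ ∞ φ)
    (S : Finset (Fin d → I)) {t : ℝ} (ht : t ∈ Icc t₀ t₁) :
    ∫ x in Icc lo hi, j (M.truncate S (u t) x) ≤
      (∫ x in Icc lo hi, j (M.truncate S (u t₀) x)) +
        ∫ s in t₀..t, ‖M.remainder B S s (u s)‖ ^ 2 / (4 * ν * δ) := by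
  have hcu := hu.continuous
  have hr := M.continuous_remainder hB S hcu
  have hrc : Continuous fun s => ‖M.remainder B S s (u s)‖ ^ 2 / (4 * ν * δ) := by fun_prop
  set Φ : ℝ → ℝ := fun t => ∫ x in Icc lo hi, j (M.truncate S (u t) x) with hΦ
  set R : ℝ → ℝ := fun t => ∫ s in t₀..t, ‖M.remainder B S s (u s)‖ ^ 2 / (4 * ν * δ) with hR
  have hΦc : Continuous Φ :=
    (continuous_integral_comp hj1).comp ((M.continuous_truncate S).comp hcu)
  have hRd : ∀ s, HasDerivAt R (‖M.remainder B S s (u s)‖ ^ 2 / (4 * ν * δ)) s := fun s =>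
    intervalIntegral.integral_hasDerivAt_right (hrc.intervalIntegrable _ _)
      (hrc.stronglyMeasurableAtFilter _ _) hrc.continuousAt
  have hRc : Continuous R := continuous_iff_continuousAt.2 fun s => (hRd s).continuousAt
  have hΦd : ∀ s ∈ Ioo t₀ t₁, ∃ Φ', HasDerivAt Φ Φ' s ∧
      Φ' ≤ ‖M.remainder B S s (u s)‖ ^ 2 / (4 * ν * δ) := by
    intro s hs
    have hwc : Continuous fun x => φ (M.truncateFun S (u s) x) :=
      hφc.continuous.comp (M.isTestFunction_truncateFun S (u s)).1.continuous
    refine ⟨_, ?_, M.sum_coeff_mul_inner_le hb hX hBb (Ioo_subset_Icc_self hs) hν hδ hφ hψ hG hGc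
      hφc S (u s) rfl hwc⟩
    simp only [hΦ, integral_comp_truncate]
    exact hu.hasDerivAt_integral_comp_truncateFun M (by fun_prop) hj hφc.continuous hφ1 S hs hwc
  have hanti : AntitoneOn (fun s => Φ s - R s) (Icc t₀ t₁) := by
    refine antitoneOn_of_deriv_nonpos (convex_Icc _ _) (hΦc.sub hRc).continuousOn ?_ ?_
    · intro s hs
      rw [interior_Icc] at hs
      obtain ⟨Φ', h, -⟩ := hΦd s hs
      exact (h.sub (hRd s)).differentiableAt.differentiableWithinAt
    · intro s hs
      rw [interior_Icc] at hs
      obtain ⟨Φ', h, h'⟩ := hΦd s hs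
      rw [(h.fun_sub (hRd s)).deriv]
      linarith
  have h := hanti ⟨le_rfl, ht.1.trans ht.2⟩ ht ht.1
  have h0 : R t₀ = 0 := intervalIntegral.integral_same
  simp only [h0, sub_zero] at h
  linarith

/-- Entropies do not increase along solutions. -/
lemma IsHeatSolution.integral_comp_le [Countable I] (M : Modes bc lo hi I)
    (hb : IsDivFreeField bc lo hi t₀ t₁ b) (hX : ∀ i, lo i ≤ hi i) (hB : Continuous B)
    (hBb : ∀ s ∈ Icc t₀ t₁, ∀ v j,
      (B s v) j =ᵐ[volume.restrict (Icc lo hi)] fun x => v x * b s x j)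
    (hν : 0 < ν) (hu : IsHeatSolution M.basis M.gradEig ν t₀ t₁ (fun s => B s (u s)) u₀ u)
    {j φ ψ G : ℝ → ℝ} {δ : ℝ} (hδ : 0 < δ) (hj1 : LipschitzWith 1 j)
    (hj : ∀ r, HasDerivAt j (φ r) r) (hφ1 : ∀ r, |φ r| ≤ 1)
    (hφ : ∀ r, HasDerivAt φ (ψ r) r) (hψ : ∀ r, δ * ψ r ^ 2 ≤ ψ r)
    (hG : ∀ r, HasDerivAt G (r * ψ r) r) (hGc : ContDiff ℝ ∞ G) (hφc : ContDiff ℝ ∞ φ)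
    {t : ℝ} (ht : t ∈ Icc t₀ t₁) :
    ∫ x in Icc lo hi, j (u t x) ≤ ∫ x in Icc lo hi, j (u₀ x) := by
  have hcu := hu.continuous
  have hlim : ∀ s, Tendsto (fun S => ∫ x in Icc lo hi, j (M.truncate S (u s) x)) atTop
      (𝓝 (∫ x in Icc lo hi, j (u s x))) := fun s =>
    ((continuous_integral_comp hj1).tendsto (u s)).comp (M.tendsto_truncate (u s))
  obtain ⟨C, hC0, hC⟩ := exists_norm_clm_le hB t₀ t₁
  -- The remainder tends to 0 at each time and is dominated by 4C ‖u s‖. Dominated convergence along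
  -- the finite sets of modes relies on their countability.
  have hrem : Tendsto (fun S => ∫ s in t₀..t, ‖M.remainder B S s (u s)‖ ^ 2 / (4 * ν * δ)) atTop
      (𝓝 (∫ _ in t₀..t, (0 : ℝ))) := by
    refine intervalIntegral.tendsto_integral_filter_of_dominated_convergence
      (fun s => (4 * C * ‖u s‖) ^ 2 / (4 * ν * δ)) ?_ ?_ ?_ ?_
    · refine Eventually.of_forall fun S => Continuous.aestronglyMeasurable ?_
      have hr := M.continuous_remainder hB S hcu
      fun_prop
    · refine Eventually.of_forall fun S => Eventually.of_forall fun s hs => ?_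
      rw [uIoc_of_le ht.1] at hs
      have h := M.norm_remainder_le hC0 (hC s ⟨hs.1.le, hs.2.trans ht.2⟩) S (u s)
      rw [Real.norm_of_nonneg (by positivity)]
      gcongr
    · exact Continuous.intervalIntegrable (by fun_prop) _ _
    · refine Eventually.of_forall fun s _ => ?_
      have h := ((M.tendsto_remainder (B := B) s (u s)).norm.pow 2).div_const (4 * ν * δ)
      simpa using h
  rw [intervalIntegral.integral_zero] at hrem
  have h := le_of_tendsto_of_tendsto' (hlim t) ((hlim t₀).add hrem) fun S =>
    hu.integral_comp_truncate_le M hb hX hB hBb hν hδ hj1 hj hφ1 hφ hψ hG hGc hφc S ht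
  rwa [add_zero, hu.initial (ht.1.trans ht.2)] at h

end Entropy

/-! ### The entropy √(s² + δ²) -/

section RegularizedAbs

variable {δ : ℝ}

lemma hasDerivAt_sqrt_sq_add (hδ : 0 < δ) (s : ℝ) :
    HasDerivAt (fun s => √(s ^ 2 + δ ^ 2)) (s / √(s ^ 2 + δ ^ 2)) s := by
  have h : HasDerivAt (fun s : ℝ => s ^ 2 + δ ^ 2) (2 * s) s := by
    simpa using (hasDerivAt_pow 2 s).add_const (δ ^ 2)
  convert! h.sqrt (by positivity) using 1
  ring

lemma hasDerivAt_div_sqrt_sq_add (hδ : 0 < δ) (s : ℝ) :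
    HasDerivAt (fun s => s / √(s ^ 2 + δ ^ 2)) (δ ^ 2 / √(s ^ 2 + δ ^ 2) ^ 3) s := by
  have hpos : 0 < √(s ^ 2 + δ ^ 2) := by positivity
  have hsq : √(s ^ 2 + δ ^ 2) ^ 2 = s ^ 2 + δ ^ 2 := Real.sq_sqrt (by positivity)
  convert! (hasDerivAt_id' s).div (hasDerivAt_sqrt_sq_add hδ s) hpos.ne' using 1
  field_simp
  rw [hsq]
  ring

/-- This provides the primitive `G` of r ψ(r), where ψ is the second derivative of the entropy. -/
lemma hasDerivAt_neg_div_sqrt_sq_add (hδ : 0 < δ) (s : ℝ) :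
    HasDerivAt (fun s => -δ ^ 2 / √(s ^ 2 + δ ^ 2)) (s * (δ ^ 2 / √(s ^ 2 + δ ^ 2) ^ 3)) s := by
  have hpos : 0 < √(s ^ 2 + δ ^ 2) := by positivity
  convert! (hasDerivAt_const s (-δ ^ 2)).div (hasDerivAt_sqrt_sq_add hδ s) hpos.ne' using 1
  field_simp
  ring

lemma contDiff_sqrt_sq_add (hδ : 0 < δ) : ContDiff ℝ ∞ fun s : ℝ => √(s ^ 2 + δ ^ 2) :=
  ContDiff.sqrt (by fun_prop) fun s => by positivity

lemma abs_le_sqrt_sq_add (δ s : ℝ) : |s| ≤ √(s ^ 2 + δ ^ 2) :=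
  Real.abs_le_sqrt (by nlinarith [sq_nonneg δ])

lemma sqrt_sq_add_le (hδ : 0 < δ) (s : ℝ) : √(s ^ 2 + δ ^ 2) ≤ |s| + δ := by
  rw [Real.sqrt_le_left (by positivity)]
  nlinarith [sq_abs s, abs_nonneg s]

lemma abs_div_sqrt_sq_add_le (hδ : 0 < δ) (s : ℝ) : |s / √(s ^ 2 + δ ^ 2)| ≤ 1 := by
  rw [abs_div, abs_of_pos (by positivity : 0 < √(s ^ 2 + δ ^ 2)), div_le_one (by positivity)]
  exact abs_le_sqrt_sq_add δ s

lemma lipschitzWith_sqrt_sq_add (hδ : 0 < δ) : LipschitzWith 1 fun s : ℝ => √(s ^ 2 + δ ^ 2) := by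
  refine lipschitzWith_of_nnnorm_deriv_le
    (fun s => (hasDerivAt_sqrt_sq_add hδ s).differentiableAt) fun s => ?_
  rw [(hasDerivAt_sqrt_sq_add hδ s).deriv, ← NNReal.coe_le_coe, coe_nnnorm]
  exact abs_div_sqrt_sq_add_le hδ s

/-- The second derivative of the entropy lies between 0 and 1/δ because the square root is at least
δ. -/
lemma mul_sq_div_sqrt_sq_add_le (hδ : 0 < δ) (s : ℝ) :
    δ * (δ ^ 2 / √(s ^ 2 + δ ^ 2) ^ 3) ^ 2 ≤ δ ^ 2 / √(s ^ 2 + δ ^ 2) ^ 3 := by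
  have hpos : 0 < √(s ^ 2 + δ ^ 2) := by positivity
  have h1 : δ ≤ √(s ^ 2 + δ ^ 2) := Real.le_sqrt_of_sq_le (by nlinarith [sq_nonneg s])
  have h2 : δ * (δ ^ 2 / √(s ^ 2 + δ ^ 2) ^ 3) ≤ 1 := by
    rw [← mul_div_assoc, div_le_one (by positivity), ← pow_succ']
    exact pow_le_pow_left₀ hδ.le h1 3
  have h3 : 0 ≤ δ ^ 2 / √(s ^ 2 + δ ^ 2) ^ 3 := by positivity
  nlinarith [mul_le_mul_of_nonneg_right h2 h3]

end RegularizedAbs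

/-! ### L¹ contraction, conservation of mass and positivity -/

section Positivity

variable {d : ℕ} {bc : BoundaryCondition} {lo hi : Fin d → ℝ} {I : Type} {t₀ t₁ ν ε : ℝ}
  {b : ℝ → (Fin d → ℝ) → (Fin d → ℝ)} {B : ℝ → L2 lo hi →L[ℝ] GradL2 lo hi} {u₀ : L2 lo hi}
  {u : ℝ → L2 lo hi}

/-- The `L¹` norm does not increase along solutions. -/
lemma IsHeatSolution.integral_abs_le [Countable I] (M : Modes bc lo hi I)
    (hb : IsDivFreeField bc lo hi t₀ t₁ b) (hX : ∀ i, lo i ≤ hi i) (hB : Continuous B)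
    (hBb : ∀ s ∈ Icc t₀ t₁, ∀ v j,
      (B s v) j =ᵐ[volume.restrict (Icc lo hi)] fun x => v x * b s x j)
    (hν : 0 < ν) (hu : IsHeatSolution M.basis M.gradEig ν t₀ t₁ (fun s => B s (u s)) u₀ u)
    {t : ℝ} (ht : t ∈ Icc t₀ t₁) :
    ∫ x in Icc lo hi, |u t x| ≤ ∫ x in Icc lo hi, |u₀ x| := by
  have key : ∀ δ > 0, ∫ x in Icc lo hi, |u t x| ≤
      (∫ x in Icc lo hi, |u₀ x|) + volume.real (Icc lo hi) * δ := by
    intro δ hδ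
    have hpos : ∀ s : ℝ, √(s ^ 2 + δ ^ 2) ≠ 0 := fun s => by positivity
    have h1 := hu.integral_comp_le M hb hX hB hBb hν hδ (lipschitzWith_sqrt_sq_add hδ)
      (hasDerivAt_sqrt_sq_add hδ) (abs_div_sqrt_sq_add_le hδ) (hasDerivAt_div_sqrt_sq_add hδ)
      (mul_sq_div_sqrt_sq_add_le hδ) (hasDerivAt_neg_div_sqrt_sq_add hδ)
      (contDiff_const.div (contDiff_sqrt_sq_add hδ) hpos)
      (contDiff_id.div (contDiff_sqrt_sq_add hδ) hpos) ht
    have h2 : ∫ x in Icc lo hi, |u t x| ≤ ∫ x in Icc lo hi, √(u t x ^ 2 + δ ^ 2) :=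
      integral_mono (integrableOn_coeFn _).abs
        (integrableOn_comp (lipschitzWith_sqrt_sq_add hδ) _) fun x => abs_le_sqrt_sq_add δ _
    have h3 : ∫ x in Icc lo hi, √(u₀ x ^ 2 + δ ^ 2) ≤ ∫ x in Icc lo hi, (|u₀ x| + δ) :=
      integral_mono (integrableOn_comp (lipschitzWith_sqrt_sq_add hδ) _)
        ((integrableOn_coeFn _).abs.add (integrable_const _)) fun x => sqrt_sq_add_le hδ _
    rw [integral_add (integrableOn_coeFn _).abs (integrable_const _), setIntegral_const,
      smul_eq_mul] at h3
    exact h2.trans (h1.trans h3)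
  have hlim : Tendsto (fun δ : ℝ => (∫ x in Icc lo hi, |u₀ x|) + volume.real (Icc lo hi) * δ)
      (𝓝[>] 0) (𝓝 ((∫ x in Icc lo hi, |u₀ x|) + volume.real (Icc lo hi) * 0)) :=
    (Continuous.tendsto (by fun_prop) 0).mono_left nhdsWithin_le_nhds
  rw [mul_zero, add_zero] at hlim
  exact ge_of_tendsto hlim (eventually_of_mem self_mem_nhdsWithin key)

lemma isTestFunction_one : IsTestFunction bc lo hi fun _ => 1 := by
  refine ⟨contDiff_const, ?_⟩
  cases bc
  · exact fun _ _ => rfl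
  · trivial

lemma pderiv_const (j : Fin d) (c : ℝ) (x : Fin d → ℝ) : pderiv j (fun _ => c) x = 0 := by
  simp [pderiv]

/-- Conservation of mass. -/
lemma IsWeakSolution.integral_eq (hu : IsWeakSolution bc lo hi t₀ t₁ ε b u₀ u) {t : ℝ}
    (ht : t ∈ Icc t₀ t₁) : ∫ x in Icc lo hi, u t x = ∫ x in Icc lo hi, u₀ x := by
  obtain ⟨g, -, -, h⟩ := hu.weak
  have := h _ isTestFunction_one t ht
  simpa [pderiv_const, sub_eq_zero] using this

lemma nonneg_of_integral_abs_le {v : L2 lo hi}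
    (h : ∫ x in Icc lo hi, |v x| ≤ ∫ x in Icc lo hi, v x) : 0 ≤ v := by
  have hi1 := (integrableOn_coeFn v).abs
  have hi2 := integrableOn_coeFn v
  have h0 : ∫ x in Icc lo hi, (|v x| - v x) = 0 := by
    refine le_antisymm ?_ (integral_nonneg fun x => sub_nonneg.2 (le_abs_self _))
    rw [integral_sub hi1 hi2]
    linarith
  rw [integral_eq_zero_iff_of_nonneg (fun x => sub_nonneg.2 (le_abs_self _)) (hi1.sub hi2)] at h0
  rw [← Lp.coeFn_nonneg]
  filter_upwards [h0] with x hx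
  have hx' : |v x| - v x = 0 := hx
  rw [Pi.zero_apply]
  linarith [abs_nonneg (v x)]

/-- Solutions with non-negative initial value are non-negative. -/
lemma IsWeakSolution.nonneg [Countable I] (M : Modes bc lo hi I)
    (hb : IsDivFreeField bc lo hi t₀ t₁ b) (hX : ∀ i, lo i < hi i) (hε : 0 < ε) (hB : Continuous B)
    (hBb : ∀ s ∈ Icc t₀ t₁, ∀ v j,
      (B s v) j =ᵐ[volume.restrict (Icc lo hi)] fun x => v x * b s x j)
    (hu : IsWeakSolution bc lo hi t₀ t₁ ε b u₀ u) (hu₀ : 0 ≤ u₀) {t : ℝ} (ht : t ∈ Icc t₀ t₁) :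
    0 ≤ u t := by
  have h := (hu.isHeatSolution M hX (ht.1.trans ht.2) hBb).integral_abs_le M hb
    (fun i => (hX i).le) hB hBb (by positivity) ht
  rw [projIcc_of_mem _ ht] at h
  -- The chain is ∫ |u(t)| ≤ ∫ |u₀| = ∫ u₀ = ∫ u(t), which forces |u(t)| = u(t) almost everywhere.
  refine nonneg_of_integral_abs_le (h.trans ?_)
  rw [hu.integral_eq ht]
  refine (integral_congr_ae ?_).le
  filter_upwards [(Lp.coeFn_nonneg _).2 hu₀] with x hx
  exact abs_of_nonneg hx

/-- The constant `1` is a stationary solution. -/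
lemma isHeatSolution_one (M : Modes bc lo hi I) (hb : IsDivFreeField bc lo hi t₀ t₁ b)
    (hX : ∀ i, lo i ≤ hi i)
    (hBb : ∀ s ∈ Icc t₀ t₁, ∀ v j,
      (B s v) j =ᵐ[volume.restrict (Icc lo hi)] fun x => v x * b s x j) :
    IsHeatSolution M.basis M.gradEig ν t₀ t₁ (fun s => B s (one lo hi)) (one lo hi)
      fun _ => one lo hi := by
  refine ⟨continuous_const, fun k t ht => ?_⟩
  have h1 : ‖M.gradEig k‖ ^ 2 * ⟪M.basis k, one lo hi⟫ = 0 := by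
    rw [one_eq_toL2, ← M.inner_gradEig_gradL2 hX isTestFunction_one, Modes.gradEig,
      inner_gradL2_gradL2]
    simp [pderiv_const]
  have h2 : ∀ s ∈ Icc t₀ t₁, ⟪M.gradEig k, B s (one lo hi)⟫ = 0 := by
    intro s hs
    rw [Modes.gradEig, inner_gradL2_field hBb hs,
      ← hb.sum_integral_mul_pderiv_eq_zero hX hs (M.isTestFunction_eig k), one_eq_toL2]
    refine Finset.sum_congr rfl fun j _ => integral_congr_ae ?_
    filter_upwards [coeFn_toL2 (lo := lo) (hi := hi) (w := fun _ => (1 : ℝ)) continuous_const]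
      with x hx
    rw [hx, one_mul]
  rw [intervalIntegral.integral_congr (g := fun _ => 0), intervalIntegral.integral_zero, add_zero]
  intro s hs
  rw [uIcc_of_le ht.1] at hs
  simp only [h2 s ⟨hs.1, hs.2.trans ht.2⟩, neg_mul, mul_assoc, h1, mul_zero, neg_zero, add_zero]

end Positivity

/-! ### The solution operator and its adjoint -/

section Operators

variable {d : ℕ} {lo hi : Fin d → ℝ}

lemma inner_nonneg_of_nonneg {f g : L2 lo hi} (hf : 0 ≤ f) (hg : 0 ≤ g) : 0 ≤ ⟪f, g⟫ := by
  rw [L2.inner_def]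
  refine integral_nonneg_of_ae ?_
  filter_upwards [(Lp.coeFn_nonneg _).2 hf, (Lp.coeFn_nonneg _).2 hg] with x hx hx'
  exact mul_nonneg hx' hx

lemma nonneg_of_forall_inner_nonneg {f : L2 lo hi} (h : ∀ g, 0 ≤ g → 0 ≤ ⟪f, g⟫) : 0 ≤ f := by
  rw [← Lp.coeFn_nonneg]
  refine ae_nonneg_of_forall_setIntegral_nonneg (integrableOn_coeFn f) fun s hs hμ => ?_
  rw [← L2.inner_indicatorConstLp_one (𝕜 := ℝ) hs hμ.ne, real_inner_comm]
  refine h _ ((Lp.coeFn_nonneg _).1 ?_)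
  filter_upwards [indicatorConstLp_coeFn (p := 2) (hs := hs) (hμs := hμ.ne) (c := (1 : ℝ))]
    with x hx
  rw [hx]
  exact indicator_nonneg (fun _ _ => zero_le_one) x

/-- The adjoint of a positive operator that preserves integrals is stochastic. -/
lemma isStochastic_adjoint {P : L2 lo hi →L[ℝ] L2 lo hi} (hpos : ∀ f, 0 ≤ f → 0 ≤ P f)
    (hint : ∀ f, ∫ x in Icc lo hi, P f x = ∫ x in Icc lo hi, f x) :
    IsStochastic (ContinuousLinearMap.adjoint P) := by
  refine ⟨fun f hf => nonneg_of_forall_inner_nonneg fun g hg => ?_, ?_⟩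
  · rw [ContinuousLinearMap.adjoint_inner_left]
    exact inner_nonneg_of_nonneg hf (hpos g hg)
  · refine ext_inner_right ℝ fun f => ?_
    rw [ContinuousLinearMap.adjoint_inner_left, inner_one, inner_one, hint]

variable {bc : BoundaryCondition} {I : Type} {t₀ t₁ ν ε : ℝ}
  {b : ℝ → (Fin d → ℝ) → (Fin d → ℝ)} {B : ℝ → L2 lo hi →L[ℝ] GradL2 lo hi} {u₀ : L2 lo hi}
  {u v : ℝ → L2 lo hi}

lemma IsWeakSolution.eqOn (M : Modes bc lo hi I) (hX : ∀ i, lo i < hi i) (ht : t₀ ≤ t₁)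
    (hε : 0 < ε) (hB : Continuous B)
    (hBb : ∀ s ∈ Icc t₀ t₁, ∀ v j,
      (B s v) j =ᵐ[volume.restrict (Icc lo hi)] fun x => v x * b s x j)
    (hu : IsWeakSolution bc lo hi t₀ t₁ ε b u₀ u) (hv : IsWeakSolution bc lo hi t₀ t₁ ε b u₀ v) :
    EqOn u v (Icc t₀ t₁) := by
  intro t htt
  have h := IsHeatSolution.eqOn (M.orthogonal_gradEig fun i => (hX i).le) (by positivity) hB
    (hu.isHeatSolution M hX ht hBb) (hv.isHeatSolution M hX ht hBb) htt
  simpa only [projIcc_of_mem ht htt] using h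

/-- The solution operator of the modal equation. -/
lemma exists_solution_operator {H G K : Type*} [NormedAddCommGroup H] [InnerProductSpace ℝ H]
    [CompleteSpace H] [NormedAddCommGroup G] [InnerProductSpace ℝ G] [CompleteSpace G]
    (e : HilbertBasis K ℝ H) {f : K → G} (hf : Pairwise fun k l => ⟪f k, f l⟫ = 0)
    (hν : 0 < ν) (ht : t₀ ≤ t₁) {A : ℝ → H →L[ℝ] G} (hA : Continuous A) :
    ∃ P : H →L[ℝ] H, ∀ x, ∃ y, IsHeatSolution e f ν t₀ t₁ (fun s => A s (y s)) x y ∧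
      P x = y t₁ := by
  choose U hU using exists_modal_solution e hf hν ht hA
  obtain ⟨C, hC⟩ := exists_norm_le_of_isHeatSolution e hf hν hA t₀ t₁
  have hbound : ∀ x, ‖U x t₁‖ ≤ C * ‖x‖ := fun x => hC x _ (hU x) t₁ ⟨ht, le_rfl⟩
  -- Linearity comes from uniqueness: a linear combination of solutions solves the equation with the
  -- combined initial value.
  have hlin : ∀ x y (c : ℝ), U (x + c • y) t₁ = U x t₁ + c • U y t₁ := by
    intro x y c
    have hx := (hU x).continuous
    have hy := (hU y).continuous
    have h := (hU x).add_smul (hU y) (by fun_prop) (by fun_prop) c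
    simp only [← map_smul, ← map_add] at h
    exact IsHeatSolution.eqOn hf hν hA (hU _) h ⟨ht, le_rfl⟩
  have hzero : U 0 t₁ = 0 := norm_le_zero_iff.1 (by simpa using hbound 0)
  let L : H →ₗ[ℝ] H :=
    { toFun := fun x => U x t₁
      map_add' := fun x y => by simpa using hlin x y 1
      map_smul' := fun c x => by simpa [hzero] using hlin 0 x c }
  exact ⟨L.mkContinuous C hbound, fun x => ⟨U x, hU x, rfl⟩⟩

end Operators

end FokkerPlanck

theorem lemma2 {d : ℕ} (lo hi : Fin d → ℝ) (hX : ∀ i, lo i < hi i)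
    (bc : FokkerPlanck.BoundaryCondition) (t₀ t₁ : ℝ) (ht : t₀ ≤ t₁) (ε : ℝ) (hε : 0 < ε)
    (b : ℝ → (Fin d → ℝ) → (Fin d → ℝ))
    (hb : FokkerPlanck.IsDivFreeField bc lo hi t₀ t₁ b) :
    (∃! P : FokkerPlanck.L2 lo hi →L[ℝ] FokkerPlanck.L2 lo hi,
      FokkerPlanck.IsTransferOperator bc lo hi t₀ t₁ ε b P) ∧
    ∀ P : FokkerPlanck.L2 lo hi →L[ℝ] FokkerPlanck.L2 lo hi,
      FokkerPlanck.IsTransferOperator bc lo hi t₀ t₁ ε b P →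
        FokkerPlanck.IsStochastic P ∧
          FokkerPlanck.IsStochastic (ContinuousLinearMap.adjoint P) := by
  have hX' : ∀ i, lo i ≤ hi i := fun i => (hX i).le
  have ht₁ : t₁ ∈ Icc t₀ t₁ := ⟨ht, le_rfl⟩
  obtain ⟨I, hI, ⟨M⟩⟩ := FokkerPlanck.exists_modes hX bc
  obtain ⟨B, hB, hBb⟩ := FokkerPlanck.exists_field_operator hX' ht hb.continuousOn
  obtain ⟨P₀, hP₀⟩ := FokkerPlanck.exists_solution_operator M.basis (M.orthogonal_gradEig hX')
    (ν := ε ^ 2 / 2) (by positivity) ht hB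
  refine ⟨⟨P₀, fun u₀ => ?_, fun Q hQ => ?_⟩, fun P hP => ?_⟩
  · obtain ⟨u, hu, hPu⟩ := hP₀ u₀
    have hw := hu.isWeakSolution M hX ht hε hB hBb
    exact ⟨u, hw, fun v hv => hv.eqOn M hX ht hε hB hBb hw, hPu⟩
  · refine ContinuousLinearMap.ext fun u₀ => ?_
    obtain ⟨u, hu, hPu⟩ := hP₀ u₀
    obtain ⟨v, -, huniq, hQv⟩ := hQ u₀
    rw [hPu, hQv, huniq u (hu.isWeakSolution M hX ht hε hB hBb) ht₁]
  · have hpos : ∀ f, 0 ≤ f → 0 ≤ P f := fun f hf => by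
      obtain ⟨u, hu, -, hPu⟩ := hP f
      rw [hPu]
      exact hu.nonneg M hb hX hε hB hBb hf ht₁
    -- `P` fixes 1 because the field is divergence-free; its adjoint fixes 1 because of conservation
    -- of mass.
    refine ⟨⟨hpos, ?_⟩, FokkerPlanck.isStochastic_adjoint hpos fun f => ?_⟩
    · obtain ⟨u, -, huniq, hPu⟩ := hP (FokkerPlanck.one lo hi)
      have hone := (FokkerPlanck.isHeatSolution_one M hb hX' hBb).isWeakSolution M hX ht hε hB hBb
      rw [hPu, ← huniq _ hone ht₁]
    · obtain ⟨u, hu, -, hPu⟩ := hP f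
      rw [hPu, hu.integral_eq ht₁]
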